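/- **Setting.** Let $H$ be a separable complex Hilbert space, $A=A^*>I$ an (in general unbounded) operator in $H$ with compact inverse, and $q(t)$, $t\in(0,1)$, a strongly measurable, uniformly bounded family of bounded self-adjoint operators of $H$. Functions of $A$ are taken through its spectral expansion. For $j>0$ let $H_j=D(A^j)$ with norm $\|A^jf\|$, and let $H_{-j}\supset H$ be the space adjoint to $H_j$ with respect to the scalar product of $H$. Let $\tilde A:H\to H_{-1}$ be the adjoint of $A:H_1\to H$, and write $\varphi(\tilde A)$ likewise for the extension of $\varphi(A)$ to the spaces $H_{-j}$ by duality. In $L_2=L_2(H,(0,1))\oplus H^2$ let $L_0'$ be the operator $$L_0'\{y,y_1,y(1)\}=\{-y''+Ay+qy,\,-y(1),\,y'(1)-y_1\},$$ where $y_1\in H$ and $y$ runs over the infinitely differentiable functions from $[0,1]$ to $H_\infty=\bigcap_jD(A^j)$ (all $A^jy$ being infinitely differentiable in $H$) that vanish near $0$. Let $L_0$ be the closure of $L_0'$ (the minimal operator) and $L_0^*$ its adjoint (the maximal operator). Put $\tilde l z=-z''+\tilde Az+q(t)z$, understood in the sense of $H_{-1}$-valued distributions on $(0,1)$. **Lemma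 2.2.** (a) The domain of $L_0^*$ consists exactly of the triples $Z=\{z,z_1,z(1)\}$ with $z_1\in H$ arbitrary and $$z(t)=e^{-\sqrt{\tilde A}\,t}f+e^{-\sqrt{A}(1-t)}g+\tfrac12\int_0^1e^{-\sqrt{A}|t-s|}A^{-1/2}h(s)\,ds,\qquad 0<t\le1,$$ where $f\in H_{-1/4}$, $g\in H_{1/2}$, $h\in L_2(H,(0,1))$ are arbitrary. Each such $z$ belongs to $L_2(H,(0,1))$ and is differentiable in $H$ on $(0,1]$ (from the left at $1$). (b) On this domain $L_0^*Z=\{\tilde lz,\,-z(1),\,z'(1)-z_1\}$. (c) The domain of $L_0$ consists of those elements of $D(L_0^*)$ for which $z(0)=z'(0)=0$, where $z(0)$ is the limit of $z(t)$ as $t\to0+$ in $H_{-1/4}$, and $z'(0)$ is the limit of $z'(t)$ as $t\to 0+$ in $H_{-3/4}$. (d) For every $z$ as in (a) these two limits exist. If $z_0=z(0)$ and $z_0'=z'(0)+\tilde A^{1/2}z(0)$, then $\tilde A^{-1/4}z_0$ and $\tilde A^{1/4}z_0'$ belong to $H$. -/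

import Mathlib

open MeasureTheory Set Filter Topology
open scoped InnerProductSpace ContDiff

noncomputable section

namespace OpDiff

/-- Lebesgue measure on the interval `(0,1)`. -/
abbrev mu01 : Measure ℝ := volume.restrict (Ioo (0 : ℝ) 1)

variable {H : Type*} [NormedAddCommGroup H] [InnerProductSpace ℂ H] [CompleteSpace H]

/-- `A⁻¹` exists as an everywhere defined operator of `H` and is compact. -/
def HasCompactInverse (A : H →ₗ.[ℂ] H) : Prop :=
  ∃ T : H →L[ℂ] H, IsCompactOperator T ∧
    (∀ y : H, ∃ hy : T y ∈ A.domain, A ⟨T y, hy⟩ = y) ∧ ∀ x : A.domain, T (A x) = (x : H)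

/-! ### Functions of `A`, through its spectral expansion -/

/-- The eigenspace `{x ∈ D(A) : A x = μ x}`. -/
def eigen (A : H →ₗ.[ℂ] H) (μ : ℝ) : Submodule ℂ H where
  carrier := {x | (x, (μ : ℂ) • x) ∈ A.graph}
  add_mem' := by
    intro x y hx hy
    have h := A.graph.add_mem hx hy
    simpa [smul_add] using h
  zero_mem' := by
    have h := A.graph.zero_mem
    change ((0 : H), (μ : ℂ) • (0 : H)) ∈ A.graph
    rw [smul_zero]
    exact h
  smul_mem' := by
    intro c x hx
    have h := A.graph.smul_mem c hx
    simpa [smul_comm c] using h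

/-- The orthogonal projection of `H` onto the eigenspace of `A` at `μ`, which is `0` when `μ` is not
an eigenvalue. (The eigenspaces of a self-adjoint operator are closed, and the closure only serves
to make the projection available for every `A`.) -/
def eigenProj (A : H →ₗ.[ℂ] H) (μ : ℝ) : H →L[ℂ] H :=
  (eigen A μ).topologicalClosure.starProjection

/-- The operator `φ(A) x = ∑_μ φ(μ) P_μ x`, summed over the eigenvalues `μ` of `A`, whose domain is
the set of all `x` for which the series converges. -/
def fnCalc (A : H →ₗ.[ℂ] H) (φ : ℝ → ℝ) : H →ₗ.[ℂ] H where
  domain :=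
    { carrier := {x | Summable fun μ : ℝ => (φ μ : ℂ) • eigenProj A μ x}
      add_mem' := by
        intro x y hx hy
        have h := Summable.add hx hy
        simpa [smul_add] using h
      zero_mem' := by simp
      smul_mem' := by
        intro c x hx
        have h := Summable.const_smul c hx
        simpa [smul_comm c] using h }
  toFun :=
    { toFun := fun x => ∑' μ : ℝ, (φ μ : ℂ) • eigenProj A μ x
      map_add' := by
        intro x y
        rw [← Summable.tsum_add x.2 y.2]
        simp [smul_add]
      map_smul' := by
        intro c x
        rw [RingHom.id_apply, ← Summable.tsum_const_smul c x.2]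
        simp [smul_comm c] }

/-- `φ(A) x` as a total function of `x` (only of use when `φ(A)` is defined on all of `H`). -/
def fnApply (A : H →ₗ.[ℂ] H) (φ : ℝ → ℝ) (x : H) : H :=
  ∑' μ : ℝ, (φ μ : ℂ) • eigenProj A μ x

/-- The power `A ^ s`. For `s > 0` its domain with the norm `‖A ^ s x‖` is the space `H_s`. -/
def opPow (A : H →ₗ.[ℂ] H) (s : ℝ) : H →ₗ.[ℂ] H := fnCalc A fun μ => μ ^ s

/-- The function `μ ↦ exp (-t √μ)`, for which `φ(A) = exp (-t √A)`. -/
def expSqrt (t : ℝ) : ℝ → ℝ := fun μ => Real.exp (-(t * √μ))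

/-! ### Spaces of negative order -/

/-- The conjugate-linear functionals on `D(B)` that are bounded for the norm `‖B v‖`. For
`B = A ^ s` this is `H_{-s}`, the space adjoint to `H_s` with respect to the scalar product of `H`:
a vector `x ∈ H` is identified with the functional `v ↦ ⟪v, x⟫`. -/
def NegSpace (B : H →ₗ.[ℂ] H) : Submodule ℂ (B.domain →ₗ⋆[ℂ] ℂ) where
  carrier := {F | ∃ C : ℝ, ∀ v : B.domain, ‖F v‖ ≤ C * ‖B v‖}
  add_mem' := by
    rintro F G ⟨C, hC⟩ ⟨D, hD⟩
    refine ⟨C + D, fun v => ?_⟩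
    calc ‖(F + G) v‖ ≤ ‖F v‖ + ‖G v‖ := norm_add_le _ _
      _ ≤ C * ‖B v‖ + D * ‖B v‖ := add_le_add (hC v) (hD v)
      _ = (C + D) * ‖B v‖ := by ring
  zero_mem' := ⟨0, fun v => by simp⟩
  smul_mem' := by
    rintro c F ⟨C, hC⟩
    refine ⟨‖c‖ * C, fun v => ?_⟩
    calc ‖(c • F) v‖ = ‖c‖ * ‖F v‖ := norm_smul c (F v)
      _ ≤ ‖c‖ * (C * ‖B v‖) := by gcongr; exact hC v
      _ = ‖c‖ * C * ‖B v‖ := by ring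

/-- Convergence of `H`-valued functions `u` to `F` in the norm of the space `NegSpace B`, that is,
`sup {|⟪v, u t⟫ - F v| : ‖B v‖ ≤ 1} → 0`. -/
def TendstoNeg {B : H →ₗ.[ℂ] H} (u : ℝ → H) (l : Filter ℝ) (F : NegSpace B) : Prop :=
  ∀ ε : ℝ, 0 < ε → ∀ᶠ t in l, ∀ v : B.domain, ‖⟪(v : H), u t⟫_ℂ - F.1 v‖ ≤ ε * ‖B v‖

/-- `φ(Ã) F = x`, where `F ∈ NegSpace B` and the result `x` lies in `H`. The operator `φ(Ã)` is the
adjoint of `φ(A)` with respect to the scalar product of `H`: `⟪v, φ(Ã) F⟫ = F (φ(A) v)`. -/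
def IsExtApply {B : H →ₗ.[ℂ] H} (A : H →ₗ.[ℂ] H) (φ : ℝ → ℝ) (F : NegSpace B) (x : H) : Prop :=
  ∀ (v : (fnCalc A φ).domain) (hv : fnCalc A φ v ∈ B.domain),
    ⟪(v : H), x⟫_ℂ = F.1 ⟨fnCalc A φ v, hv⟩

/-- The vector `φ(Ã) F` of `H`, when there is one. -/
def extApply {B : H →ₗ.[ℂ] H} (A : H →ₗ.[ℂ] H) (φ : ℝ → ℝ) (F : NegSpace B) : H :=
  Classical.epsilon (IsExtApply A φ F)

/-- The operator `Ã : H → H_{-1}` adjoint to `A : H_1 → H`. -/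
def tildeA (A : H →ₗ.[ℂ] H) (x : H) : NegSpace A :=
  ⟨{ toFun := fun v => ⟪A v, x⟫_ℂ
     map_add' := by intro v w; rw [A.map_add, inner_add_left]
     map_smul' := by intro c v; rw [A.map_smul, inner_smul_left]; rfl },
   ‖x‖, fun v => by
     rw [mul_comm]
     exact norm_inner_le_norm (A v) x⟩

/-! ### The Hilbert space and the minimal operator -/

variable (H) in
/-- The space `L_2(H, (0,1))`. -/
abbrev L2H : Type _ := Lp H 2 mu01

variable (H) in
/-- The Hilbert space `L_2 = L_2(H, (0,1)) ⊕ H²` of triples `{y, y₁, y₂}`; the components of `Y` are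
`Y.fst`, `Y.snd.fst` and `Y.snd.snd`. -/
abbrev BigL2 : Type _ := WithLp 2 (L2H H × WithLp 2 (H × H))

/-- `y = u 0` is an infinitely differentiable function from `[0,1]` to `H_∞ = ⋂ D(A ^ j)` that
vanishes in a neighbourhood of zero, and `u j = A ^ j y`. Differentiability is in the topology of
`H_∞`, that is, all the functions `A ^ j y` are infinitely differentiable in `H`. -/
def IsSmooth0 (A : H →ₗ.[ℂ] H) (u : ℕ → ℝ → H) : Prop :=
  (∀ j, ContDiffOn ℝ ∞ (u j) (Icc 0 1)) ∧
  (∀ j, ∀ t ∈ Icc (0 : ℝ) 1, (u j t, u (j + 1) t) ∈ A.graph) ∧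
  ∃ δ : ℝ, 0 < δ ∧ ∀ t ∈ Icc (0 : ℝ) 1, t < δ → u 0 t = 0

/-- The pair `(Y, W)` is in the graph of `L'_0`: `Y = {y, y₁, y(1)}` with `y` smooth, `H_∞`-valued
and zero near `0`, and `W = {-y'' + A y + q y, -y(1), y'(1) - y₁}`. -/
def IsMinPair (A : H →ₗ.[ℂ] H) (q : ℝ → H →L[ℂ] H) (P : BigL2 H × BigL2 H) : Prop :=
  ∃ u : ℕ → ℝ → H, IsSmooth0 A u ∧
    P.1.fst =ᵐ[mu01] u 0 ∧ P.1.snd.snd = u 0 1 ∧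
    (P.2.fst =ᵐ[mu01] fun t =>
      -iteratedDerivWithin 2 (u 0) (Icc 0 1) t + u 1 t + q t (u 0 t)) ∧
    P.2.snd.fst = -u 0 1 ∧
    P.2.snd.snd = derivWithin (u 0) (Icc 0 1) 1 - P.1.snd.fst

/-- The graph of `L'_0`. -/
def minGraph (A : H →ₗ.[ℂ] H) (q : ℝ → H →L[ℂ] H) : Submodule ℂ (BigL2 H × BigL2 H) where
  carrier := {P | IsMinPair A q P}
  add_mem' := by
    rintro P Q ⟨u, ⟨hu1, hu2, δ, hδ, hu3⟩, a1, a2, a3, a4, a5⟩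
      ⟨w, ⟨hw1, hw2, ε, hε, hw3⟩, b1, b2, b3, b4, b5⟩
    have huI := uniqueDiffOn_Icc (zero_lt_one (α := ℝ))
    have m1 : (1 : ℝ) ∈ Icc (0 : ℝ) 1 := by simp
    refine ⟨fun j => u j + w j, ⟨fun j => (hu1 j).add (hw1 j),
      fun j t ht => A.graph.add_mem (hu2 j t ht) (hw2 j t ht),
      min δ ε, lt_min hδ hε, fun t ht h => ?_⟩, ?_, ?_, ?_, ?_, ?_⟩
    · simp [hu3 t ht (h.trans_le (min_le_left _ _)), hw3 t ht (h.trans_le (min_le_right _ _))]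
    · exact (Lp.coeFn_add P.1.fst Q.1.fst).trans (a1.add b1)
    · simp [a2, b2]
    · refine (Lp.coeFn_add P.2.fst Q.2.fst).trans ((a3.add b3).trans ?_)
      filter_upwards [ae_restrict_mem measurableSet_Ioo] with t ht
      have ht' := Ioo_subset_Icc_self ht
      rw [iteratedDerivWithin_add ht' huI (((hu1 0) t ht').of_le (mod_cast le_top : ((2 : ℕ∞) : WithTop ℕ∞) ≤ ∞))
        (((hw1 0) t ht').of_le (mod_cast le_top : ((2 : ℕ∞) : WithTop ℕ∞) ≤ ∞))]
      simp only [Pi.add_apply, map_add]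
      abel
    · simp [a4, b4]; abel
    · have e : derivWithin (u 0 + w 0) (Icc 0 1) 1 =
          derivWithin (u 0) (Icc 0 1) 1 + derivWithin (w 0) (Icc 0 1) 1 :=
        derivWithin_add ((hu1 0).differentiableOn (by simp) 1 m1)
          ((hw1 0).differentiableOn (by simp) 1 m1)
      simp [a5, b5, e]; abel
  zero_mem' := by
    refine ⟨fun _ _ => 0, ⟨fun j => contDiffOn_const, fun j t ht => A.graph.zero_mem, 1,
      one_pos, fun t _ _ => rfl⟩, Lp.coeFn_zero H 2 mu01, rfl, ?_, by simp, by simp⟩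
    refine (Lp.coeFn_zero H 2 mu01).trans (Eventually.of_forall fun t => ?_)
    simp
  smul_mem' := by
    rintro c P ⟨u, ⟨hu1, hu2, δ, hδ, hu3⟩, a1, a2, a3, a4, a5⟩
    have huI := uniqueDiffOn_Icc (zero_lt_one (α := ℝ))
    have m1 : (1 : ℝ) ∈ Icc (0 : ℝ) 1 := by simp
    refine ⟨fun j => c • u j, ⟨fun j => contDiffOn_const.smul (hu1 j),
      fun j t ht => A.graph.smul_mem c (hu2 j t ht),
      δ, hδ, fun t ht h => by simp [hu3 t ht h]⟩, ?_, ?_, ?_, ?_, ?_⟩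
    · exact (Lp.coeFn_smul c P.1.fst).trans (a1.const_smul c)
    · simp [a2]
    · refine (Lp.coeFn_smul c P.2.fst).trans ((a3.const_smul c).trans ?_)
      filter_upwards [ae_restrict_mem measurableSet_Ioo] with t ht
      have ht' := Ioo_subset_Icc_self ht
      rw [iteratedDerivWithin_const_smul ht' huI c (((hu1 0) t ht').of_le (mod_cast le_top : ((2 : ℕ∞) : WithTop ℕ∞) ≤ ∞))]
      simp [smul_add]
    · simp [a4]
    · have e : derivWithin (c • u 0) (Icc 0 1) 1 = c • derivWithin (u 0) (Icc 0 1) 1 :=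
        derivWithin_const_smul c ((hu1 0).differentiableOn (by simp) 1 m1)
      simp [a5, e, smul_sub]

set_option linter.unusedSectionVars false in
/-- The relation `minGraph` is single-valued. -/
theorem minGraph_functional (A : H →ₗ.[ℂ] H) (q : ℝ → H →L[ℂ] H) :
    ∀ P ∈ minGraph A q, P.1 = 0 → P.2 = 0 := by
  rintro ⟨Y, W⟩ ⟨u, ⟨hu1, hu2, δ, hδ, hu3⟩, a1, a2, a3, a4, a5⟩ h
  dsimp only at a1 a2 a3 a4 a5 h
  subst h
  have m1 : (1 : ℝ) ∈ Icc (0 : ℝ) 1 := by simp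
  have e0 : EqOn (u 0) (fun _ => 0) (Icc 0 1) := by
    refine Measure.eqOn_Icc_of_ae_eq volume zero_ne_one ?_ (hu1 0).continuousOn
      continuousOn_const
    rw [← restrict_Ioo_eq_restrict_Icc]
    exact a1.symm.trans (Lp.coeFn_zero H 2 mu01)
  have e1 : ∀ t ∈ Icc (0 : ℝ) 1, u 1 t = 0 := fun t ht =>
    A.graph_fst_eq_zero_snd (hu2 0 t ht) (e0 ht)
  have c1 : W.fst = 0 := by
    refine Lp.ext (a3.trans ?_)
    refine EventuallyEq.trans ?_ (Lp.coeFn_zero H 2 mu01).symm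
    filter_upwards [ae_restrict_mem measurableSet_Ioo] with t ht
    have ht' := Ioo_subset_Icc_self ht
    rw [iteratedDerivWithin_congr e0 ht', e1 t ht', e0 ht']
    simp
  have c2 : W.snd.fst = 0 := by rw [a4, e0 m1]; simp
  have c3 : W.snd.snd = 0 := by
    rw [a5, derivWithin_congr e0 (e0 m1)]; simp
  refine WithLp.ofLp_injective 2 (Prod.ext c1 (WithLp.ofLp_injective 2 (Prod.ext c2 c3)))

/-- The operator `L'_0`. -/
def preMinOp (A : H →ₗ.[ℂ] H) (q : ℝ → H →L[ℂ] H) : BigL2 H →ₗ.[ℂ] BigL2 H :=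
  (minGraph A q).toLinearPMap

/-- The minimal operator `L_0`, the closure of `L'_0`. -/
def minOp (A : H →ₗ.[ℂ] H) (q : ℝ → H →L[ℂ] H) : BigL2 H →ₗ.[ℂ] BigL2 H :=
  (preMinOp A q).closure

/-- The maximal operator `L_0*`. -/
def maxOp (A : H →ₗ.[ℂ] H) (q : ℝ → H →L[ℂ] H) : BigL2 H →ₗ.[ℂ] BigL2 H :=
  (minOp A q).adjoint

/-! ### The expression `l̃` and the representation formula -/

/-- `w = -z'' + Ã z + q z`, as an equality of `H_{-1}`-valued distributions on `(0,1)`. -/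
def IsTildeL (A : H →ₗ.[ℂ] H) (q : ℝ → H →L[ℂ] H) (z w : L2H H) : Prop :=
  ∀ φ : ℝ → ℝ, ContDiff ℝ ∞ φ → HasCompactSupport φ → tsupport φ ⊆ Ioo 0 1 →
    ∀ v : A.domain,
      (∫ t, (-(((iteratedDeriv 2 φ t : ℝ) : ℂ) * ⟪(v : H), z t⟫_ℂ) + (φ t : ℂ) * (tildeA A (z t)).1 v
        + (φ t : ℂ) * ⟪(v : H), q t (z t)⟫_ℂ) ∂mu01) =
      ∫ t, (φ t : ℂ) * ⟪(v : H), w t⟫_ℂ ∂mu01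

/-- For `0 < t ≤ 1`, the value
`exp (-t √Ã) f + exp (-(1 - t) √A) g + 1/2 ∫₀¹ exp (-|t - s| √A) A^(-1/2) h(s) ds`. -/
def sol (A : H →ₗ.[ℂ] H) (f : NegSpace (opPow A (1 / 4))) (g : (opPow A (1 / 2)).domain)
    (h : L2H H) (t : ℝ) : H :=
  extApply A (expSqrt t) f + fnApply A (expSqrt (1 - t)) g +
    (1 / 2 : ℂ) • ∫ s, fnApply A (expSqrt |t - s|) (fnApply A (fun μ => μ ^ (-(1 / 2) : ℝ)) (h s))
      ∂mu01

/-- `Z = {z(t), z₁, z(1)}` with some `z₁ ∈ H`, where `z` is the function `sol A f g h`. -/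
def Represents (A : H →ₗ.[ℂ] H) (f : NegSpace (opPow A (1 / 4))) (g : (opPow A (1 / 2)).domain)
    (h : L2H H) (Z : BigL2 H) : Prop :=
  Z.fst =ᵐ[mu01] sol A f g h ∧ Z.snd.snd = sol A f g h 1

/-- The derivative `z'` of `z = sol A f g h` in the norm of `H` on `(0,1]`, one-sided at `1`. -/
def solDeriv (A : H →ₗ.[ℂ] H) (f : NegSpace (opPow A (1 / 4))) (g : (opPow A (1 / 2)).domain)
    (h : L2H H) (t : ℝ) : H :=
  derivWithin (sol A f g h) (Ioc 0 1) t

end OpDiff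

end

open MeasureTheory Set Filter Topology
open scoped InnerProductSpace ContDiff

noncomputable section

namespace OpDiff

set_option linter.unusedSectionVars false

variable {H : Type*} [NormedAddCommGroup H] [InnerProductSpace ℂ H] [CompleteSpace H]

/-! ### Coordinates in a Hilbert basis -/

section Coordinates

variable {ι : Type*} (b : HilbertBasis ι ℂ H)

include b

/-! The inverse of A is compact and symmetric, so H has an orthonormal basis of eigenvectors b_i of
A with eigenvalues λ_i > 1 (`exists_isDiag`). In this basis φ(A) multiplies the i-th coordinate by
φ(λ_i), H_{-s} is the image of H under the extended power of A (`exists_toNeg`), and the coordinates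
of `sol` solve -y'' + ρ²y = h_i with ρ = √λ_i (`coord_sol`). What remains is one scalar equation,
together with estimates uniform in ρ that reassemble vectors of H and functions in L_2 from scalar
solutions. The family q acts as a symmetric operator Q on L_2 (`exists_mulOp`) and drops out of
every symmetric identity; the free parameter h is the first component of L_0^*Z minus qz.

The orders of f and g are those of the coefficients a_i of exp(-ρt) and c_i of exp(-ρ(1 - t)). Since
ρ∫exp(-2ρt)dt is bounded, a_i = λ_i^(1/4) x_i with x in H gives a function in L_2 (`memLp_sol`);
conversely z in L_2 and z(1) in H force this growth of a_i (`coef_bound`), and then z'(1) in H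
forces g in H_{1/2} (`coef_bound_right`).

The operators are found through Green's formula (`hasSum_green`). The last two components of the
triples cancel the boundary form at 1, so only the form at 0 survives. Smooth elements vanishing
near 0 have zero Cauchy data there, hence every represented triple lies in the domain of the
adjoint. Conversely, an element of the graph of the adjoint is tested against φ b_i with φ zero near
0 and free at 1, which identifies each coordinate with a scalar solution
(`exists_isMaxPair_of_orthogonal`).

The closure of the graph of L_0' is its second annihilator for the symplectic form of the graph
space (`mem_topologicalClosure_of_annihilator`). It therefore consists of the elements of the
maximal graph whose boundary form at 0 vanishes against the whole maximal graph. The solutions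
exp(-ρt)b_i and exp(-ρ(1 - t))b_i separate the Cauchy data in each coordinate, so this means z(0) =
z'(0) = 0 (`mem_minOp_graph`). The limits at 0 exist by dominated convergence in coordinates, and in
z'(0) + Ã^(1/2) z(0) the contribution of f cancels, which makes this combination more regular than
its two terms (`exists_coord_boundary`). -/

theorem coord_ext {x y : H} (h : ∀ i, ⟪b i, x⟫_ℂ = ⟪b i, y⟫_ℂ) : x = y := by
  apply b.repr.injective
  ext i
  simpa [HilbertBasis.repr_apply_apply] using h i

theorem hasSum_sq_coord (x : H) : HasSum (fun i => ‖⟪b i, x⟫_ℂ‖ ^ 2) (‖x‖ ^ 2) := by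
  have h := b.hasSum_inner_mul_inner x x
  have h2 := (Complex.hasSum_iff _ _).1 h
  have h3 := h2.1
  convert h3 using 1
  · funext i
    rw [← inner_conj_symm x (b i), ← Complex.normSq_eq_conj_mul_self, Complex.ofReal_re,
      Complex.normSq_eq_norm_sq]
  · rw [inner_self_eq_norm_sq_to_K]
    norm_cast

theorem summable_sq_coord (x : H) : Summable fun i => ‖⟪b i, x⟫_ℂ‖ ^ 2 :=
  (hasSum_sq_coord b x).summable

theorem norm_sq_eq_tsum (x : H) : ‖x‖ ^ 2 = ∑' i, ‖⟪b i, x⟫_ℂ‖ ^ 2 :=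
  (hasSum_sq_coord b x).tsum_eq.symm

theorem norm_coord_le (x : H) (i : ι) : ‖⟪b i, x⟫_ℂ‖ ≤ ‖x‖ := by
  simpa [b.orthonormal.1 i] using norm_inner_le_norm (𝕜 := ℂ) (b i) x

theorem exists_coord {a : ι → ℂ} (h : Summable fun i => ‖a i‖ ^ 2) :
    ∃ x : H, ∀ i, ⟪b i, x⟫_ℂ = a i := by
  have hm : Memℓp a 2 := by
    refine memℓp_gen ?_
    simpa using h
  refine ⟨b.repr.symm ⟨a, hm⟩, fun i => ?_⟩
  rw [← b.repr_apply_apply]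
  simp

theorem exists_coord_of_le {a : ι → ℂ} {B : ι → ℝ} (hB : Summable fun i => B i ^ 2)
    (h : ∀ i, ‖a i‖ ≤ B i) : ∃ x : H, ∀ i, ⟪b i, x⟫_ℂ = a i :=
  exists_coord b (hB.of_nonneg_of_le (fun _ => sq_nonneg _)
    fun i => pow_le_pow_left₀ (norm_nonneg _) (h i) 2)

theorem inner_basis (i j : ι) [Decidable (i = j)] : ⟪b i, b j⟫_ℂ = if i = j then 1 else 0 := by
  classical
  have := (orthonormal_iff_ite.1 b.orthonormal) i j
  rw [this]
  congr

/-- Distinct basis vectors are at distance at least 1, so balls of radius 1/2 around them are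
disjoint. Countability is what allows measurability, and statements almost everywhere, to be checked
one coordinate at a time. -/
theorem countable_of_hilbertBasis [TopologicalSpace.SeparableSpace H] : Countable ι := by
  classical
  have hd : ∀ i j : ι, i ≠ j → 1 ≤ dist (b i) (b j) := by
    intro i j hij
    have h1 := norm_coord_le b (b i - b j) i
    rw [inner_sub_right, inner_basis b, inner_basis b, if_pos rfl, if_neg hij] at h1
    rw [dist_eq_norm]
    simpa using h1
  refine Set.countable_univ_iff.1 (Set.PairwiseDisjoint.countable_of_isOpen
    (s := fun i => Metric.ball (b i) (1 / 2)) ?_ (fun i _ => Metric.isOpen_ball)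
    (fun i _ => ⟨b i, Metric.mem_ball_self (by norm_num)⟩))
  intro i _ j _ hij
  refine Metric.ball_disjoint_ball ?_
  have := hd i j hij
  linarith

/-- Dominated convergence for the coordinates of a family of vectors. -/
theorem tendsto_of_coord {α : Type*} {l : Filter α} {F : α → H} {x : H} {B : ι → ℝ}
    (hB : Summable fun i => B i ^ 2) (hF : ∀ᶠ t in l, ∀ i, ‖⟪b i, F t⟫_ℂ‖ ≤ B i)
    (hx : ∀ i, ‖⟪b i, x⟫_ℂ‖ ≤ B i)
    (hlim : ∀ i, Tendsto (fun t => ⟪b i, F t⟫_ℂ) l (𝓝 ⟪b i, x⟫_ℂ)) : Tendsto F l (𝓝 x) := by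
  have key : Tendsto (fun t => ∑' i, ‖⟪b i, F t - x⟫_ℂ‖ ^ 2) l (𝓝 (∑' _ : ι, (0 : ℝ))) := by
    refine tendsto_tsum_of_dominated_convergence (bound := fun i => 4 * B i ^ 2)
      (hB.mul_left 4) (fun i => ?_) ?_
    · have h1 : Tendsto (fun t => ⟪b i, F t - x⟫_ℂ) l (𝓝 0) := by
        simpa [inner_sub_right] using (hlim i).sub_const ⟪b i, x⟫_ℂ
      simpa using (h1.norm.pow 2)
    · filter_upwards [hF] with t ht i
      have h2 : ‖⟪b i, F t - x⟫_ℂ‖ ≤ 2 * B i := by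
        rw [inner_sub_right]
        refine (norm_sub_le _ _).trans ?_
        linarith [ht i, hx i]
      rw [Real.norm_of_nonneg (sq_nonneg _)]
      calc ‖⟪b i, F t - x⟫_ℂ‖ ^ 2 ≤ (2 * B i) ^ 2 := pow_le_pow_left₀ (norm_nonneg _) h2 2
        _ = 4 * B i ^ 2 := by ring
  rw [tsum_zero] at key
  have key2 : Tendsto (fun t => ‖F t - x‖ ^ 2) l (𝓝 0) := by
    simpa only [norm_sq_eq_tsum b] using key
  rw [tendsto_iff_norm_sub_tendsto_zero]
  have := key2.sqrt
  simpa [Real.sqrt_sq (norm_nonneg _)] using this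

/-- A family of vectors is differentiable if its coordinates are and the derivatives of the
coordinates have a common square summable bound. -/
theorem hasDerivWithinAt_of_coord {F G : ℝ → H} {S : Set ℝ} (hS : Convex ℝ S) {B : ι → ℝ}
    (hB : Summable fun i => B i ^ 2) (hG : ∀ s ∈ S, ∀ i, ‖⟪b i, G s⟫_ℂ‖ ≤ B i)
    (hd : ∀ i, ∀ s ∈ S, HasDerivWithinAt (fun t => ⟪b i, F t⟫_ℂ) ⟪b i, G s⟫_ℂ S s)
    {t : ℝ} (ht : t ∈ S) : HasDerivWithinAt F (G t) S t := by
  rw [hasDerivWithinAt_iff_tendsto_slope]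
  have hc : ∀ i s, ⟪b i, slope F t s⟫_ℂ = slope (fun t => ⟪b i, F t⟫_ℂ) t s := by
    intro i s
    simp only [slope, vsub_eq_sub, inner_sub_right, inner_smul_right_eq_smul]
  refine tendsto_of_coord b hB ?_ (hG t ht) fun i => ?_
  · filter_upwards [self_mem_nhdsWithin] with s hs i
    rw [hc i s, slope_def_module, norm_smul]
    -- The mean value inequality turns the bound on the derivatives of the coordinates into the same
    -- bound for their difference quotients, which dominates the limit.
    have h1 := hS.norm_image_sub_le_of_norm_hasDerivWithin_le (f := fun t => ⟪b i, F t⟫_ℂ)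
      (C := B i) (hd i) (fun s hs => hG s hs i) ht hs.1
    have h2 : 0 < ‖s - t‖ := norm_pos_iff.2 (sub_ne_zero.2 hs.2)
    rw [norm_inv, inv_mul_le_iff₀ h2, mul_comm]
    exact h1
  · simp only [hc]
    exact hasDerivWithinAt_iff_tendsto_slope.1 (hd i t ht)

end Coordinates

/-! ### Diagonal form of an operator with compact inverse -/

/-- `A` is the diagonal operator with eigenvectors `b i` and eigenvalues `lam i > 1`. -/
structure IsDiag {ι : Type*} (A : H →ₗ.[ℂ] H) (b : HilbertBasis ι ℂ H) (lam : ι → ℝ) : Prop where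
  one_lt : ∀ i, 1 < lam i
  mem_graph : ∀ x y, (x, y) ∈ A.graph ↔ ∀ i, ⟪b i, y⟫_ℂ = lam i * ⟪b i, x⟫_ℂ

theorem symmetric_of_isSelfAdjoint {A : H →ₗ.[ℂ] H} (hA : IsSelfAdjoint A) (x y : A.domain) :
    ⟪A x, (y : H)⟫_ℂ = ⟪(x : H), A y⟫_ℂ := by
  have h := LinearPMap.adjoint_isFormalAdjoint hA.dense_domain
  have hA' : LinearPMap.adjoint A = A := hA
  rw [hA'] at h
  exact h x y

/-- The spectral theorem for the compact symmetric operator T = A⁻¹: Hilbert bases of its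
eigenspaces are glued together, and λ is the reciprocal of the eigenvalue of T. The graph of A is
then recovered from coordinates because x = Ty as soon as the coordinates of y are λ_i times those
of x. -/
theorem exists_isDiag.{u} {H : Type u} [NormedAddCommGroup H] [InnerProductSpace ℂ H]
    [CompleteSpace H] {A : H →ₗ.[ℂ] H} (hA : IsSelfAdjoint A)
    (hAI : ∀ x : A.domain, x ≠ 0 → ‖(x : H)‖ ^ 2 < (⟪A x, (x : H)⟫_ℂ).re)
    (hAc : HasCompactInverse A) :
    ∃ (ι : Type u) (b : HilbertBasis ι ℂ H) (lam : ι → ℝ), IsDiag A b lam := by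
  obtain ⟨T, hT, hT1, hT2⟩ := hAc
  have hsym := symmetric_of_isSelfAdjoint hA
  have hTs : (T : H →ₗ[ℂ] H).IsSymmetric := by
    intro x y
    obtain ⟨hx, ex⟩ := hT1 x
    obtain ⟨hy, ey⟩ := hT1 y
    have := hsym ⟨T x, hx⟩ ⟨T y, hy⟩
    rw [ex, ey] at this
    exact this.symm
  have hspec := ContinuousLinearMap.orthogonalComplement_iSup_eigenspaces_eq_bot hT hTs
  let E : ℂ → Submodule ℂ H := fun μ => Module.End.eigenspace (T : Module.End ℂ H) μ
  have hE : ∀ μ v, v ∈ E μ ↔ T v = μ • v := fun μ v => Module.End.mem_eigenspace_iff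
  have hcl : ∀ μ, IsClosed (E μ : Set H) := by
    intro μ
    have : (E μ : Set H) = {v | T v = μ • v} := by
      ext v; exact hE μ v
    rw [this]
    exact isClosed_eq T.continuous (continuous_const_smul μ)
  have : ∀ μ, CompleteSpace (E μ) := fun μ => (hcl μ).completeSpace_coe
  choose w bw hbw using fun μ => exists_hilbertBasis ℂ (E μ)
  let ι := Σ μ : ℂ, w μ
  let v : ι → H := fun i => ((bw i.1 i.2 : E i.1) : H)
  have hv : Orthonormal ℂ v :=
    hTs.orthogonalFamily_eigenspaces.orthonormal_sigma_orthonormal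
      (v_family := fun μ => ⇑(bw μ)) (fun μ => (bw μ).orthonormal)
  have hvE : ∀ i : ι, v i ∈ E i.1 := fun i => (bw i.1 i.2).2
  have hperp : (Submodule.span ℂ (Set.range v))ᗮ = ⊥ := by
    rw [eq_bot_iff, ← hspec]
    intro x hx
    rw [Submodule.mem_orthogonal] at hx ⊢
    intro u hu
    refine Submodule.iSup_induction _ (motive := fun u => ⟪u, x⟫_ℂ = 0) hu ?_ (by simp) ?_
    · intro μ u hu
      have h1 := (bw μ).hasSum_repr (⟨u, hu⟩ : E μ)
      have h2 := (h1.mapL (E μ).subtypeL).mapL ((innerSL ℂ x))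
      have h3 : ∀ j, (innerSL ℂ x) ((E μ).subtypeL ((bw μ).repr ⟨u, hu⟩ j • bw μ j)) = 0 := by
        intro j
        have := hx (v ⟨μ, j⟩) (Submodule.subset_span ⟨_, rfl⟩)
        simp only [map_smul, innerSL_apply_apply, Submodule.subtypeL_apply, smul_eq_mul]
        rw [inner_eq_zero_symm.1 this, mul_zero]
      simp only [h3] at h2
      have h4 := h2.unique hasSum_zero
      exact inner_eq_zero_symm.1 h4
    · intro a c ha hc
      rw [inner_add_left, ha, hc, add_zero]
  let b := HilbertBasis.mkOfOrthogonalEqBot hv hperp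
  have hb : ∀ i, b i = v i := fun i => by
    simp [b]
  have hn : ∀ i, ‖v i‖ = 1 := hv.1
  have key : ∀ i : ι, ∃ l : ℝ, 1 < l ∧ ∃ h : v i ∈ A.domain, A ⟨v i, h⟩ = (l : ℂ) • v i := by
    intro i
    have hTi : T (v i) = i.1 • v i := (hE _ _).1 (hvE i)
    obtain ⟨hd, he⟩ := hT1 (v i)
    have hne : v i ≠ 0 := by
      intro h; have := hn i; rw [h] at this; simp at this
    -- T is injective, since A T = I, so 0 is not an eigenvalue of T and each eigenvector lies in
    -- the range of T, that is, in D(A).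
    have hμ : i.1 ≠ 0 := by
      intro h
      rw [h, zero_smul] at hTi
      apply hne
      rw [← he]
      have : (⟨T (v i), hd⟩ : A.domain) = 0 := Subtype.ext hTi
      rw [this, A.map_zero]
    have hdom : v i ∈ A.domain := by
      have := A.domain.smul_mem (i.1)⁻¹ hd
      rwa [hTi, smul_smul, inv_mul_cancel₀ hμ, one_smul] at this
    have hAv : A ⟨v i, hdom⟩ = (i.1)⁻¹ • v i := by
      have h1 : (⟨v i, hdom⟩ : A.domain) = (i.1)⁻¹ • ⟨T (v i), hd⟩ := by
        apply Subtype.ext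
        simp [hTi, smul_smul, inv_mul_cancel₀ hμ]
      rw [h1, A.map_smul, he]
    have hs := hsym ⟨v i, hdom⟩ ⟨v i, hdom⟩
    rw [hAv] at hs
    simp only [inner_smul_left, inner_smul_right, inner_self_eq_norm_sq_to_K, hn i] at hs
    -- The eigenvalue is real by symmetry of A, and exceeds 1 by A > I applied to the unit vector `v
    -- i`.
    have hre : (((i.1)⁻¹).re : ℂ) = (i.1)⁻¹ := Complex.conj_eq_iff_re.1 (by simpa using hs)
    refine ⟨((i.1)⁻¹).re, ?_, hdom, by rw [hre, hAv]⟩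
    have h2 := hAI ⟨v i, hdom⟩ (fun h => hne (congrArg Subtype.val h))
    rw [hAv] at h2
    simp only [inner_smul_left, inner_self_eq_norm_sq_to_K, hn i] at h2
    simpa using h2
  choose lam hlam hdom hAv using key
  refine ⟨ι, b, lam, hlam, fun x y => ?_⟩
  have hAx : ∀ (x : A.domain) i, ⟪b i, A x⟫_ℂ = lam i * ⟪b i, (x : H)⟫_ℂ := by
    intro x i
    have := hsym ⟨v i, hdom i⟩ x
    rw [hAv, inner_smul_left, Complex.conj_ofReal] at this
    rw [hb]
    exact this.symm
  constructor
  · intro h i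
    obtain ⟨x', hx', rfl⟩ := (LinearPMap.mem_graph_iff A).1 h
    simp only at hx'
    subst hx'
    exact hAx x' i
  · intro h
    obtain ⟨hy, ey⟩ := hT1 y
    have : x = T y := by
      refine coord_ext b fun i => ?_
      have h1 := hAx ⟨T y, hy⟩ i
      rw [ey, h i] at h1
      exact mul_left_cancel₀ (Complex.ofReal_ne_zero.2 (by linarith [hlam i])) h1
    rw [LinearPMap.mem_graph_iff]
    exact ⟨⟨T y, hy⟩, this.symm, ey⟩

/-! ### The functional calculus in coordinates -/

theorem inner_eq_of_coord {ι : Type*} (b : HilbertBasis ι ℂ H) {v w v' w' : H}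
    (h : ∀ i, ⟪v, b i⟫_ℂ * ⟪b i, w⟫_ℂ = ⟪v', b i⟫_ℂ * ⟪b i, w'⟫_ℂ) :
    ⟪v, w⟫_ℂ = ⟪v', w'⟫_ℂ := by
  rw [← b.tsum_inner_mul_inner, ← b.tsum_inner_mul_inner]
  exact tsum_congr h

namespace IsDiag

variable {ι : Type*} {A : H →ₗ.[ℂ] H} {b : HilbertBasis ι ℂ H} {lam : ι → ℝ} (hD : IsDiag A b lam)

include hD

theorem pos (i : ι) : 0 < lam i := one_pos.trans (hD.one_lt i)

theorem mem_eigen {μ : ℝ} {x : H} :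
    x ∈ eigen A μ ↔ ∀ i, lam i ≠ μ → ⟪b i, x⟫_ℂ = 0 := by
  change (x, (μ : ℂ) • x) ∈ A.graph ↔ _
  rw [hD.mem_graph]
  refine forall_congr' fun i => ?_
  rw [inner_smul_right, ← sub_eq_zero, ← sub_mul, mul_eq_zero, sub_eq_zero, Complex.ofReal_inj,
    eq_comm]
  tauto

theorem basis_mem_eigen (i : ι) : b i ∈ eigen A (lam i) := by
  classical
  rw [hD.mem_eigen]
  intro j hj
  rw [inner_basis b, if_neg]
  rintro rfl
  exact hj rfl

/-- The projection is moved onto `b i`, which lies in the eigenspace when `lam i = μ` and is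
orthogonal to it otherwise. -/
theorem coord_eigenProj (μ : ℝ) (x : H) (i : ι) [Decidable (lam i = μ)] :
    ⟪b i, eigenProj A μ x⟫_ℂ = if lam i = μ then ⟪b i, x⟫_ℂ else 0 := by
  unfold eigenProj
  rw [← Submodule.inner_starProjection_left_eq_right]
  split_ifs with h
  · subst h
    rw [Submodule.starProjection_eq_self_iff.2
      (Submodule.le_topologicalClosure _ (hD.basis_mem_eigen i))]
  · rw [(Submodule.starProjection_apply_eq_zero_iff _).2, inner_zero_left]
    rw [Submodule.orthogonal_closure, Submodule.mem_orthogonal']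
    intro u hu
    exact hD.mem_eigen.1 hu i h

/-- The basis expansion of x, grouped by the fibres of `lam`. This is how the basis-free spectral
sum over all real μ is compared with coordinates. -/
theorem hasSum_eigenProj (x : H) : HasSum (fun μ => eigenProj A μ x) x := by
  classical
  have h := (Equiv.hasSum_iff (Equiv.sigmaFiberEquiv lam)).2 (b.hasSum_repr x)
  refine h.sigma fun μ => ?_
  have h2 := b.hasSum_repr (eigenProj A μ x)
  have h3 : Function.support (fun i => b.repr (eigenProj A μ x) i • b i) ⊆ {i | lam i = μ} := by
    intro i hi
    by_contra hne
    apply hi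
    have hne' : ¬ lam i = μ := hne
    simp [b.repr_apply_apply, hD.coord_eigenProj, hne']
  refine ((hasSum_subtype_iff_of_support_subset h3).2 h2).congr_fun ?_
  rintro ⟨i, hi⟩
  have hi' : lam i = μ := hi
  simp [b.repr_apply_apply, hD.coord_eigenProj, hi', Equiv.sigmaFiberEquiv]

theorem hasSum_fn {φ : ℝ → ℝ} {x y : H} (h : ∀ i, ⟪b i, y⟫_ℂ = φ (lam i) * ⟪b i, x⟫_ℂ) :
    HasSum (fun μ : ℝ => (φ μ : ℂ) • eigenProj A μ x) y := by
  classical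
  convert hD.hasSum_eigenProj y using 2 with μ
  refine coord_ext b fun i => ?_
  rw [inner_smul_right, hD.coord_eigenProj, hD.coord_eigenProj]
  split_ifs with hi
  · rw [h i, hi]
  · simp

theorem coord_of_hasSum {φ : ℝ → ℝ} {x y : H}
    (h : HasSum (fun μ : ℝ => (φ μ : ℂ) • eigenProj A μ x) y) (i : ι) :
    ⟪b i, y⟫_ℂ = φ (lam i) * ⟪b i, x⟫_ℂ := by
  classical
  have h1 := h.mapL (innerSL ℂ (b i))
  refine h1.unique ?_
  have h2 : ∀ μ, (innerSL ℂ (b i)) ((φ μ : ℂ) • eigenProj A μ x) =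
      if μ = lam i then (φ (lam i) * ⟪b i, x⟫_ℂ : ℂ) else 0 := by
    intro μ
    rw [innerSL_apply_apply, inner_smul_right, hD.coord_eigenProj]
    by_cases hi : μ = lam i
    · simp [hi]
    · rw [if_neg hi, if_neg (Ne.symm hi), mul_zero]
  simp only [h2]
  exact hasSum_ite_eq _ _

theorem mem_fnCalc_domain {φ : ℝ → ℝ} {x : H} :
    x ∈ (fnCalc A φ).domain ↔ ∃ y, ∀ i, ⟪b i, y⟫_ℂ = φ (lam i) * ⟪b i, x⟫_ℂ :=
  ⟨fun h => ⟨_, hD.coord_of_hasSum (Summable.hasSum h)⟩,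
    fun ⟨_, hy⟩ => (hD.hasSum_fn hy).summable⟩

theorem coord_fnCalc {φ : ℝ → ℝ} (x : (fnCalc A φ).domain) (i : ι) :
    ⟪b i, fnCalc A φ x⟫_ℂ = φ (lam i) * ⟪b i, (x : H)⟫_ℂ :=
  hD.coord_of_hasSum (Summable.hasSum x.2) i

theorem exists_coord_mul {φ : ℝ → ℝ} {C : ℝ} (hφ : ∀ i, |φ (lam i)| ≤ C) (x : H) :
    ∃ y, ∀ i, ⟪b i, y⟫_ℂ = φ (lam i) * ⟪b i, x⟫_ℂ := by
  refine exists_coord_of_le b (B := fun i => C * ‖⟪b i, x⟫_ℂ‖) ?_ fun i => ?_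
  · simpa only [mul_pow] using (summable_sq_coord b x).mul_left (C ^ 2)
  · rw [norm_mul, Complex.norm_real]
    exact mul_le_mul_of_nonneg_right (hφ i) (norm_nonneg _)

theorem coord_fnApply {φ : ℝ → ℝ} {C : ℝ} (hφ : ∀ i, |φ (lam i)| ≤ C) (x : H) (i : ι) :
    ⟪b i, fnApply A φ x⟫_ℂ = φ (lam i) * ⟪b i, x⟫_ℂ := by
  obtain ⟨y, hy⟩ := hD.exists_coord_mul hφ x
  have : fnApply A φ x = y := (hD.hasSum_fn hy).tsum_eq
  rw [this, hy]

theorem expSqrt_le {t : ℝ} (ht : 0 ≤ t) (i : ι) : |expSqrt t (lam i)| ≤ 1 := by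
  unfold expSqrt
  rw [abs_of_pos (Real.exp_pos _), Real.exp_le_one_iff, neg_nonpos]
  positivity

theorem rpow_le_one {s : ℝ} (hs : s ≤ 0) (i : ι) : |lam i ^ s| ≤ 1 := by
  rw [abs_of_pos (Real.rpow_pos_of_pos (hD.pos i) s)]
  exact Real.rpow_le_one_of_one_le_of_nonpos (hD.one_lt i).le hs

theorem basis_mem_fnCalc_domain (φ : ℝ → ℝ) (i : ι) : b i ∈ (fnCalc A φ).domain := by
  classical
  refine hD.mem_fnCalc_domain.2 ⟨(φ (lam i) : ℂ) • b i, fun j => ?_⟩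
  rw [inner_smul_right, inner_basis b]
  split_ifs with h
  · rw [h]
  · simp

theorem fnCalc_basis (φ : ℝ → ℝ) (i : ι) (h : b i ∈ (fnCalc A φ).domain) :
    fnCalc A φ ⟨b i, h⟩ = (φ (lam i) : ℂ) • b i := by
  classical
  refine coord_ext b fun j => ?_
  rw [hD.coord_fnCalc, inner_smul_right, inner_basis b]
  split_ifs with h
  · rw [h]
  · simp

/-! ### Spaces of negative order as copies of `H` -/

/-- Since λ_i > 1, the power A^(-s) is bounded and everywhere defined; it supplies the preimage. -/
theorem exists_opPow_eq {s : ℝ} (hs : 0 ≤ s) (w : H) :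
    ∃ v : (opPow A s).domain, opPow A s v = w := by
  obtain ⟨v, hv⟩ := hD.exists_coord_mul (φ := fun μ => μ ^ (-s))
    (hD.rpow_le_one (neg_nonpos.2 hs)) w
  have hv' : ∀ i, ⟪b i, w⟫_ℂ = ((fun μ : ℝ => μ ^ s) (lam i) : ℝ) * ⟪b i, v⟫_ℂ := by
    intro i
    rw [hv i, ← mul_assoc, ← Complex.ofReal_mul, ← Real.rpow_add (hD.pos i)]
    simp
  exact ⟨⟨v, hD.mem_fnCalc_domain.2 ⟨w, hv'⟩⟩,
    coord_ext b fun i => (hD.coord_fnCalc _ i).trans (hv' i).symm⟩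

theorem opPow_injective (s : ℝ) {v w : (opPow A s).domain} (h : opPow A s v = opPow A s w) :
    v = w := by
  refine Subtype.ext (coord_ext b fun i => ?_)
  have h1 := hD.coord_fnCalc v i
  have h2 := hD.coord_fnCalc w i
  have h3 : fnCalc A (fun μ => μ ^ s) v = fnCalc A (fun μ => μ ^ s) w := h
  rw [h3, h2] at h1
  exact (mul_left_cancel₀ (Complex.ofReal_ne_zero.2
    (Real.rpow_pos_of_pos (hD.pos i) s).ne') h1).symm

end IsDiag

/-- The element `Bˣ x` of `NegSpace B`. -/
def toNeg (B : H →ₗ.[ℂ] H) (x : H) : NegSpace B :=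
  ⟨{ toFun := fun v => ⟪B v, x⟫_ℂ
     map_add' := by intro v w; rw [B.map_add, inner_add_left]
     map_smul' := by intro c v; rw [B.map_smul, inner_smul_left]; rfl },
   ‖x‖, fun v => by
     rw [mul_comm]
     exact norm_inner_le_norm (B v) x⟩

theorem toNeg_apply (B : H →ₗ.[ℂ] H) (x : H) (v : B.domain) : (toNeg B x).1 v = ⟪B v, x⟫_ℂ := rfl

namespace IsDiag

variable {ι : Type*} {A : H →ₗ.[ℂ] H} {b : HilbertBasis ι ℂ H} {lam : ι → ℝ} (hD : IsDiag A b lam)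

include hD

/-- Riesz representation: w ↦ conj F(A^(-s) w) is a bounded linear functional on H, and its
representing vector is x. A functional of negative order is thereby replaced by an honest vector. -/
theorem exists_toNeg {s : ℝ} (hs : 0 ≤ s) (F : NegSpace (opPow A s)) :
    ∃ x, F = toNeg (opPow A s) x := by
  choose R hR using hD.exists_opPow_eq hs
  obtain ⟨C, hC⟩ := F.2
  let ℓ : H →ₗ[ℂ] ℂ :=
    { toFun := fun w => (starRingEnd ℂ) (F.1 (R w))
      map_add' := by
        intro v w
        have : R (v + w) = R v + R w := hD.opPow_injective s (by
          rw [LinearPMap.map_add, hR, hR, hR])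
        rw [this, map_add, map_add]
      map_smul' := by
        intro c w
        have : R (c • w) = c • R w := hD.opPow_injective s (by
          rw [LinearPMap.map_smul, hR, hR])
        rw [this, LinearMap.map_smulₛₗ]
        simp }
  let ℓ' : H →L[ℂ] ℂ := ℓ.mkContinuous C (fun w => by
    have := hC (R w)
    rw [hR] at this
    simpa [ℓ] using this)
  refine ⟨(InnerProductSpace.toDual ℂ H).symm ℓ', Subtype.ext (LinearMap.ext fun v => ?_)⟩
  rw [toNeg_apply, ← inner_conj_symm, InnerProductSpace.toDual_symm_apply]
  have h1 : R (opPow A s v) = v := hD.opPow_injective s (hR _)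
  simp [ℓ', ℓ, h1]

/-- Testing on the eigenvectors determines all coordinates of z. Conversely, Parseval's identity
extends the relation from eigenvectors to every admissible v. -/
theorem isExtApply_iff {s : ℝ} {φ : ℝ → ℝ} {x z : H} :
    IsExtApply A φ (toNeg (opPow A s) x) z ↔
      ∀ i, ⟪b i, z⟫_ℂ = φ (lam i) * ((lam i ^ s : ℝ) * ⟪b i, x⟫_ℂ) := by
  constructor
  · intro h i
    have hm := hD.basis_mem_fnCalc_domain φ i
    have hv : fnCalc A φ ⟨b i, hm⟩ ∈ (opPow A s).domain := by
      rw [hD.fnCalc_basis]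
      exact (opPow A s).domain.smul_mem _ (hD.basis_mem_fnCalc_domain _ i)
    have h1 := h ⟨b i, hm⟩ hv
    rw [toNeg_apply] at h1
    have h2 : opPow A s ⟨fnCalc A φ ⟨b i, hm⟩, hv⟩ =
        (φ (lam i) : ℂ) • ((lam i ^ s : ℝ) : ℂ) • b i := by
      have : (⟨fnCalc A φ ⟨b i, hm⟩, hv⟩ : (opPow A s).domain) =
          (φ (lam i) : ℂ) • ⟨b i, hD.basis_mem_fnCalc_domain _ i⟩ :=
        Subtype.ext (hD.fnCalc_basis φ i hm)
      rw [this, LinearPMap.map_smul]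
      congr 1
      exact hD.fnCalc_basis _ i _
    rw [h2, inner_smul_left, inner_smul_left, Complex.conj_ofReal, Complex.conj_ofReal] at h1
    exact h1
  · intro h v hv
    rw [toNeg_apply]
    refine inner_eq_of_coord b fun i => ?_
    rw [h i, ← inner_conj_symm _ (b i), ← inner_conj_symm (opPow A s _) (b i)]
    have h1 := hD.coord_fnCalc (φ := fun μ => μ ^ s) ⟨fnCalc A φ v, hv⟩ i
    have h2 : ⟪b i, opPow A s ⟨fnCalc A φ v, hv⟩⟫_ℂ = _ := h1
    rw [h2, hD.coord_fnCalc]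
    simp only [map_mul, Complex.conj_ofReal]
    ring

/-- The existence of z guarantees that the choice operator returns a solution, and uniqueness of
coordinates makes that solution z. -/
theorem extApply_coord {s : ℝ} {φ : ℝ → ℝ} {x z : H}
    (h : ∀ i, ⟪b i, z⟫_ℂ = φ (lam i) * ((lam i ^ s : ℝ) * ⟪b i, x⟫_ℂ)) :
    extApply A φ (toNeg (opPow A s) x) = z := by
  have h1 : IsExtApply A φ (toNeg (opPow A s) x) (extApply A φ (toNeg (opPow A s) x)) :=
    Classical.epsilon_spec ⟨z, hD.isExtApply_iff.2 h⟩
  exact coord_ext b fun i => (hD.isExtApply_iff.1 h1 i).trans (h i).symm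

theorem toNeg_basis {s : ℝ} (x : H) (i : ι) :
    (toNeg (opPow A s) x).1 ⟨b i, hD.basis_mem_fnCalc_domain _ i⟩ =
      (lam i ^ s : ℝ) * ⟪b i, x⟫_ℂ := by
  rw [toNeg_apply]
  have : opPow A s ⟨b i, hD.basis_mem_fnCalc_domain _ i⟩ = ((lam i ^ s : ℝ) : ℂ) • b i :=
    hD.fnCalc_basis (fun μ => μ ^ s) i _
  rw [this, inner_smul_left, Complex.conj_ofReal]

/-- Convergence in H_{-s} follows from norm convergence of the vectors A^(-s) u(t), which play the
role of U. -/
theorem tendstoNeg {s : ℝ} {u U : ℝ → H} {l : Filter ℝ} {x : H}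
    (hU : ∀ᶠ t in l, ∀ i, ⟪b i, u t⟫_ℂ = (lam i ^ s : ℝ) * ⟪b i, U t⟫_ℂ)
    (h : Tendsto U l (𝓝 x)) : TendstoNeg u l (toNeg (opPow A s) x) := by
  intro ε hε
  have h1 := (tendsto_iff_norm_sub_tendsto_zero.1 h).eventually (eventually_le_nhds hε)
  filter_upwards [hU, h1] with t ht ht' v
  have h2 : ⟪(v : H), u t⟫_ℂ = ⟪opPow A s v, U t⟫_ℂ := by
    refine inner_eq_of_coord b fun i => ?_
    have h3 : ⟪b i, opPow A s v⟫_ℂ = _ := hD.coord_fnCalc v i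
    rw [ht i, ← inner_conj_symm _ (b i), ← inner_conj_symm (opPow A s v) (b i), h3]
    simp only [map_mul, Complex.conj_ofReal]
    ring
  rw [toNeg_apply, h2, ← inner_sub_right]
  refine (norm_inner_le_norm _ _).trans ?_
  rw [mul_comm]
  exact mul_le_mul_of_nonneg_right ht' (norm_nonneg _)

theorem tendsto_coord_of_tendstoNeg {s : ℝ} {u : ℝ → H} {l : Filter ℝ}
    {F : NegSpace (opPow A s)} (h : TendstoNeg u l F) (i : ι) :
    Tendsto (fun t => ⟪b i, u t⟫_ℂ) l (𝓝 (F.1 ⟨b i, hD.basis_mem_fnCalc_domain _ i⟩)) := by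
  rw [tendsto_iff_norm_sub_tendsto_zero]
  set v : (opPow A s).domain := ⟨b i, hD.basis_mem_fnCalc_domain _ i⟩
  rw [Metric.tendsto_nhds]
  intro ε hε
  -- The added 1 makes the final inequality strict and avoids division by zero.
  have hc : 0 < ‖opPow A s v‖ + 1 := by positivity
  filter_upwards [h (ε / (‖opPow A s v‖ + 1)) (by positivity)] with t ht
  rw [Real.dist_eq, sub_zero, abs_of_nonneg (norm_nonneg _)]
  refine (ht v).trans_lt ?_
  rw [div_mul_eq_mul_div, div_lt_iff₀ hc]
  nlinarith

end IsDiag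

/-! ### The scalar equation `-y'' + ρ² y = h` -/

instance : IsProbabilityMeasure mu01 := ⟨by simp [mu01]⟩

local notation "conj" => starRingEnd ℂ

/-- The function `∫₀¹ exp (-ρ |t - s|) h(s) ds`. -/
def expConv (ρ : ℝ) (h : ℝ → ℂ) (t : ℝ) : ℂ :=
  ∫ s, (Real.exp (-(|t - s| * ρ)) : ℂ) * h s ∂mu01

/-- The derivative of `expConv ρ h`. -/
def expConvDeriv (ρ : ℝ) (h : ℝ → ℂ) (t : ℝ) : ℂ :=
  ∫ s, ((-(SignType.sign (t - s) * ρ) * Real.exp (-(|t - s| * ρ)) : ℝ) : ℂ) * h s ∂mu01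

theorem abs_exp_neg_sub_le {x y : ℝ} (hx : 0 ≤ x) (hy : 0 ≤ y) :
    |Real.exp (-x) - Real.exp (-y)| ≤ |x - y| := by
  wlog hxy : x ≤ y generalizing x y
  · rw [abs_sub_comm, abs_sub_comm x]
    exact this hy hx (le_of_not_ge hxy)
  have h1 : Real.exp (-y) = Real.exp (-x) * Real.exp (x - y) := by
    rw [← Real.exp_add]; ring_nf
  have h2 := Real.add_one_le_exp (x - y)
  have h3 : Real.exp (-x) ≤ 1 := Real.exp_le_one_iff.2 (by linarith)
  have h4 : Real.exp (-y) ≤ Real.exp (-x) := Real.exp_le_exp.2 (by linarith)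
  rw [abs_of_nonneg (by linarith), abs_of_nonpos (by linarith), h1]
  nlinarith [Real.exp_pos (-x)]

theorem norm_exp_mul_le {ρ : ℝ} (hρ : 0 ≤ ρ) (r : ℝ) (z : ℂ) :
    ‖(Real.exp (-(|r| * ρ)) : ℂ) * z‖ ≤ ‖z‖ := by
  rw [norm_mul, Complex.norm_real, Real.norm_of_nonneg (Real.exp_pos _).le]
  exact mul_le_of_le_one_left (norm_nonneg _) (Real.exp_le_one_iff.2 (by
    rw [neg_nonpos]; positivity))

theorem integrable_exp_mul {ρ : ℝ} (hρ : 0 ≤ ρ) {h : ℝ → ℂ} (hh : Integrable h mu01) (t : ℝ) :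
    Integrable (fun s => (Real.exp (-(|t - s| * ρ)) : ℂ) * h s) mu01 := by
  refine hh.mono ?_ (ae_of_all _ fun s => norm_exp_mul_le hρ _ _)
  refine AEStronglyMeasurable.mul ?_ hh.1
  exact (Continuous.aestronglyMeasurable (by fun_prop))

theorem norm_expConv_le {ρ : ℝ} (hρ : 0 ≤ ρ) {h : ℝ → ℂ} (hh : Integrable h mu01) (t : ℝ) :
    ‖expConv ρ h t‖ ≤ ∫ s, ‖h s‖ ∂mu01 :=
  norm_integral_le_of_norm_le hh.norm (ae_of_all _ fun _ => norm_exp_mul_le hρ _ _)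

theorem norm_signExp_mul_le {ρ : ℝ} (hρ : 0 ≤ ρ) (r : ℝ) (z : ℂ) :
    ‖((-(SignType.sign r * ρ) * Real.exp (-(|r| * ρ)) : ℝ) : ℂ) * z‖ ≤ ρ * ‖z‖ := by
  have h1 : |((SignType.sign r : SignType) : ℝ)| ≤ 1 := by
    rcases lt_trichotomy r 0 with h | h | h <;> simp [h]
  rw [Complex.ofReal_mul, mul_right_comm, mul_comm, mul_comm _ z, ← mul_assoc]
  rw [norm_mul, Complex.norm_real, Real.norm_eq_abs, abs_neg, abs_mul, abs_of_nonneg hρ, mul_comm]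
  have h2 := norm_exp_mul_le hρ r z
  have h3 : |((SignType.sign r : SignType) : ℝ)| * ρ ≤ 1 * ρ := mul_le_mul_of_nonneg_right h1 hρ
  calc _ ≤ (1 * ρ) * ‖z‖ := mul_le_mul h3 h2 (norm_nonneg _) (by positivity)
    _ = ρ * ‖z‖ := by ring

theorem norm_expConvDeriv_le {ρ : ℝ} (hρ : 0 ≤ ρ) {h : ℝ → ℂ} (hh : Integrable h mu01) (t : ℝ) :
    ‖expConvDeriv ρ h t‖ ≤ ρ * ∫ s, ‖h s‖ ∂mu01 := by
  rw [← integral_const_mul]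
  exact norm_integral_le_of_norm_le (hh.norm.const_mul ρ)
    (ae_of_all _ fun s => norm_signExp_mul_le hρ _ _)

theorem measurable_signExp (ρ t : ℝ) : Measurable fun s : ℝ =>
    ((-(SignType.sign (t - s) * ρ) * Real.exp (-(|t - s| * ρ)) : ℝ) : ℂ) := by
  have h1 : Measurable fun s : ℝ => ((SignType.sign (t - s) : SignType) : ℝ) := by
    have : (fun s : ℝ => ((SignType.sign (t - s) : SignType) : ℝ)) =
        fun s => if t < s then -1 else if s < t then 1 else 0 := by
      funext s
      rcases lt_trichotomy (t - s) 0 with h | h | h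
      · simp [h, sub_neg.1 h]
      · simp [sub_eq_zero.1 h]
      · simp [h, (sub_pos.1 h), (sub_pos.1 h).le]
    rw [this]
    exact Measurable.ite measurableSet_Ioi measurable_const
      (Measurable.ite measurableSet_Iio measurable_const measurable_const)
  fun_prop

theorem hasDerivAt_expAbs {ρ t s : ℝ} (h : t ≠ s) :
    HasDerivAt (fun t => (Real.exp (-(|t - s| * ρ)) : ℂ))
      ((-(SignType.sign (t - s) * ρ) * Real.exp (-(|t - s| * ρ)) : ℝ) : ℂ) t := by
  have h1 : HasDerivAt (fun t : ℝ => |t - s|) (((SignType.sign (t - s) : SignType) : ℝ) * 1) t :=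
    HasDerivAt.comp (h₂ := fun x : ℝ => |x|) (h := fun t => t - s) t
      (hasDerivAt_abs (sub_ne_zero.2 h)) ((hasDerivAt_id t).sub_const s)
  have h2 : HasDerivAt (fun t : ℝ => Real.exp (-(|t - s| * ρ)))
      (Real.exp (-(|t - s| * ρ)) * -(((SignType.sign (t - s) : SignType) : ℝ) * 1 * ρ)) t :=
    (h1.mul_const ρ).neg.exp
  refine h2.ofReal_comp.congr_deriv ?_
  congr 1
  ring

/-- In t the kernel is Lipschitz with constant ρ and fails to be differentiable only at t = s, a
null set of s. Hence the integral is differentiable at every t even though h is merely integrable.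
-/
theorem hasDerivAt_expConv {ρ : ℝ} (hρ : 0 ≤ ρ) {h : ℝ → ℂ} (hh : Integrable h mu01) (t : ℝ) :
    HasDerivAt (expConv ρ h) (expConvDeriv ρ h t) t := by
  refine (hasDerivAt_integral_of_dominated_loc_of_lip (μ := mu01) (s := univ)
    (F := fun t s => (Real.exp (-(|t - s| * ρ)) : ℂ) * h s)
    (F' := fun s => ((-(SignType.sign (t - s) * ρ) * Real.exp (-(|t - s| * ρ)) : ℝ) : ℂ) * h s)
    (bound := fun s => ρ * ‖h s‖) univ_mem ?_ (integrable_exp_mul hρ hh t) ?_ ?_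
    (hh.norm.const_mul ρ) ?_).2
  · exact Eventually.of_forall fun x => (integrable_exp_mul hρ hh x).1
  · exact (measurable_signExp ρ t).aestronglyMeasurable.mul hh.1
  · refine ae_of_all _ fun s => LipschitzOnWith.of_dist_le_mul fun x _ y _ => ?_
    rw [dist_eq_norm, ← sub_mul, norm_mul, ← Complex.ofReal_sub, Complex.norm_real,
      Real.norm_eq_abs, Real.coe_nnabs, abs_of_nonneg (by positivity : (0 : ℝ) ≤ ρ * ‖h s‖)]
    have h1 := abs_exp_neg_sub_le (x := |x - s| * ρ) (y := |y - s| * ρ) (by positivity)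
      (by positivity)
    have h2 : |(|x - s| * ρ) - |y - s| * ρ| ≤ ρ * dist x y := by
      rw [← sub_mul, abs_mul, abs_of_nonneg hρ, mul_comm, Real.dist_eq]
      have := abs_abs_sub_abs_le (x - s) (y - s)
      rw [sub_sub_sub_cancel_right] at this
      exact mul_le_mul_of_nonneg_left this hρ
    calc _ ≤ (ρ * dist x y) * ‖h s‖ := mul_le_mul_of_nonneg_right (h1.trans h2) (norm_nonneg _)
      _ = _ := by ring
  · have h0 : ∀ᵐ s ∂mu01, s ≠ t := by
      refine ae_restrict_of_ae ?_
      exact (Set.countable_singleton t).ae_notMem volume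
    filter_upwards [h0] with s hs
    exact (hasDerivAt_expAbs (Ne.symm hs)).mul_const _

theorem continuous_expConv {ρ : ℝ} (hρ : 0 ≤ ρ) {h : ℝ → ℂ} (hh : Integrable h mu01) :
    Continuous (expConv ρ h) :=
  continuous_iff_continuousAt.2 fun t => (hasDerivAt_expConv hρ hh t).continuousAt

theorem ae_mem_Ioo : ∀ᵐ s ∂mu01, s ∈ Ioo (0 : ℝ) 1 := ae_restrict_mem measurableSet_Ioo

theorem expConvDeriv_zero (ρ : ℝ) (h : ℝ → ℂ) : expConvDeriv ρ h 0 = ρ * expConv ρ h 0 := by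
  unfold expConvDeriv expConv
  rw [← integral_const_mul]
  refine integral_congr_ae ?_
  filter_upwards [ae_mem_Ioo] with s hs
  simp [hs.1]
  ring

theorem expConvDeriv_one (ρ : ℝ) (h : ℝ → ℂ) : expConvDeriv ρ h 1 = -(ρ * expConv ρ h 1) := by
  unfold expConvDeriv expConv
  rw [← integral_const_mul, ← integral_neg]
  refine integral_congr_ae ?_
  filter_upwards [ae_mem_Ioo] with s hs
  simp [hs.2]
  ring

/-- For each s > 0 the sign of t - s is constantly -1 once t < s, so the integrand converges
pointwise under the bound ρ‖h(s)‖. -/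
theorem tendsto_expConvDeriv_zero {ρ : ℝ} (hρ : 0 ≤ ρ) {h : ℝ → ℂ} (hh : Integrable h mu01) :
    Tendsto (expConvDeriv ρ h) (𝓝[>] 0) (𝓝 (expConvDeriv ρ h 0)) := by
  refine tendsto_integral_filter_of_dominated_convergence (fun s => ρ * ‖h s‖) ?_ ?_
    (hh.norm.const_mul ρ) ?_
  · exact Eventually.of_forall fun x => (measurable_signExp ρ x).aestronglyMeasurable.mul hh.1
  · exact Eventually.of_forall fun x => ae_of_all _ fun s => norm_signExp_mul_le hρ _ _
  · filter_upwards [ae_mem_Ioo] with s hs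
    refine Tendsto.mul_const _ ?_
    have h1 : ContinuousAt (fun t : ℝ => ((-((-1 : ℝ) * ρ) * Real.exp (-(|t - s| * ρ)) : ℝ) : ℂ)) 0 :=
      Continuous.continuousAt (by fun_prop)
    have h2 : ∀ᶠ t in 𝓝 (0 : ℝ), t < s := eventually_lt_nhds hs.1
    refine Tendsto.mono_left ?_ nhdsWithin_le_nhds
    have h3 : ∀ t < s, ((SignType.sign (t - s) : SignType) : ℝ) = -1 := by
      intro t ht
      simp [sub_neg.2 ht]
    rw [h3 0 hs.1]
    refine h1.tendsto.congr' ?_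
    filter_upwards [h2] with t ht
    rw [h3 t ht]

/-- The function `a exp (-ρ t) + c exp (-ρ (1 - t)) + (1 / 2ρ) ∫₀¹ exp (-ρ |t - s|) h(s) ds`, a
solution of `-y'' + ρ² y = h`. -/
def scal (ρ : ℝ) (a c : ℂ) (h : ℝ → ℂ) (t : ℝ) : ℂ :=
  Real.exp (-(t * ρ)) * a + Real.exp (-((1 - t) * ρ)) * c + (2 * ρ : ℂ)⁻¹ * expConv ρ h t

/-- The derivative of `scal ρ a c h`. -/
def scalDeriv (ρ : ℝ) (a c : ℂ) (h : ℝ → ℂ) (t : ℝ) : ℂ :=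
  -(ρ * (Real.exp (-(t * ρ)) * a)) + ρ * (Real.exp (-((1 - t) * ρ)) * c) +
    (2 * ρ : ℂ)⁻¹ * expConvDeriv ρ h t

theorem hasDerivAt_scal {ρ : ℝ} (hρ : 0 ≤ ρ) (a c : ℂ) {h : ℝ → ℂ} (hh : Integrable h mu01)
    (t : ℝ) : HasDerivAt (scal ρ a c h) (scalDeriv ρ a c h t) t := by
  have h1 : HasDerivAt (fun t : ℝ => ((Real.exp (-(t * ρ)) : ℝ) : ℂ))
      ((Real.exp (-(t * ρ)) * (-(1 * ρ)) : ℝ) : ℂ) t :=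
    (((hasDerivAt_id t).mul_const ρ).neg.exp).ofReal_comp
  have h2 : HasDerivAt (fun t : ℝ => ((Real.exp (-((1 - t) * ρ)) : ℝ) : ℂ))
      ((Real.exp (-((1 - t) * ρ)) * (-(-1 * ρ)) : ℝ) : ℂ) t :=
    ((((hasDerivAt_id t).const_sub 1).mul_const ρ).neg.exp).ofReal_comp
  have h3 := ((h1.mul_const a).add (h2.mul_const c)).add
    ((hasDerivAt_expConv hρ hh t).const_mul (2 * ρ : ℂ)⁻¹)
  refine h3.congr_deriv ?_
  unfold scalDeriv
  push_cast
  ring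

theorem continuous_scal {ρ : ℝ} (hρ : 0 ≤ ρ) (a c : ℂ) {h : ℝ → ℂ} (hh : Integrable h mu01) :
    Continuous (scal ρ a c h) :=
  continuous_iff_continuousAt.2 fun t => (hasDerivAt_scal hρ a c hh t).continuousAt

theorem tendsto_scalDeriv_zero {ρ : ℝ} (hρ : 0 ≤ ρ) (a c : ℂ) {h : ℝ → ℂ}
    (hh : Integrable h mu01) :
    Tendsto (scalDeriv ρ a c h) (𝓝[>] 0) (𝓝 (scalDeriv ρ a c h 0)) := by
  unfold scalDeriv
  refine Tendsto.add (Tendsto.mono_left (Continuous.tendsto ?_ 0) nhdsWithin_le_nhds)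
    ((tendsto_expConvDeriv_zero hρ hh).const_mul _)
  fun_prop

theorem integrable_conj {f : ℝ → ℂ} (hf : Integrable f mu01) :
    Integrable (fun t => conj (f t)) mu01 :=
  (Complex.conjCLE : ℂ ≃L[ℝ] ℂ).toContinuousLinearMap.integrable_comp hf

theorem expConv_conj (ρ : ℝ) (h : ℝ → ℂ) (t : ℝ) :
    expConv ρ (fun s => conj (h s)) t = conj (expConv ρ h t) := by
  unfold expConv
  rw [← integral_conj]
  simp only [map_mul, Complex.conj_ofReal]

theorem integrable_mul_expConv {ρ : ℝ} (hρ : 0 ≤ ρ) {f h : ℝ → ℂ} (hf : Integrable f mu01)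
    (hh : Integrable h mu01) : Integrable (fun t => f t * expConv ρ h t) mu01 :=
  hf.mul_bdd (c := ∫ s, ‖h s‖ ∂mu01) (continuous_expConv hρ hh).aestronglyMeasurable
    (ae_of_all _ fun t => norm_expConv_le hρ hh t)

/-- Fubini's theorem and the symmetry of the kernel exp(-ρ|t - s|). -/
theorem integral_mul_expConv_comm {ρ : ℝ} (hρ : 0 ≤ ρ) {f h : ℝ → ℂ} (hf : Integrable f mu01)
    (hh : Integrable h mu01) :
    ∫ t, f t * expConv ρ h t ∂mu01 = ∫ t, h t * expConv ρ f t ∂mu01 := by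
  have h1 : Integrable (Function.uncurry fun t s =>
      f t * ((Real.exp (-(|t - s| * ρ)) : ℂ) * h s)) (mu01.prod mu01) := by
    have h2 := hf.mul_prod hh
    refine h2.mono ?_ (ae_of_all _ ?_)
    · have h3 : AEStronglyMeasurable (fun p : ℝ × ℝ => (Real.exp (-(|p.1 - p.2| * ρ)) : ℂ))
          (mu01.prod mu01) := Continuous.aestronglyMeasurable (by fun_prop)
      refine (h3.mul h2.1).congr (ae_of_all _ fun p => ?_)
      simp only [Function.uncurry, Pi.mul_apply]
      ring
    · rintro ⟨t, s⟩
      simp only [Function.uncurry]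
      rw [norm_mul (f t), norm_mul (f t)]
      exact mul_le_mul_of_nonneg_left (norm_exp_mul_le hρ _ _) (norm_nonneg _)
  have e1 : ∀ t, f t * expConv ρ h t =
      ∫ s, f t * ((Real.exp (-(|t - s| * ρ)) : ℂ) * h s) ∂mu01 := fun t =>
    (integral_const_mul _ _).symm
  simp only [e1]
  rw [integral_integral_swap h1]
  refine integral_congr_ae (ae_of_all _ fun s => ?_)
  simp only
  unfold expConv
  rw [← integral_const_mul]
  refine integral_congr_ae (ae_of_all _ fun t => ?_)
  simp only
  rw [abs_sub_comm]
  ring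

theorem integral_mul_exp {ρ : ℝ} (f : ℝ → ℂ) :
    ∫ t, f t * Real.exp (-(t * ρ)) ∂mu01 = expConv ρ f 0 := by
  unfold expConv
  refine integral_congr_ae ?_
  filter_upwards [ae_mem_Ioo] with s hs
  rw [zero_sub, abs_neg, abs_of_pos hs.1, mul_comm]

theorem integral_mul_exp_one_sub {ρ : ℝ} (f : ℝ → ℂ) :
    ∫ t, f t * Real.exp (-((1 - t) * ρ)) ∂mu01 = expConv ρ f 1 := by
  unfold expConv
  refine integral_congr_ae ?_
  filter_upwards [ae_mem_Ioo] with s hs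
  rw [abs_of_pos (sub_pos.2 hs.2), mul_comm]

theorem integral_mul_scal {ρ : ℝ} (hρ : 0 ≤ ρ) (a c : ℂ) {f h : ℝ → ℂ} (hf : Integrable f mu01)
    (hh : Integrable h mu01) :
    ∫ t, f t * scal ρ a c h t ∂mu01 = a * expConv ρ f 0 + c * expConv ρ f 1 +
      (2 * ρ : ℂ)⁻¹ * ∫ t, f t * expConv ρ h t ∂mu01 := by
  have i1 : Integrable (fun t => f t * (Real.exp (-(t * ρ)) : ℂ)) mu01 := by
    refine hf.mul_bdd (c := 1) (Continuous.aestronglyMeasurable (by fun_prop)) ?_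
    filter_upwards [ae_mem_Ioo] with s hs
    rw [Complex.norm_real, Real.norm_of_nonneg (Real.exp_pos _).le, Real.exp_le_one_iff, neg_nonpos]
    exact mul_nonneg hs.1.le hρ
  have i2 : Integrable (fun t => f t * (Real.exp (-((1 - t) * ρ)) : ℂ)) mu01 := by
    refine hf.mul_bdd (c := 1) (Continuous.aestronglyMeasurable (by fun_prop)) ?_
    filter_upwards [ae_mem_Ioo] with s hs
    rw [Complex.norm_real, Real.norm_of_nonneg (Real.exp_pos _).le, Real.exp_le_one_iff, neg_nonpos]
    exact mul_nonneg (sub_nonneg.2 hs.2.le) hρ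
  have e : ∀ t, f t * scal ρ a c h t = a * (f t * (Real.exp (-(t * ρ)) : ℂ)) +
      c * (f t * (Real.exp (-((1 - t) * ρ)) : ℂ)) +
      (2 * ρ : ℂ)⁻¹ * (f t * expConv ρ h t) := by
    intro t
    unfold scal
    ring
  simp only [e]
  have i3 : Integrable (fun t => a * (f t * (Real.exp (-(t * ρ)) : ℂ)) +
      c * (f t * (Real.exp (-((1 - t) * ρ)) : ℂ))) mu01 := (i1.const_mul a).add (i2.const_mul c)
  rw [integral_add i3 ((integrable_mul_expConv hρ hf hh).const_mul _), integral_add (i1.const_mul a) (i2.const_mul c),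
    integral_const_mul, integral_const_mul, integral_const_mul, integral_mul_exp,
    integral_mul_exp_one_sub]

theorem scal_zero (ρ : ℝ) (a c : ℂ) (h : ℝ → ℂ) :
    scal ρ a c h 0 = a + Real.exp (-ρ) * c + (2 * ρ : ℂ)⁻¹ * expConv ρ h 0 := by
  simp [scal]

theorem scal_one (ρ : ℝ) (a c : ℂ) (h : ℝ → ℂ) :
    scal ρ a c h 1 = Real.exp (-ρ) * a + c + (2 * ρ : ℂ)⁻¹ * expConv ρ h 1 := by
  simp [scal]

theorem scalDeriv_zero (ρ : ℝ) (a c : ℂ) (h : ℝ → ℂ) :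
    scalDeriv ρ a c h 0 =
      -(ρ * a) + ρ * (Real.exp (-ρ) * c) + (2 * ρ : ℂ)⁻¹ * (ρ * expConv ρ h 0) := by
  simp [scalDeriv, expConvDeriv_zero]

theorem scalDeriv_one (ρ : ℝ) (a c : ℂ) (h : ℝ → ℂ) :
    scalDeriv ρ a c h 1 =
      -(ρ * (Real.exp (-ρ) * a)) + ρ * c - (2 * ρ : ℂ)⁻¹ * (ρ * expConv ρ h 1) := by
  simp [scalDeriv, expConvDeriv_one, sub_eq_add_neg]

/-- Green's formula. -/
theorem scal_green {ρ : ℝ} (hρ : 0 < ρ) (a c a' c' : ℂ) {h h' : ℝ → ℂ} (hh : Integrable h mu01)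
    (hh' : Integrable h' mu01) :
    ∫ t, conj (h t) * scal ρ a' c' h' t ∂mu01 - ∫ t, conj (scal ρ a c h t) * h' t ∂mu01 =
      conj (scal ρ a c h 1) * scalDeriv ρ a' c' h' 1
        - conj (scalDeriv ρ a c h 1) * scal ρ a' c' h' 1
        + conj (scalDeriv ρ a c h 0) * scal ρ a' c' h' 0
        - conj (scal ρ a c h 0) * scalDeriv ρ a' c' h' 0 := by
  have hρ0 : (ρ : ℂ) ≠ 0 := Complex.ofReal_ne_zero.2 hρ.ne'
  -- No integration by parts is needed. Both integrals expand into boundary values of `expConv` and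
  -- a double integral; the double integrals cancel by symmetry of the kernel, and the rest is an
  -- algebraic identity.
  have hch := integrable_conj hh
  have e : ∀ t, conj (scal ρ a c h t) * h' t =
      h' t * scal ρ (conj a) (conj c) (fun s => conj (h s)) t := by
    intro t
    rw [scal, scal, expConv_conj, mul_comm]
    simp only [map_add, map_mul, map_inv₀, Complex.conj_ofReal, map_ofNat]
  simp only [e]
  rw [integral_mul_scal hρ.le _ _ hch hh', integral_mul_scal hρ.le _ _ hh' hch,
    integral_mul_expConv_comm hρ.le hh' hch, expConv_conj, expConv_conj]
  simp only [scal_zero, scal_one, scalDeriv_zero, scalDeriv_one, map_add, map_sub, map_mul, map_neg,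
    map_inv₀, Complex.conj_ofReal, map_ofNat]
  field_simp
  ring

/-! ### Smooth solutions and the coefficients of a solution -/

theorem integral_mu01 {E : Type*} [NormedAddCommGroup E] [NormedSpace ℝ E] (f : ℝ → E) :
    ∫ t, f t ∂mu01 = ∫ t in (0 : ℝ)..1, f t := by
  rw [intervalIntegral.integral_of_le zero_le_one, integral_Ioc_eq_integral_Ioo]

/-- On each side of t the integrand is an exact derivative in s, of exp(-ρ(t - s))(-y' + ρy) on the
left and of exp(ρ(t - s))(-y' - ρy) on the right. The zero Cauchy data remove the contribution of
the endpoint 0. -/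
theorem expConv_of_smooth {ρ : ℝ} {y y' y'' : ℝ → ℂ}
    (hy : ∀ t ∈ Icc (0 : ℝ) 1, HasDerivWithinAt y (y' t) (Icc 0 1) t)
    (hy' : ∀ t ∈ Icc (0 : ℝ) 1, HasDerivWithinAt y' (y'' t) (Icc 0 1) t)
    (hy'' : ContinuousOn y'' (Icc 0 1)) (h0 : y 0 = 0) (h0' : y' 0 = 0) {t : ℝ}
    (ht : t ∈ Icc (0 : ℝ) 1) :
    expConv ρ (fun s => -y'' s + ρ ^ 2 * y s) t =
      2 * ρ * y t - Real.exp (-((1 - t) * ρ)) * (y' 1 + ρ * y 1) := by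
  have cy : ContinuousOn y (Icc 0 1) := fun t ht => (hy t ht).continuousWithinAt
  have cy' : ContinuousOn y' (Icc 0 1) := fun t ht => (hy' t ht).continuousWithinAt
  have dy : ∀ t ∈ Ioo (0 : ℝ) 1, HasDerivAt y (y' t) t := fun t ht =>
    (hy t (Ioo_subset_Icc_self ht)).hasDerivAt (Icc_mem_nhds ht.1 ht.2)
  have dy' : ∀ t ∈ Ioo (0 : ℝ) 1, HasDerivAt y' (y'' t) t := fun t ht =>
    (hy' t (Ioo_subset_Icc_self ht)).hasDerivAt (Icc_mem_nhds ht.1 ht.2)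
  have cG : ContinuousOn (fun s => (Real.exp (-(|t - s| * ρ)) : ℂ) * (-y'' s + ρ ^ 2 * y s))
      (Icc 0 1) := by fun_prop
  have iG : ∀ {u v : ℝ}, 0 ≤ u → u ≤ v → v ≤ 1 → IntervalIntegrable
      (fun s => (Real.exp (-(|t - s| * ρ)) : ℂ) * (-y'' s + ρ ^ 2 * y s)) volume u v :=
    fun hu huv hv => (cG.mono (Icc_subset_Icc hu hv)).intervalIntegrable_of_Icc huv
  have sub1 : Icc 0 t ⊆ Icc (0 : ℝ) 1 := Icc_subset_Icc le_rfl ht.2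
  have sub2 : Icc t 1 ⊆ Icc (0 : ℝ) 1 := Icc_subset_Icc ht.1 le_rfl
  have dexp : ∀ (σ s : ℝ), HasDerivAt (fun s : ℝ => ((Real.exp (-((t - s) * σ)) : ℝ) : ℂ))
      ((σ : ℂ) * (Real.exp (-((t - s) * σ)) : ℝ)) s := by
    intro σ s
    have h2 : HasDerivAt (fun s : ℝ => Real.exp (-((t - s) * σ)))
      (Real.exp (-((t - s) * σ)) * (-(-1 * σ))) s :=
      (((hasDerivAt_id s).const_sub t).mul_const σ).neg.exp
    refine h2.ofReal_comp.congr_deriv ?_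
    push_cast
    ring
  have e1 := intervalIntegral.integral_eq_sub_of_hasDerivAt_of_le ht.1
    (f := fun s => (Real.exp (-((t - s) * ρ)) : ℂ) * (-y' s + ρ * y s))
    (f' := fun s => (Real.exp (-(|t - s| * ρ)) : ℂ) * (-y'' s + ρ ^ 2 * y s))
    (by have := cy.mono sub1; have := cy'.mono sub1; fun_prop)
    (by
      intro s hs
      have hs' : s ∈ Ioo (0 : ℝ) 1 := ⟨hs.1, hs.2.trans_le ht.2⟩
      refine ((dexp ρ s).mul ((dy' s hs').neg.add ((dy s hs').const_mul (ρ : ℂ)))).congr_deriv ?_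
      rw [abs_of_pos (sub_pos.2 hs.2)]
      simp only [Pi.add_apply, Pi.neg_apply]
      ring) (iG le_rfl ht.1 ht.2)
  have e2 := intervalIntegral.integral_eq_sub_of_hasDerivAt_of_le ht.2
    (f := fun s => (Real.exp (-((t - s) * -ρ)) : ℂ) * (-y' s - ρ * y s))
    (f' := fun s => (Real.exp (-(|t - s| * ρ)) : ℂ) * (-y'' s + ρ ^ 2 * y s))
    (by have := cy.mono sub2; have := cy'.mono sub2; fun_prop)
    (by
      intro s hs
      have hs' : s ∈ Ioo (0 : ℝ) 1 := ⟨ht.1.trans_lt hs.1, hs.2⟩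
      refine ((dexp (-ρ) s).mul
        ((dy' s hs').neg.sub ((dy s hs').const_mul (ρ : ℂ)))).congr_deriv ?_
      rw [abs_of_neg (sub_neg.2 hs.1), neg_mul, mul_neg]
      simp only [Pi.sub_apply, Pi.neg_apply]
      push_cast
      ring) (iG ht.1 ht.2 le_rfl)
  unfold expConv
  rw [integral_mu01, ← intervalIntegral.integral_add_adjacent_intervals (iG le_rfl ht.1 ht.2)
    (iG ht.1 ht.2 le_rfl), e1, e2, h0, h0']
  have e3 : (t - 1) * -ρ = (1 - t) * ρ := by ring
  simp only [e3, sub_self, zero_mul, neg_zero, Real.exp_zero, Complex.ofReal_one]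
  ring

theorem hasDerivAt_integral_exp_mul (σ : ℝ) {ψ : ℝ → ℝ} (hψ : Continuous ψ) (t : ℝ) :
    HasDerivAt (fun t => ∫ s in (0 : ℝ)..t, Real.exp (σ * s) * ψ s) (Real.exp (σ * t) * ψ t) t := by
  have hc : Continuous fun s => Real.exp (σ * s) * ψ s := by fun_prop
  exact intervalIntegral.integral_hasDerivAt_right (hc.intervalIntegrable _ _)
    (hc.stronglyMeasurableAtFilter _ _) hc.continuousAt

theorem contDiff_integral_exp_mul (σ : ℝ) {ψ : ℝ → ℝ} (hψ : ContDiff ℝ ∞ ψ) :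
    ContDiff ℝ ∞ (fun t => ∫ s in (0 : ℝ)..t, Real.exp (σ * s) * ψ s) := by
  have h := hasDerivAt_integral_exp_mul σ hψ.continuous
  rw [contDiff_infty_iff_deriv]
  refine ⟨fun t => (h t).differentiableAt, ?_⟩
  rw [funext fun t => (h t).deriv]
  fun_prop

/-- Variation of parameters started at 0: φ(t) = -(1/ρ)∫₀ᵗ sinh(ρ(t - s))ψ(s) ds. It inherits the
vanishing of ψ near 0 but is in general nonzero at 1, where the minimal domain imposes no vanishing.
-/
theorem exists_contDiff_solution {ρ δ : ℝ} (hρ : 0 < ρ) {ψ : ℝ → ℝ} (hψ : ContDiff ℝ ∞ ψ)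
    (hδ : 0 < δ) (h0 : ∀ t < δ, ψ t = 0) :
    ∃ φ : ℝ → ℝ, ContDiff ℝ ∞ φ ∧ (∀ t, -iteratedDeriv 2 φ t + ρ ^ 2 * φ t = ψ t) ∧
      ∀ t < δ, φ t = 0 := by
  let P : ℝ → ℝ → ℝ := fun σ t => ∫ s in (0 : ℝ)..t, Real.exp (σ * s) * ψ s
  have dP : ∀ σ t, HasDerivAt (P σ) (Real.exp (σ * t) * ψ t) t := fun σ t =>
    hasDerivAt_integral_exp_mul σ hψ.continuous t
  have cP : ∀ σ, ContDiff ℝ ∞ (P σ) := fun σ => contDiff_integral_exp_mul σ hψ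
  have dE : ∀ σ t, HasDerivAt (fun t : ℝ => Real.exp (σ * t)) (Real.exp (σ * t) * σ) t := by
    intro σ t
    simpa using ((hasDerivAt_id t).const_mul σ).exp
  have hE : ∀ t, Real.exp (ρ * t) * Real.exp (-ρ * t) = 1 := by
    intro t; rw [← Real.exp_add]; simp
  let φ : ℝ → ℝ := fun t => -(1 / (2 * ρ)) * (Real.exp (ρ * t) * P (-ρ) t - Real.exp (-ρ * t) * P ρ t)
  let φ' : ℝ → ℝ := fun t => -(1 / 2) * (Real.exp (ρ * t) * P (-ρ) t + Real.exp (-ρ * t) * P ρ t)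
  have d1 : ∀ t, HasDerivAt φ (φ' t) t := by
    intro t
    refine ((((dE ρ t).mul (dP (-ρ) t)).sub ((dE (-ρ) t).mul (dP ρ t))).const_mul _).congr_deriv ?_
    simp only [φ']
    field_simp
    ring
  have d2 : ∀ t, HasDerivAt φ' (ρ ^ 2 * φ t - ψ t) t := by
    intro t
    refine ((((dE ρ t).mul (dP (-ρ) t)).add ((dE (-ρ) t).mul (dP ρ t))).const_mul _).congr_deriv ?_
    simp only [φ]
    have := hE t
    field_simp
    rw [neg_mul] at this
    linear_combination (-2 * ψ t) * this
  refine ⟨φ, ?_, fun t => ?_, fun t ht => ?_⟩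
  · have := cP ρ
    have := cP (-ρ)
    fun_prop
  · have h1 : iteratedDeriv 2 φ t = ρ ^ 2 * φ t - ψ t := by
      rw [iteratedDeriv_succ, iteratedDeriv_one, funext fun t => (d1 t).deriv, (d2 t).deriv]
    rw [h1]; ring
  · have h1 : ∀ σ, P σ t = 0 := by
      intro σ
      have : P σ t = ∫ s in (0 : ℝ)..t, (0 : ℝ) := by
        refine intervalIntegral.integral_congr fun s hs => ?_
        have : s < δ := by
          rcases le_total 0 t with h | h
          · rw [uIcc_of_le h] at hs; exact hs.2.trans_lt ht
          · rw [uIcc_of_ge h] at hs; exact hs.2.trans_lt hδ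
        simp [h0 s this]
      simpa using this
    simp [φ, h1]

theorem exists_forall_lt_eq_zero {ψ : ℝ → ℝ} (h : tsupport ψ ⊆ Ioo 0 1) :
    ∃ δ : ℝ, 0 < δ ∧ ∀ t < δ, ψ t = 0 := by
  have h0 : (0 : ℝ) ∉ tsupport ψ := fun h' => (h h').1.ne rfl
  obtain ⟨δ, hδ, hb⟩ := Metric.isOpen_iff.1 (isClosed_tsupport ψ).isOpen_compl 0 h0
  refine ⟨δ, hδ, fun t ht => ?_⟩
  by_contra hne
  have h1 : t ∈ tsupport ψ := subset_tsupport ψ hne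
  have h2 : t ∈ Metric.ball (0 : ℝ) δ := by
    rw [Metric.mem_ball, Real.dist_eq, sub_zero, abs_of_pos (h h1).1]
    exact ht
  exact hb h2 h1

/-- Near 0, on an interval of length comparable to 1/ρ, the term exp(-ρt)a has size comparable to
|a|. The coefficient c is eliminated through the value m at t = 1; integrating over that interval
produces the factor 1/ρ. -/
theorem coef_bound {ρ : ℝ} (hρ : 1 ≤ ρ) (a c : ℂ) {p : ℝ → ℂ}
    (hp : p =ᵐ[mu01] fun t => Real.exp (-(t * ρ)) * a + Real.exp (-((1 - t) * ρ)) * c)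
    (hi : Integrable (fun t => ‖p t‖ ^ 2) mu01) :
    ‖a‖ ^ 2 / ρ ≤ 400 * ∫ t, ‖p t‖ ^ 2 ∂mu01 + 200 * ‖Real.exp (-ρ) * a + c‖ ^ 2 := by
  have hρ0 : 0 < ρ := one_pos.trans_le hρ
  set m : ℂ := Real.exp (-ρ) * a + c with hm
  have hT : 1 / (2 * ρ) ≤ 1 / 2 := by
    rw [div_le_div_iff₀ (by positivity) (by norm_num)]; linarith
  have key : ∀ t ∈ Ioo 0 (1 / (2 * ρ)), ‖a‖ ^ 2 / 200 - ‖m‖ ^ 2 ≤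
      ‖Real.exp (-(t * ρ)) * a + Real.exp (-((1 - t) * ρ)) * c‖ ^ 2 := by
    intro t ht
    have htρ : t * ρ ≤ 1 / 2 := by
      have := (lt_div_iff₀ (by positivity : (0 : ℝ) < 2 * ρ)).1 ht.2
      linarith
    set x : ℂ := Real.exp (-(t * ρ)) * a + Real.exp (-((1 - t) * ρ)) * c
    set E : ℝ := Real.exp (-((1 - t) * ρ)) with hE
    -- Subtracting E·m removes c and changes the coefficient of a only by a small term.
    have e1 : x - E * m = ((Real.exp (-(t * ρ)) - Real.exp (-((2 - t) * ρ)) : ℝ) : ℂ) * a := by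
      have : Real.exp (-((2 - t) * ρ)) = E * Real.exp (-ρ) := by
        rw [hE, ← Real.exp_add]; ring_nf
      have hx : x = Real.exp (-(t * ρ)) * a + E * c := rfl
      rw [this, hm, hx]
      push_cast
      ring
    have l1 : 1 / 2 ≤ Real.exp (-(t * ρ)) := by
      have := Real.add_one_le_exp (-(t * ρ)); linarith
    have l2 : Real.exp (-((2 - t) * ρ)) ≤ 2 / 5 := by
      have h1 : (3 : ℝ) / 2 ≤ (2 - t) * ρ := by nlinarith
      have h2 := Real.add_one_le_exp ((2 - t) * ρ)
      rw [Real.exp_neg, inv_le_comm₀ (Real.exp_pos _) (by norm_num)]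
      linarith
    have l3 : E ≤ 1 := Real.exp_le_one_iff.2 (by
      rw [neg_nonpos]; exact mul_nonneg (by linarith [ht.2]) hρ0.le)
    have l4 : ‖x - E * m‖ ≤ ‖x‖ + ‖m‖ := by
      refine (norm_sub_le _ _).trans (add_le_add le_rfl ?_)
      rw [norm_mul, Complex.norm_real, Real.norm_of_nonneg (Real.exp_pos _).le]
      exact mul_le_of_le_one_left (norm_nonneg _) l3
    rw [e1, norm_mul, Complex.norm_real, Real.norm_of_nonneg (by linarith)] at l4
    -- The constant is 1/2 - 2/5. Squaring gives |a|²/200 ≤ |x|² + |m|², and the interval length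
    -- 1/(2ρ) then yields 400 and 200.
    have l5 : ‖a‖ / 10 ≤ ‖x‖ + ‖m‖ := by
      refine le_trans ?_ l4
      nlinarith [norm_nonneg a]
    have l6 : (‖a‖ / 10) ^ 2 ≤ (‖x‖ + ‖m‖) ^ 2 := pow_le_pow_left₀ (by positivity) l5 2
    nlinarith [sq_nonneg (‖x‖ - ‖m‖)]
  have hsub : Ioo 0 (1 / (2 * ρ)) ⊆ Ioo (0 : ℝ) 1 := Ioo_subset_Ioo le_rfl (by linarith)
  have h1 : ∫ _ in Ioo 0 (1 / (2 * ρ)), (‖a‖ ^ 2 / 200 - ‖m‖ ^ 2) ≤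
      ∫ t in Ioo 0 (1 / (2 * ρ)), ‖p t‖ ^ 2 := by
    refine setIntegral_mono_on_ae (integrable_const _) (IntegrableOn.mono_set hi hsub)
      measurableSet_Ioo ?_
    have hp' := (ae_restrict_iff' measurableSet_Ioo).1 hp
    filter_upwards [hp'] with t ht hts
    rw [ht (hsub hts)]
    exact key t hts
  have h2 : ∫ t in Ioo 0 (1 / (2 * ρ)), ‖p t‖ ^ 2 ≤ ∫ t, ‖p t‖ ^ 2 ∂mu01 :=
    setIntegral_mono_set hi (ae_of_all _ fun t => sq_nonneg _) (LE.le.eventuallyLE hsub)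
  rw [setIntegral_const] at h1
  have h3 : (volume.real (Ioo 0 (1 / (2 * ρ)))) = 1 / (2 * ρ) := by
    rw [Real.volume_real_Ioo_of_le (by positivity), sub_zero]
  rw [h3, smul_eq_mul] at h1
  have h4 := h1.trans h2
  have h5 : ‖a‖ ^ 2 / ρ = 400 * (1 / (2 * ρ) * (‖a‖ ^ 2 / 200 - ‖m‖ ^ 2)) +
      200 * (‖m‖ ^ 2 * (1 / ρ)) := by
    field_simp
    ring
  have h6 : ‖m‖ ^ 2 * (1 / ρ) ≤ ‖m‖ ^ 2 := by
    refine mul_le_of_le_one_right (sq_nonneg _) ?_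
    rw [div_le_one hρ0]; exact hρ
  rw [h5]
  linarith

theorem exp_neg_le_div_sq {x : ℝ} (hx : 0 < x) : Real.exp (-x) ≤ 2 / x ^ 2 := by
  have h := Real.quadratic_le_exp_of_nonneg hx.le
  rw [Real.exp_neg, inv_le_comm₀ (Real.exp_pos _) (by positivity), inv_div]
  linarith

/-- The a-term has size ρ exp(-ρ)|a| ≤ (2/ρ)|a|, whose square is controlled by |a|²/ρ, the quantity
bounded in `coef_bound`. -/
theorem coef_bound_right {ρ : ℝ} (hρ : 1 ≤ ρ) (a c : ℂ) :
    ‖ρ * c‖ ^ 2 ≤ 2 * ‖-(ρ * (Real.exp (-ρ) * a)) + ρ * c‖ ^ 2 + 8 * (‖a‖ ^ 2 / ρ) := by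
  have hρ0 : 0 < ρ := one_pos.trans_le hρ
  set m : ℂ := -(ρ * (Real.exp (-ρ) * a)) + ρ * c with hm
  have e : ρ * c = m + (ρ * Real.exp (-ρ) : ℝ) * a := by rw [hm]; push_cast; ring
  have h1 : ‖ρ * c‖ ≤ ‖m‖ + ρ * Real.exp (-ρ) * ‖a‖ := by
    rw [e]
    refine (norm_add_le _ _).trans (le_of_eq ?_)
    rw [norm_mul, Complex.norm_real, Real.norm_of_nonneg (by positivity)]
  have h2 : ρ * Real.exp (-ρ) ≤ 2 / ρ := by
    calc ρ * Real.exp (-ρ) ≤ ρ * (2 / ρ ^ 2) :=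
          mul_le_mul_of_nonneg_left (exp_neg_le_div_sq hρ0) hρ0.le
      _ = 2 / ρ := by field_simp
  have h3 : ‖ρ * c‖ ≤ ‖m‖ + 2 / ρ * ‖a‖ :=
    h1.trans (by gcongr)
  have h4 : ‖ρ * c‖ ^ 2 ≤ (‖m‖ + 2 / ρ * ‖a‖) ^ 2 := pow_le_pow_left₀ (norm_nonneg _) h3 2
  have h5 : (2 / ρ * ‖a‖) ^ 2 ≤ 4 * (‖a‖ ^ 2 / ρ) := by
    have : (2 / ρ * ‖a‖) ^ 2 = 4 * (‖a‖ ^ 2 / ρ) * (1 / ρ) := by field_simp; ring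
    rw [this]
    refine mul_le_of_le_one_right (by positivity) ?_
    rw [div_le_one hρ0]; exact hρ
  nlinarith [sq_nonneg (‖m‖ - 2 / ρ * ‖a‖)]

theorem exists_cauchy_data {ρ : ℝ} (hρ : 0 < ρ) (z z' : ℂ) (h : ℝ → ℂ) :
    ∃ a c : ℂ, scal ρ a c h 1 = z ∧ scalDeriv ρ a c h 1 = z' := by
  have hρ0 : (ρ : ℂ) ≠ 0 := Complex.ofReal_ne_zero.2 hρ.ne'
  have hE : (Real.exp (-ρ) : ℂ) ≠ 0 := Complex.ofReal_ne_zero.2 (Real.exp_pos _).ne'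
  set m : ℂ := z - (2 * ρ : ℂ)⁻¹ * expConv ρ h 1
  set n : ℂ := z' + (2 * ρ : ℂ)⁻¹ * (ρ * expConv ρ h 1)
  -- The solution of the system p + c = m, -ρp + ρc = n for p = exp(-ρ)a. The factor exp(ρ) in a
  -- does no harm here, because summability is obtained separately.
  refine ⟨(Real.exp (-ρ) : ℂ)⁻¹ * ((m - n / ρ) / 2), (m + n / ρ) / 2, ?_, ?_⟩
  · rw [scal_one, mul_inv_cancel_left₀ hE]
    simp only [m, n]
    field_simp
    ring
  · rw [scalDeriv_one, mul_inv_cancel_left₀ hE]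
    simp only [m, n]
    field_simp
    ring

/-! ### Square integrable functions in coordinates -/

/-- The variance of f under the probability measure on (0,1) is nonnegative. -/
theorem sq_integral_le {f : ℝ → ℝ} (hf : Integrable f mu01)
    (hf2 : Integrable (fun t => f t ^ 2) mu01) : (∫ t, f t ∂mu01) ^ 2 ≤ ∫ t, f t ^ 2 ∂mu01 := by
  set m := ∫ t, f t ∂mu01 with hm
  have h : 0 ≤ ∫ t, (f t - m) ^ 2 ∂mu01 := integral_nonneg fun t => sq_nonneg _
  have e : ∀ t, (f t - m) ^ 2 = f t ^ 2 - (2 * m * f t - m ^ 2) := fun t => by ring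
  simp only [e] at h
  have h2 : Integrable (fun t => 2 * m * f t - m ^ 2) mu01 :=
    (hf.const_mul _).sub (integrable_const _)
  rw [integral_sub hf2 h2, integral_sub (hf.const_mul _) (integrable_const _), integral_const_mul] at h
  simp only [integral_const, probReal_univ, one_smul, ← hm] at h
  nlinarith

theorem summable_add_sq {ι : Type*} {p q : ι → ℝ} (hp : Summable fun i => p i ^ 2)
    (hq : Summable fun i => q i ^ 2) : Summable fun i => (p i + q i) ^ 2 :=
  ((hp.mul_left 2).add (hq.mul_left 2)).of_nonneg_of_le (fun _ => sq_nonneg _)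
    fun i => by nlinarith [sq_nonneg (p i - q i)]

theorem integrable_coord {f : ℝ → H} (hf : MemLp f 2 mu01) (v : H) :
    Integrable (fun t => ⟪v, f t⟫_ℂ) mu01 :=
  (hf.const_inner v).integrable one_le_two

theorem integrable_sq_coord {f : ℝ → H} (hf : MemLp f 2 mu01) (v : H) :
    Integrable (fun t => ‖⟪v, f t⟫_ℂ‖ ^ 2) mu01 :=
  (hf.const_inner v).integrable_norm_pow two_ne_zero

section L2Coordinates

variable {ι : Type*} (b : HilbertBasis ι ℂ H)

include b

theorem summable_integral_sq_coord {f : ℝ → H} (hf : MemLp f 2 mu01) :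
    Summable fun i => ∫ t, ‖⟪b i, f t⟫_ℂ‖ ^ 2 ∂mu01 := by
  refine summable_of_sum_le (c := ∫ t, ‖f t‖ ^ 2 ∂mu01)
    (fun i => integral_nonneg fun t => sq_nonneg _) fun s => ?_
  rw [← integral_finsetSum _ fun i _ => integrable_sq_coord hf (b i)]
  refine integral_mono (integrable_finsetSum _ fun i _ => integrable_sq_coord hf (b i))
    (hf.integrable_norm_pow two_ne_zero) fun t => ?_
  exact sum_le_hasSum s (fun i _ => sq_nonneg _) (hasSum_sq_coord b (f t))

theorem summable_sq_integral_coord {f : ℝ → H} (hf : MemLp f 2 mu01) :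
    Summable fun i => (∫ t, ‖⟪b i, f t⟫_ℂ‖ ∂mu01) ^ 2 :=
  (summable_integral_sq_coord b hf).of_nonneg_of_le (fun _ => sq_nonneg _) fun i =>
    sq_integral_le (integrable_coord hf (b i)).norm (integrable_sq_coord hf (b i))

variable [Countable ι]

theorem aestronglyMeasurable_of_coord {f : ℝ → H}
    (hf : ∀ i, AEStronglyMeasurable (fun t => ⟪b i, f t⟫_ℂ) mu01) :
    AEStronglyMeasurable f mu01 := by
  refine aestronglyMeasurable_of_tendsto_ae (u := (atTop : Filter (Finset ι)))
    (f := fun s t => ∑ i ∈ s, ⟪b i, f t⟫_ℂ • b i) (fun s => ?_) (ae_of_all _ fun t => ?_)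
  · exact Finset.aestronglyMeasurable_fun_sum _ fun i _ => (hf i).smul_const (b i)
  · have := b.hasSum_repr (f t)
    simpa [HasSum, b.repr_apply_apply] using this

/-- Parseval's identity pointwise in t, then Tonelli's theorem to exchange the sum over i with the
integral. -/
theorem memLp_of_coord {f : ℝ → H} (hm : AEStronglyMeasurable f mu01)
    (hi : ∀ i, Integrable (fun t => ‖⟪b i, f t⟫_ℂ‖ ^ 2) mu01)
    (hs : Summable fun i => ∫ t, ‖⟪b i, f t⟫_ℂ‖ ^ 2 ∂mu01) : MemLp f 2 mu01 := by
  rw [memLp_two_iff_integrable_sq_norm hm]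
  refine ⟨(hm.norm.pow 2), ?_⟩
  rw [hasFiniteIntegral_iff_ofReal (ae_of_all _ fun t => sq_nonneg _)]
  have e : ∀ t, ENNReal.ofReal (‖f t‖ ^ 2) = ∑' i, ENNReal.ofReal (‖⟪b i, f t⟫_ℂ‖ ^ 2) := fun t => by
    rw [norm_sq_eq_tsum b, ENNReal.ofReal_tsum_of_nonneg (fun i => sq_nonneg _)
      (summable_sq_coord b _)]
  simp only [e]
  rw [lintegral_tsum fun i => (hi i).1.aemeasurable.ennreal_ofReal]
  have e2 : ∀ i, ∫⁻ t, ENNReal.ofReal (‖⟪b i, f t⟫_ℂ‖ ^ 2) ∂mu01 =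
      ENNReal.ofReal (∫ t, ‖⟪b i, f t⟫_ℂ‖ ^ 2 ∂mu01) := fun i =>
    (ofReal_integral_eq_lintegral_ofReal (hi i) (ae_of_all _ fun t => sq_nonneg _)).symm
  simp only [e2]
  rw [← ENNReal.ofReal_tsum_of_nonneg (fun i => integral_nonneg fun t => sq_nonneg _) hs]
  exact ENNReal.ofReal_lt_top

/-- Parseval's identity integrated termwise; Σ∫(|z_i|² + |w_i|²) < ∞ justifies the exchange. -/
theorem hasSum_inner_L2 (z w : L2H H) :
    HasSum (fun i => ∫ t, conj ⟪b i, z t⟫_ℂ * ⟪b i, w t⟫_ℂ ∂mu01) ⟪z, w⟫_ℂ := by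
  have hz := Lp.memLp z
  have hw := Lp.memLp w
  have hb : ∀ i t, ‖conj ⟪b i, z t⟫_ℂ * ⟪b i, w t⟫_ℂ‖ ≤
      ‖⟪b i, z t⟫_ℂ‖ ^ 2 + ‖⟪b i, w t⟫_ℂ‖ ^ 2 := by
    intro i t
    rw [norm_mul, RCLike.norm_conj]
    nlinarith [sq_nonneg (‖⟪b i, z t⟫_ℂ‖ - ‖⟪b i, w t⟫_ℂ‖), sq_nonneg ‖⟪b i, z t⟫_ℂ‖,
      sq_nonneg ‖⟪b i, w t⟫_ℂ‖]
  have hI : ∀ i, Integrable (fun t => conj ⟪b i, z t⟫_ℂ * ⟪b i, w t⟫_ℂ) mu01 := fun i =>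
    ((integrable_sq_coord hz (b i)).add (integrable_sq_coord hw (b i))).mono'
      ((integrable_conj (integrable_coord hz (b i))).1.mul (integrable_coord hw (b i)).1)
      (ae_of_all _ (hb i))
  have h := hasSum_integral_of_summable_integral_norm hI (by
    refine ((summable_integral_sq_coord b hz).add
      (summable_integral_sq_coord b hw)).of_nonneg_of_le
      (fun i => integral_nonneg fun t => norm_nonneg _) fun i => ?_
    rw [← integral_add (integrable_sq_coord hz (b i)) (integrable_sq_coord hw (b i))]
    exact integral_mono (hI i).norm
      ((integrable_sq_coord hz (b i)).add (integrable_sq_coord hw (b i))) (hb i))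
  have e : ⟪z, w⟫_ℂ = ∫ t, ∑' i, conj ⟪b i, z t⟫_ℂ * ⟪b i, w t⟫_ℂ ∂mu01 := by
    rw [L2.inner_def]
    refine integral_congr_ae (ae_of_all _ fun t => ?_)
    simp only
    rw [← b.tsum_inner_mul_inner]
    exact tsum_congr fun i => by rw [inner_conj_symm]
  rw [e]
  exact h

theorem ae_eq_of_coord {f g : ℝ → H}
    (h : ∀ i, (fun t => ⟪b i, f t⟫_ℂ) =ᵐ[mu01] fun t => ⟪b i, g t⟫_ℂ) : f =ᵐ[mu01] g := by
  filter_upwards [ae_all_iff.2 h] with t ht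
  exact coord_ext b ht

end L2Coordinates

/-! ### The solution in coordinates -/

/-- The integral is (1 - exp(-2ρ))/2. This bound, uniform in ρ, is the origin of the exponent 1/4:
it makes λ_i^(1/4) exp(-√λ_i t) bounded in L_2(0,1). -/
theorem integral_mul_exp_le (ρ : ℝ) :
    Integrable (fun t => Real.exp (-(t * ρ)) ^ 2 * ρ) mu01 ∧
      ∫ t, Real.exp (-(t * ρ)) ^ 2 * ρ ∂mu01 ≤ 1 := by
  have hc : Continuous fun t : ℝ => Real.exp (-(t * ρ)) ^ 2 * ρ := by fun_prop
  constructor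
  · exact (hc.integrableOn_Icc (a := 0) (b := 1)).mono_set Ioo_subset_Icc_self
  · rw [integral_mu01, intervalIntegral.integral_eq_sub_of_hasDerivAt
      (f := fun t => -(Real.exp (-(t * ρ)) ^ 2) / 2) ?_ (hc.intervalIntegrable _ _)]
    · have := sq_nonneg (Real.exp (-(1 * ρ)))
      simp only [zero_mul, neg_zero, Real.exp_zero]
      linarith
    · intro t _
      have h : HasDerivAt (fun t : ℝ => Real.exp (-(t * ρ))) (Real.exp (-(t * ρ)) * -(1 * ρ)) t :=
        ((hasDerivAt_id t).mul_const ρ).neg.exp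
      refine ((h.pow 2).neg.div_const 2).congr_deriv ?_
      push_cast
      ring

namespace IsDiag

variable {ι : Type*} {A : H →ₗ.[ℂ] H} {b : HilbertBasis ι ℂ H} {lam : ι → ℝ} (hD : IsDiag A b lam)

include hD

theorem one_le_sqrt (i : ι) : 1 ≤ √(lam i) := by
  rw [Real.one_le_sqrt]; exact (hD.one_lt i).le

theorem sqrt_pos (i : ι) : 0 < √(lam i) := one_pos.trans_le (hD.one_le_sqrt i)

theorem rpow_quarter_pos (i : ι) : 0 < lam i ^ (1 / 4 : ℝ) := Real.rpow_pos_of_pos (hD.pos i) _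

theorem rpow_quarter_sq (i : ι) : (lam i ^ (1 / 4 : ℝ)) ^ 2 = √(lam i) := by
  rw [← Real.rpow_natCast, ← Real.rpow_mul (hD.pos i).le, Real.sqrt_eq_rpow]
  norm_num

theorem rpow_quarter_le (i : ι) : lam i ^ (1 / 4 : ℝ) ≤ √(lam i) := by
  rw [Real.sqrt_eq_rpow]
  exact Real.rpow_le_rpow_of_exponent_le (hD.one_lt i).le (by norm_num)

theorem exp_mul_le {t : ℝ} (ht : 0 < t) (i : ι) :
    Real.exp (-(t * √(lam i))) * √(lam i) * lam i ^ (1 / 4 : ℝ) ≤ 2 / t ^ 2 := by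
  have h1 := hD.sqrt_pos i
  have h2 := exp_neg_le_div_sq (mul_pos ht h1)
  have h3 := hD.rpow_quarter_le i
  have h4 := (hD.rpow_quarter_pos i).le
  calc _ ≤ 2 / (t * √(lam i)) ^ 2 * √(lam i) * √(lam i) := by gcongr
    _ = 2 / t ^ 2 := by field_simp

/-- The coefficient in the expansion of `sol` that comes from `f = Ã^(1/4) x`. -/
theorem exists_coord_exp {t : ℝ} (ht : 0 < t) (x : H) :
    ∃ z, ∀ i, ⟪b i, z⟫_ℂ =
      expSqrt t (lam i) * ((lam i ^ (1 / 4 : ℝ) : ℝ) * ⟪b i, x⟫_ℂ) := by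
  obtain ⟨z, hz⟩ := hD.exists_coord_mul (φ := fun μ => expSqrt t μ * μ ^ (1 / 4 : ℝ))
    (C := 2 / t ^ 2) (fun i => by
      have h4 := hD.rpow_quarter_pos i
      have h5 : 0 < expSqrt t (lam i) := Real.exp_pos _
      rw [abs_of_pos (mul_pos h5 h4)]
      refine le_trans ?_ (hD.exp_mul_le ht i)
      refine mul_le_mul_of_nonneg_right ?_ h4.le
      exact le_mul_of_one_le_right (Real.exp_pos _).le (hD.one_le_sqrt i)) x
  exact ⟨z, fun i => by rw [hz i]; push_cast; ring⟩

theorem coord_expSqrt {t : ℝ} (ht : 0 ≤ t) (x : H) (i : ι) :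
    ⟪b i, fnApply A (expSqrt t) x⟫_ℂ = Real.exp (-(t * √(lam i))) * ⟪b i, x⟫_ℂ :=
  hD.coord_fnApply (hD.expSqrt_le ht) x i

theorem coord_kernel (r : ℝ) (x : H) (i : ι) :
    ⟪b i, fnApply A (expSqrt |r|) (fnApply A (fun μ => μ ^ (-(1 / 2) : ℝ)) x)⟫_ℂ =
      (√(lam i) : ℂ)⁻¹ * (Real.exp (-(|r| * √(lam i))) * ⟪b i, x⟫_ℂ) := by
  rw [hD.coord_expSqrt (abs_nonneg r), hD.coord_fnApply (hD.rpow_le_one (by norm_num)),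
    Real.rpow_neg (hD.pos i).le, ← Real.sqrt_eq_rpow]
  push_cast
  ring

theorem coord_opPow_half (g : (opPow A (1 / 2)).domain) (i : ι) :
    ⟪b i, opPow A (1 / 2) g⟫_ℂ = √(lam i) * ⟪b i, (g : H)⟫_ℂ := by
  rw [Real.sqrt_eq_rpow]
  exact hD.coord_fnCalc g i

variable [Countable ι]

theorem coord_sol (x : H) (g : (opPow A (1 / 2)).domain) (h : L2H H) {t : ℝ}
    (ht : t ∈ Ioc (0 : ℝ) 1) (i : ι) :
    ⟪b i, sol A (toNeg (opPow A (1 / 4)) x) g h t⟫_ℂ =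
      scal (√(lam i)) ((lam i ^ (1 / 4 : ℝ) : ℝ) * ⟪b i, x⟫_ℂ) ⟪b i, (g : H)⟫_ℂ
        (fun s => ⟪b i, h s⟫_ℂ) t := by
  have hh := Lp.memLp h
  obtain ⟨z, hz⟩ := hD.exists_coord_exp ht.1 x
  have hc : ∀ i, AEStronglyMeasurable (fun s => ⟪b i, fnApply A (expSqrt |t - s|)
      (fnApply A (fun μ => μ ^ (-(1 / 2) : ℝ)) (h s))⟫_ℂ) mu01 := by
    intro i
    simp only [hD.coord_kernel]
    refine AEStronglyMeasurable.const_mul ?_ _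
    exact (integrable_exp_mul (hD.sqrt_pos i).le (integrable_coord hh (b i)) t).1
  -- Integrability of the vector-valued integrand allows the coordinate functional to pass under the
  -- integral. It follows from that of h, since the kernel multiplies each coordinate by at most 1.
  have hI : Integrable (fun s => fnApply A (expSqrt |t - s|)
      (fnApply A (fun μ => μ ^ (-(1 / 2) : ℝ)) (h s))) mu01 := by
    refine (hh.integrable one_le_two).mono (aestronglyMeasurable_of_coord b hc)
      (ae_of_all _ fun s => ?_)
    refine le_of_sq_le_sq ?_ (norm_nonneg _)
    refine hasSum_le (fun i => ?_) (hasSum_sq_coord b _) (hasSum_sq_coord b _)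
    refine pow_le_pow_left₀ (norm_nonneg _) ?_ 2
    rw [hD.coord_kernel, norm_mul, norm_inv, Complex.norm_real,
      Real.norm_of_nonneg (hD.sqrt_pos i).le]
    refine (mul_le_of_le_one_left (norm_nonneg _) (inv_le_one_of_one_le₀ (hD.one_le_sqrt i))).trans ?_
    exact norm_exp_mul_le (hD.sqrt_pos i).le _ _
  unfold sol
  rw [hD.extApply_coord hz, inner_add_right, inner_add_right, hz,
    hD.coord_expSqrt (sub_nonneg.2 ht.2), inner_smul_right, ← integral_inner hI]
  simp only [hD.coord_kernel]
  rw [integral_const_mul]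
  unfold scal expConv expSqrt
  rw [mul_inv]
  ring

/-- Away from t = 0 the semigroup smooths: the growth √λ_i λ_i^(1/4) is absorbed by exp(-δ√λ_i), at
the price of the constant 2/δ². -/
theorem norm_scalDeriv_le (x : H) (g : (opPow A (1 / 2)).domain) (h : L2H H) {δ t : ℝ}
    (hδ : 0 < δ) (ht : t ∈ Icc δ 1) (i : ι) :
    ‖scalDeriv (√(lam i)) ((lam i ^ (1 / 4 : ℝ) : ℝ) * ⟪b i, x⟫_ℂ) ⟪b i, (g : H)⟫_ℂ
        (fun s => ⟪b i, h s⟫_ℂ) t‖ ≤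
      2 / δ ^ 2 * ‖⟪b i, x⟫_ℂ‖ + (‖⟪b i, opPow A (1 / 2) g⟫_ℂ‖ + ∫ s, ‖⟪b i, h s⟫_ℂ‖ ∂mu01) := by
  have h1 := hD.sqrt_pos i
  have hh := integrable_coord (Lp.memLp h) (b i)
  unfold scalDeriv
  rw [add_assoc]
  refine (norm_add_le _ _).trans (add_le_add ?_ ((norm_add_le _ _).trans (add_le_add ?_ ?_)))
  · rw [norm_neg, norm_mul, norm_mul, norm_mul, Complex.norm_real, Complex.norm_real,
      Complex.norm_real, Real.norm_of_nonneg h1.le, Real.norm_of_nonneg (Real.exp_pos _).le,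
      Real.norm_of_nonneg (hD.rpow_quarter_pos i).le]
    have e : Real.exp (-(t * √(lam i))) ≤ Real.exp (-(δ * √(lam i))) :=
      Real.exp_le_exp.2 (neg_le_neg (mul_le_mul_of_nonneg_right ht.1 h1.le))
    have h2 := hD.exp_mul_le hδ i
    have h3 := (hD.rpow_quarter_pos i).le
    calc _ = Real.exp (-(t * √(lam i))) * √(lam i) * lam i ^ (1 / 4 : ℝ) * ‖⟪b i, x⟫_ℂ‖ := by ring
      _ ≤ Real.exp (-(δ * √(lam i))) * √(lam i) * lam i ^ (1 / 4 : ℝ) * ‖⟪b i, x⟫_ℂ‖ := by gcongr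
      _ ≤ _ := by gcongr
  · rw [hD.coord_opPow_half, mul_left_comm, norm_mul, Complex.norm_real,
      Real.norm_of_nonneg (Real.exp_pos _).le]
    refine mul_le_of_le_one_left (norm_nonneg _) (Real.exp_le_one_iff.2 ?_)
    rw [neg_nonpos]
    exact mul_nonneg (sub_nonneg.2 ht.2) h1.le
  · have h2 := norm_expConvDeriv_le h1.le hh t
    have h0 : 0 ≤ ∫ s, ‖⟪b i, h s⟫_ℂ‖ ∂mu01 := integral_nonneg fun _ => norm_nonneg _
    rw [norm_mul, norm_inv, norm_mul, Complex.norm_real, Real.norm_of_nonneg h1.le,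
      RCLike.norm_ofNat, inv_mul_le_iff₀ (by positivity)]
    nlinarith [mul_nonneg h1.le h0]

theorem summable_sq_bound (C : ℝ) (x y : H) (h : L2H H) :
    Summable fun i => (C * ‖⟪b i, x⟫_ℂ‖ + (‖⟪b i, y⟫_ℂ‖ + ∫ s, ‖⟪b i, h s⟫_ℂ‖ ∂mu01)) ^ 2 := by
  refine summable_add_sq ?_ (summable_add_sq (summable_sq_coord b y)
    (summable_sq_integral_coord b (Lp.memLp h)))
  simpa only [mul_pow] using (summable_sq_coord b x).mul_left (C ^ 2)

theorem hasDerivWithinAt_sol (x : H) (g : (opPow A (1 / 2)).domain) (h : L2H H) {t : ℝ}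
    (ht : t ∈ Ioc (0 : ℝ) 1) :
    HasDerivWithinAt (sol A (toNeg (opPow A (1 / 4)) x) g h)
        (solDeriv A (toNeg (opPow A (1 / 4)) x) g h t) (Ioc 0 1) t ∧
      ∀ i, ⟪b i, solDeriv A (toNeg (opPow A (1 / 4)) x) g h t⟫_ℂ =
        scalDeriv (√(lam i)) ((lam i ^ (1 / 4 : ℝ) : ℝ) * ⟪b i, x⟫_ℂ) ⟪b i, (g : H)⟫_ℂ
        (fun s => ⟪b i, h s⟫_ℂ) t := by
  -- The square summable bound on the derivatives degenerates at 0, so differentiation is carried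
  -- out on [t/2, 1], a neighbourhood of t within (0,1].
  have hδ : 0 < t / 2 := half_pos ht.1
  have hB := hD.summable_sq_bound (2 / (t / 2) ^ 2) x (opPow A (1 / 2) g) h
  have hex : ∀ s : ℝ, ∃ D : H, s ∈ Icc (t / 2) 1 → ∀ i, ⟪b i, D⟫_ℂ =
      scalDeriv (√(lam i)) ((lam i ^ (1 / 4 : ℝ) : ℝ) * ⟪b i, x⟫_ℂ) ⟪b i, (g : H)⟫_ℂ
        (fun s => ⟪b i, h s⟫_ℂ) s := by
    intro s
    by_cases hs : s ∈ Icc (t / 2) 1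
    · obtain ⟨D, hD'⟩ := exists_coord_of_le b hB (hD.norm_scalDeriv_le x g h hδ hs)
      exact ⟨D, fun _ => hD'⟩
    · exact ⟨0, fun h => absurd h hs⟩
  choose D hDc using hex
  have hsub : Icc (t / 2) 1 ⊆ Ioc (0 : ℝ) 1 := fun s hs => ⟨hδ.trans_le hs.1, hs.2⟩
  have htI : t ∈ Icc (t / 2) 1 := ⟨by linarith [ht.1], ht.2⟩
  have h1 : HasDerivWithinAt (sol A (toNeg (opPow A (1 / 4)) x) g h) (D t) (Icc (t / 2) 1) t := by
    refine hasDerivWithinAt_of_coord b (convex_Icc _ _) hB (fun s hs i => ?_) (fun i s hs => ?_) htI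
    · rw [hDc s hs]
      exact hD.norm_scalDeriv_le x g h hδ hs i
    · rw [hDc s hs]
      refine ((hasDerivAt_scal (hD.sqrt_pos i).le _ _ (integrable_coord (Lp.memLp h) (b i))
        s).hasDerivWithinAt).congr (fun r hr => ?_) ?_
      · exact hD.coord_sol x g h (hsub hr) i
      · exact hD.coord_sol x g h (hsub hs) i
  have h2 : HasDerivWithinAt (sol A (toNeg (opPow A (1 / 4)) x) g h) (D t) (Ioc 0 1) t := by
    refine h1.mono_of_mem_nhdsWithin ?_
    have : Ioi (t / 2) ∩ Ioc 0 1 ⊆ Icc (t / 2) 1 := fun s hs => ⟨hs.1.le, hs.2.2⟩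
    exact mem_of_superset (inter_mem (mem_nhdsWithin_of_mem_nhds (Ioi_mem_nhds (half_lt_self ht.1)))
      self_mem_nhdsWithin) this
  have h3 : solDeriv A (toNeg (opPow A (1 / 4)) x) g h t = D t :=
    h2.derivWithin (uniqueDiffOn_Ioc 0 1 t ht)
  rw [h3]
  exact ⟨h2, hDc t htI⟩

theorem memLp_sol (x : H) (g : (opPow A (1 / 2)).domain) (h : L2H H) :
    MemLp (sol A (toNeg (opPow A (1 / 4)) x) g h) 2 mu01 := by
  set z := sol A (toNeg (opPow A (1 / 4)) x) g h with hz
  have hm : AEStronglyMeasurable z mu01 := by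
    refine ContinuousOn.aestronglyMeasurable (fun t ht => ?_) measurableSet_Ioo
    exact ((hD.hasDerivWithinAt_sol x g h (Ioo_subset_Ioc_self ht)).1.continuousWithinAt).mono
      Ioo_subset_Ioc_self
  set N : ι → ℝ := fun i => ‖⟪b i, (g : H)⟫_ℂ‖ + ∫ s, ‖⟪b i, h s⟫_ℂ‖ ∂mu01 with hN
  have hb : ∀ i, ∀ t ∈ Ioo (0 : ℝ) 1, ‖⟪b i, z t⟫_ℂ‖ ^ 2 ≤
      2 * ‖⟪b i, x⟫_ℂ‖ ^ 2 * (Real.exp (-(t * √(lam i))) ^ 2 * √(lam i)) + 2 * N i ^ 2 := by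
    intro i t ht
    have h1 := hD.sqrt_pos i
    have hh := integrable_coord (Lp.memLp h) (b i)
    have h0 : 0 ≤ ∫ s, ‖⟪b i, h s⟫_ℂ‖ ∂mu01 := integral_nonneg fun _ => norm_nonneg _
    have h2 : ‖⟪b i, z t⟫_ℂ‖ ≤
        Real.exp (-(t * √(lam i))) * (lam i ^ (1 / 4 : ℝ) * ‖⟪b i, x⟫_ℂ‖) + N i := by
      rw [hz, hD.coord_sol x g h (Ioo_subset_Ioc_self ht), scal, add_assoc]
      refine (norm_add_le _ _).trans (add_le_add (le_of_eq ?_)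
        ((norm_add_le _ _).trans (add_le_add ?_ ?_)))
      · rw [norm_mul, norm_mul, Complex.norm_real, Complex.norm_real,
          Real.norm_of_nonneg (Real.exp_pos _).le, Real.norm_of_nonneg (hD.rpow_quarter_pos i).le]
      · rw [norm_mul, Complex.norm_real, Real.norm_of_nonneg (Real.exp_pos _).le]
        refine mul_le_of_le_one_left (norm_nonneg _) (Real.exp_le_one_iff.2 ?_)
        rw [neg_nonpos]
        exact mul_nonneg (sub_nonneg.2 ht.2.le) h1.le
      · have h2 := norm_expConv_le h1.le hh t
        rw [norm_mul, norm_inv, norm_mul, Complex.norm_real, Real.norm_of_nonneg h1.le,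
          RCLike.norm_ofNat, inv_mul_le_iff₀ (by positivity)]
        nlinarith [hD.one_le_sqrt i]
    calc _ ≤ (Real.exp (-(t * √(lam i))) * (lam i ^ (1 / 4 : ℝ) * ‖⟪b i, x⟫_ℂ‖) + N i) ^ 2 :=
          pow_le_pow_left₀ (norm_nonneg _) h2 2
      _ ≤ 2 * (Real.exp (-(t * √(lam i))) * (lam i ^ (1 / 4 : ℝ) * ‖⟪b i, x⟫_ℂ‖)) ^ 2
          + 2 * N i ^ 2 := by
          nlinarith [sq_nonneg (Real.exp (-(t * √(lam i))) *
            (lam i ^ (1 / 4 : ℝ) * ‖⟪b i, x⟫_ℂ‖) - N i)]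
      _ = _ := by
          rw [mul_pow, mul_pow, hD.rpow_quarter_sq]
          ring
  have hI : ∀ i, Integrable (fun t => 2 * ‖⟪b i, x⟫_ℂ‖ ^ 2 *
      (Real.exp (-(t * √(lam i))) ^ 2 * √(lam i)) + 2 * N i ^ 2) mu01 := fun i =>
    ((integral_mul_exp_le √(lam i)).1.const_mul _).add (integrable_const _)
  have hi : ∀ i, Integrable (fun t => ‖⟪b i, z t⟫_ℂ‖ ^ 2) mu01 := by
    intro i
    refine (hI i).mono' ((hm.const_inner).norm.pow 2) ?_
    filter_upwards [ae_mem_Ioo] with t ht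
    rw [Real.norm_of_nonneg (sq_nonneg _)]
    exact hb i t ht
  refine memLp_of_coord b hm hi ?_
  have hs := ((summable_sq_coord b x).mul_left 2).add ((summable_add_sq
    (summable_sq_coord b (g : H)) (summable_sq_integral_coord b (Lp.memLp h))).mul_left 2)
  refine hs.of_nonneg_of_le (fun i => integral_nonneg fun t => sq_nonneg _) fun i => ?_
  refine (integral_mono_ae (hi i) (hI i) ?_).trans ?_
  · filter_upwards [ae_mem_Ioo] with t ht using hb i t ht
  · rw [integral_add ((integral_mul_exp_le √(lam i)).1.const_mul _) (integrable_const _),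
      integral_const_mul]
    simp only [integral_const, probReal_univ, one_smul]
    refine add_le_add (mul_le_of_le_one_right (by positivity)
      (integral_mul_exp_le √(lam i)).2) le_rfl

end IsDiag

/-! ### The bounded perturbation -/

theorem exists_mulOp {ι : Type*} [Countable ι] (b : HilbertBasis ι ℂ H) {q : ℝ → H →L[ℂ] H}
    (hqm : ∀ x : H, AEStronglyMeasurable (fun t => q t x) mu01)
    (hqs : ∀ t ∈ Ioo (0 : ℝ) 1, IsSelfAdjoint (q t))
    (hqb : ∃ C : ℝ, ∀ t ∈ Ioo (0 : ℝ) 1, ‖q t‖ ≤ C) :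
    ∃ Q : L2H H → L2H H, (∀ z, Q z =ᵐ[mu01] fun t => q t (z t)) ∧
      ∀ z w, ⟪Q z, w⟫_ℂ = ⟪z, Q w⟫_ℂ := by
  obtain ⟨C, hC⟩ := hqb
  have hm : ∀ z : L2H H, MemLp (fun t => q t (z t)) 2 mu01 := by
    intro z
    have hz := Lp.memLp z
    refine hz.of_le_mul (c := C) ?_ ?_
    -- Strong measurability of q is known only on fixed vectors, so z(t) is expanded in the basis
    -- and q(t)z(t) is a limit of finite sums.
    · refine aestronglyMeasurable_of_tendsto_ae (u := (atTop : Filter (Finset ι)))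
        (f := fun s t => ∑ i ∈ s, ⟪b i, z t⟫_ℂ • q t (b i)) (fun s => ?_) (ae_of_all _ fun t => ?_)
      · exact Finset.aestronglyMeasurable_fun_sum _ fun i _ =>
          (integrable_coord hz (b i)).1.smul (hqm (b i))
      · have := (b.hasSum_repr (z t)).mapL (q t)
        simpa [HasSum, b.repr_apply_apply] using this
    · filter_upwards [ae_mem_Ioo] with t ht
      exact ((q t).le_opNorm _).trans (mul_le_mul_of_nonneg_right (hC t ht) (norm_nonneg _))
  refine ⟨fun z => (hm z).toLp _, fun z => (hm z).coeFn_toLp, fun z w => ?_⟩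
  rw [L2.inner_def, L2.inner_def]
  refine integral_congr_ae ?_
  filter_upwards [(hm z).coeFn_toLp, (hm w).coeFn_toLp, ae_mem_Ioo] with t h1 h2 ht
  rw [h1, h2]
  exact (hqs t ht).isSymmetric (z t) (w t)

/-! ### Green's formula on the domain of the maximal operator -/

/-- The coordinate of `sol A (Ã^(1/4) x) g h` in an eigenbasis. -/
def solCoord {ι : Type*} (b : HilbertBasis ι ℂ H) (lam : ι → ℝ) (x g : H) (h : L2H H) (i : ι)
    (t : ℝ) : ℂ :=
  scal (√(lam i)) ((lam i ^ (1 / 4 : ℝ) : ℝ) * ⟪b i, x⟫_ℂ) ⟪b i, g⟫_ℂ (fun s => ⟪b i, h s⟫_ℂ) t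

/-- The derivative of `solCoord b lam x g h i`. -/
def solCoordDeriv {ι : Type*} (b : HilbertBasis ι ℂ H) (lam : ι → ℝ) (x g : H) (h : L2H H) (i : ι)
    (t : ℝ) : ℂ :=
  scalDeriv (√(lam i)) ((lam i ^ (1 / 4 : ℝ) : ℝ) * ⟪b i, x⟫_ℂ) ⟪b i, g⟫_ℂ
    (fun s => ⟪b i, h s⟫_ℂ) t

/-- `P = (Z, W)` with `Z = {z, z₁, z(1)}` and `W = {h + Q z, -z(1), z'(1) - z₁}` for the function
`z = sol A (Ã^(1/4) x) g h`. -/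
structure IsMaxPair (A : H →ₗ.[ℂ] H) (Q : L2H H → L2H H) (x : H) (g : (opPow A (1 / 2)).domain)
    (h : L2H H) (P : BigL2 H × BigL2 H) : Prop where
  represents : Represents A (toNeg (opPow A (1 / 4)) x) g h P.1
  image_fst : P.2.fst = h + Q P.1.fst
  image_snd : P.2.snd.fst = -sol A (toNeg (opPow A (1 / 4)) x) g h 1
  image_trd : P.2.snd.snd = solDeriv A (toNeg (opPow A (1 / 4)) x) g h 1 - P.1.snd.fst

theorem one_mem_Ioc : (1 : ℝ) ∈ Ioc (0 : ℝ) 1 := ⟨one_pos, le_rfl⟩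

theorem inner_bigL2 (Y Z : BigL2 H) :
    ⟪Y, Z⟫_ℂ = ⟪Y.fst, Z.fst⟫_ℂ + (⟪Y.snd.fst, Z.snd.fst⟫_ℂ + ⟪Y.snd.snd, Z.snd.snd⟫_ℂ) := by
  rw [WithLp.prod_inner_apply, WithLp.prod_inner_apply]
  rfl

/-- The symmetric operator Q cancels, and so do the free components z₁; only the Cauchy data at 1
remain. They will cancel the boundary terms at 1 in the scalar Green formula. -/
theorem inner_bigL2_sub {Q : L2H H → L2H H} (hQ : ∀ z w, ⟪Q z, w⟫_ℂ = ⟪z, Q w⟫_ℂ)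
    {P P' : BigL2 H × BigL2 H} {h h' : L2H H} {z z' d d' : H}
    (h1 : P.1.snd.snd = z) (h1' : P'.1.snd.snd = z')
    (h2 : P.2.fst = h + Q P.1.fst) (h2' : P'.2.fst = h' + Q P'.1.fst)
    (h3 : P.2.snd.fst = -z) (h3' : P'.2.snd.fst = -z')
    (h4 : P.2.snd.snd = d - P.1.snd.fst) (h4' : P'.2.snd.snd = d' - P'.1.snd.fst) :
    ⟪P.2, P'.1⟫_ℂ - ⟪P.1, P'.2⟫_ℂ =
      ⟪h, P'.1.fst⟫_ℂ - ⟪P.1.fst, h'⟫_ℂ + ⟪d, z'⟫_ℂ - ⟪z, d'⟫_ℂ := by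
  rw [inner_bigL2, inner_bigL2, h1, h1', h2, h2', h3, h3', h4, h4', inner_add_left, inner_add_right,
    hQ, inner_sub_left, inner_sub_right, inner_neg_left, inner_neg_right]
  ring

namespace IsDiag

variable {ι : Type*} {A : H →ₗ.[ℂ] H} {b : HilbertBasis ι ℂ H} {lam : ι → ℝ} (hD : IsDiag A b lam)
variable [Countable ι] {Q : L2H H → L2H H} (hQ : ∀ z w, ⟪Q z, w⟫_ℂ = ⟪z, Q w⟫_ℂ)

include hD

theorem coord_of_represents {x : H} {g : (opPow A (1 / 2)).domain} {h : L2H H} {Z : BigL2 H}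
    (hZ : Represents A (toNeg (opPow A (1 / 4)) x) g h Z) :
    ∀ᵐ t ∂mu01, ∀ i, ⟪b i, Z.fst t⟫_ℂ = solCoord b lam x g h i t := by
  filter_upwards [hZ.1, ae_mem_Ioo] with t h1 ht i
  rw [h1]
  exact hD.coord_sol x g h (Ioo_subset_Ioc_self ht) i

include hQ

theorem hasSum_green {x x' : H} {g g' : (opPow A (1 / 2)).domain} {h h' : L2H H}
    {P P' : BigL2 H × BigL2 H} (hP : IsMaxPair A Q x g h P) (hP' : IsMaxPair A Q x' g' h' P') :
    HasSum (fun i => conj (solCoordDeriv b lam x g h i 0) * solCoord b lam x' g' h' i 0 -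
      conj (solCoord b lam x g h i 0) * solCoordDeriv b lam x' g' h' i 0)
      (⟪P.2, P'.1⟫_ℂ - ⟪P.1, P'.2⟫_ℂ) := by
  rw [inner_bigL2_sub hQ hP.represents.2 hP'.represents.2 hP.image_fst hP'.image_fst hP.image_snd
    hP'.image_snd hP.image_trd hP'.image_trd]
  have s1 := (((hasSum_inner_L2 b h P'.1.fst).sub (hasSum_inner_L2 b P.1.fst h')).add
    (b.hasSum_inner_mul_inner (solDeriv A (toNeg (opPow A (1 / 4)) x) g h 1)
      (sol A (toNeg (opPow A (1 / 4)) x') g' h' 1))).sub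
    (b.hasSum_inner_mul_inner (sol A (toNeg (opPow A (1 / 4)) x) g h 1)
      (solDeriv A (toNeg (opPow A (1 / 4)) x') g' h' 1))
  refine s1.congr_fun fun i => ?_
  have e1 : ∫ t, conj ⟪b i, h t⟫_ℂ * ⟪b i, P'.1.fst t⟫_ℂ ∂mu01 =
      ∫ t, conj ⟪b i, h t⟫_ℂ * solCoord b lam x' g' h' i t ∂mu01 := by
    refine integral_congr_ae ?_
    filter_upwards [hD.coord_of_represents hP'.represents] with t ht
    rw [ht]
  have e2 : ∫ t, conj ⟪b i, P.1.fst t⟫_ℂ * ⟪b i, h' t⟫_ℂ ∂mu01 =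
      ∫ t, conj (solCoord b lam x g h i t) * ⟪b i, h' t⟫_ℂ ∂mu01 := by
    refine integral_congr_ae ?_
    filter_upwards [hD.coord_of_represents hP.represents] with t ht
    rw [ht]
  rw [e1, e2, ← inner_conj_symm _ (b i), ← inner_conj_symm (sol A _ g h 1) (b i),
    (hD.hasDerivWithinAt_sol x g h one_mem_Ioc).2, (hD.hasDerivWithinAt_sol x' g' h' one_mem_Ioc).2,
    hD.coord_sol x g h one_mem_Ioc, hD.coord_sol x' g' h' one_mem_Ioc]
  have := scal_green (hD.sqrt_pos i) ((lam i ^ (1 / 4 : ℝ) : ℝ) * ⟪b i, x⟫_ℂ) ⟪b i, (g : H)⟫_ℂ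
    ((lam i ^ (1 / 4 : ℝ) : ℝ) * ⟪b i, x'⟫_ℂ) ⟪b i, (g' : H)⟫_ℂ
    (integrable_coord (Lp.memLp h) (b i)) (integrable_coord (Lp.memLp h') (b i))
  unfold solCoord solCoordDeriv
  rw [this]
  ring

end IsDiag

/-! ### Smooth functions vanishing near zero -/

theorem expConv_congr {ρ : ℝ} {h h' : ℝ → ℂ} (e : h =ᵐ[mu01] h') : expConv ρ h = expConv ρ h' := by
  funext t
  refine integral_congr_ae ?_
  filter_upwards [e] with s hs
  rw [hs]

/-- Zero Cauchy data at 0 force the coefficient of exp(-ρt) to vanish, and `expConv_of_smooth` at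
the right endpoint dictates c. -/
theorem scal_of_smooth {ρ : ℝ} (hρ : 0 < ρ) {y y' y'' h : ℝ → ℂ} {c : ℂ}
    (hy : ∀ t ∈ Icc (0 : ℝ) 1, HasDerivWithinAt y (y' t) (Icc 0 1) t)
    (hy' : ∀ t ∈ Icc (0 : ℝ) 1, HasDerivWithinAt y' (y'' t) (Icc 0 1) t)
    (hy'' : ContinuousOn y'' (Icc 0 1)) (h0 : y 0 = 0) (h0' : y' 0 = 0)
    (hh : h =ᵐ[mu01] fun s => -y'' s + ρ ^ 2 * y s) (hc : 2 * ρ * c = y' 1 + ρ * y 1) :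
    (∀ t ∈ Icc (0 : ℝ) 1, scal ρ 0 c h t = y t) ∧ scalDeriv ρ 0 c h 1 = y' 1 ∧
      scalDeriv ρ 0 c h 0 = 0 := by
  have hρ0 : (ρ : ℂ) ≠ 0 := Complex.ofReal_ne_zero.2 hρ.ne'
  have key := fun t (ht : t ∈ Icc (0 : ℝ) 1) =>
    (congrFun (expConv_congr (ρ := ρ) hh) t).trans (expConv_of_smooth hy hy' hy'' h0 h0' ht)
  refine ⟨fun t ht => ?_, ?_, ?_⟩
  · rw [scal, key t ht, ← hc]
    field_simp
    ring
  · rw [scalDeriv_one, key 1 (by simp)]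
    simp only [sub_self, zero_mul, neg_zero, Real.exp_zero, Complex.ofReal_one, one_mul, mul_zero,
      zero_add]
    field_simp
    linear_combination hc
  · rw [scalDeriv_zero, key 0 (by simp), h0, ← hc]
    simp only [sub_zero, one_mul, mul_zero]
    field_simp
    ring

theorem hasDerivWithinAt_inner {u : ℝ → H} {u' : H} {S : Set ℝ} {t : ℝ} (v : H)
    (h : HasDerivWithinAt u u' S t) : HasDerivWithinAt (fun t => ⟪v, u t⟫_ℂ) ⟪v, u'⟫_ℂ S t :=
  ((innerSL ℂ v).restrictScalars ℝ).hasFDerivAt.comp_hasDerivWithinAt t h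

theorem hasDerivWithinAt_of_contDiffOn {u : ℝ → H} (hu : ContDiffOn ℝ ∞ u (Icc 0 1)) :
    (∀ t ∈ Icc (0 : ℝ) 1, HasDerivWithinAt u (derivWithin u (Icc 0 1) t) (Icc 0 1) t) ∧
    (∀ t ∈ Icc (0 : ℝ) 1, HasDerivWithinAt (derivWithin u (Icc 0 1))
      (iteratedDerivWithin 2 u (Icc 0 1) t) (Icc 0 1) t) ∧
    ContinuousOn (iteratedDerivWithin 2 u (Icc 0 1)) (Icc 0 1) := by
  have hI := uniqueDiffOn_Icc (zero_lt_one (α := ℝ))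
  refine ⟨fun t ht => (hu.differentiableOn (by simp) t ht).hasDerivWithinAt, fun t ht => ?_,
    hu.continuousOn_iteratedDerivWithin
      (mod_cast le_top : ((2 : ℕ∞) : WithTop ℕ∞) ≤ ∞) hI⟩
  have h1 := hu.differentiableOn_iteratedDerivWithin (m := 1) (by norm_cast) hI t ht
  rw [iteratedDerivWithin_succ]
  rw [iteratedDerivWithin_one] at h1 ⊢
  exact h1.hasDerivWithinAt

namespace IsDiag

variable {ι : Type*} {A : H →ₗ.[ℂ] H} {b : HilbertBasis ι ℂ H} {lam : ι → ℝ} (hD : IsDiag A b lam)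
variable [Countable ι] {Q : L2H H → L2H H} {q : ℝ → H →L[ℂ] H}
  (hQq : ∀ z, Q z =ᵐ[mu01] fun t => q t (z t))

include hD hQq

/-- Each smooth element is itself of the form `sol`, with f = 0, h = -y'' + Ay and A^(1/2) g =
(y'(1) + A^(1/2) y(1))/2. -/
theorem exists_isMaxPair_of_mem_minGraph {P : BigL2 H × BigL2 H} (hP : P ∈ minGraph A q) :
    ∃ x g h, IsMaxPair A Q x g h P ∧
      ∀ i, solCoord b lam x g h i 0 = 0 ∧ solCoordDeriv b lam x g h i 0 = 0 := by
  obtain ⟨u, ⟨hu1, hu2, δ, hδ, hu3⟩, a1, a2, a3, a4, a5⟩ := hP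
  have m0 : (0 : ℝ) ∈ Icc (0 : ℝ) 1 := by simp
  have m1 : (1 : ℝ) ∈ Icc (0 : ℝ) 1 := by simp
  have hI := uniqueDiffOn_Icc (zero_lt_one (α := ℝ))
  obtain ⟨d1, d2, c2⟩ := hasDerivWithinAt_of_contDiffOn (hu1 0)
  set u' := derivWithin (u 0) (Icc 0 1) with hu'
  set u'' := iteratedDerivWithin 2 (u 0) (Icc 0 1)
  have hA : ∀ t ∈ Icc (0 : ℝ) 1, ∀ i, ⟪b i, u 1 t⟫_ℂ = lam i * ⟪b i, u 0 t⟫_ℂ := fun t ht =>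
    (hD.mem_graph _ _).1 (hu2 0 t ht)
  have z0 : u 0 0 = 0 := hu3 0 m0 hδ
  have z0' : u' 0 = 0 := by
    have e : u 0 =ᶠ[𝓝[Icc 0 1] 0] fun _ => 0 := by
      filter_upwards [self_mem_nhdsWithin, mem_nhdsWithin_of_mem_nhds (Iio_mem_nhds hδ)] with t ht ht'
      exact hu3 t ht ht'
    rw [hu', e.derivWithin_eq z0]
    simp
  -- The vector w is A^(1/2) y(1); it exists because y(1) is in D(A) and √λ_i ≤ λ_i.
  obtain ⟨w, hw⟩ := exists_coord_of_le b (a := fun i => √(lam i) * ⟪b i, u 0 1⟫_ℂ)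
    (summable_sq_coord b (u 1 1)) (fun i => by
      rw [hA 1 m1, norm_mul, norm_mul, Complex.norm_real, Complex.norm_real,
        Real.norm_of_nonneg (hD.sqrt_pos i).le, Real.norm_of_nonneg (hD.pos i).le]
      refine mul_le_mul_of_nonneg_right ?_ (norm_nonneg _)
      rw [Real.sqrt_le_left (hD.pos i).le]
      nlinarith [hD.one_lt i])
  obtain ⟨g, hg⟩ := hD.exists_opPow_eq (s := 1 / 2) (by norm_num) ((1 / 2 : ℂ) • (u' 1 + w))
  set h : L2H H := P.2.fst - Q P.1.fst with hh
  have hae : ∀ᵐ t ∂mu01, h t = -u'' t + u 1 t := by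
    filter_upwards [a1, a3, hQq P.1.fst, Lp.coeFn_sub P.2.fst (Q P.1.fst)] with t e1 e3 e4 e5
    rw [hh, e5, Pi.sub_apply, e3, e4, e1]
    abel
  have key : ∀ i, _ := fun i => scal_of_smooth (hD.sqrt_pos i)
    (y := fun t => ⟪b i, u 0 t⟫_ℂ) (y' := fun t => ⟪b i, u' t⟫_ℂ) (y'' := fun t => ⟪b i, u'' t⟫_ℂ)
    (h := fun t => ⟪b i, h t⟫_ℂ) (c := ⟪b i, (g : H)⟫_ℂ)
    (fun t ht => hasDerivWithinAt_inner (b i) (d1 t ht))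
    (fun t ht => hasDerivWithinAt_inner (b i) (d2 t ht))
    (continuousOn_const.inner c2) (by rw [z0, inner_zero_right])
    (by rw [z0', inner_zero_right])
    (by
      filter_upwards [hae, ae_mem_Ioo] with t e1 ht
      rw [e1, inner_add_right, inner_neg_right, hA t (Ioo_subset_Icc_self ht),
        ← Complex.ofReal_pow, Real.sq_sqrt (hD.pos i).le])
    (by
      rw [mul_assoc, ← hD.coord_opPow_half, hg, inner_smul_right, inner_add_right, hw]
      ring)
  have hsol : ∀ t ∈ Ioc (0 : ℝ) 1, sol A (toNeg (opPow A (1 / 4)) 0) g h t = u 0 t := by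
    intro t ht
    refine coord_ext b fun i => ?_
    rw [hD.coord_sol 0 g h ht, inner_zero_right, mul_zero]
    exact (key i).1 t (Ioc_subset_Icc_self ht)
  refine ⟨0, g, h, ⟨⟨?_, ?_⟩, ?_, ?_, ?_⟩, fun i => ⟨?_, ?_⟩⟩
  · filter_upwards [a1, ae_mem_Ioo] with t e ht
    rw [e, hsol t (Ioo_subset_Ioc_self ht)]
  · rw [a2, hsol 1 one_mem_Ioc]
  · rw [hh, sub_add_cancel]
  · rw [a4, hsol 1 one_mem_Ioc]
  · rw [a5]
    congr 1
    refine coord_ext b fun i => ?_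
    rw [(hD.hasDerivWithinAt_sol 0 g h one_mem_Ioc).2, inner_zero_right, mul_zero]
    exact (key i).2.1.symm
  · rw [solCoord, inner_zero_right, mul_zero, (key i).1 0 m0, z0, inner_zero_right]
  · rw [solCoordDeriv, inner_zero_right, mul_zero]
    exact (key i).2.2

/-- The pair of the graph of `L'_0` with `y = φ · b i` and `y₁ = v`. -/
theorem exists_mem_minGraph {φ : ℝ → ℝ} (hφ : ContDiff ℝ ∞ φ) {δ : ℝ} (hδ : 0 < δ)
    (h0 : ∀ t < δ, φ t = 0) (i : ι) (v : H) :
    ∃ P ∈ minGraph A q, P.1.fst =ᵐ[mu01] (fun t => (φ t : ℂ) • b i) ∧ P.1.snd.fst = v ∧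
      P.1.snd.snd = (φ 1 : ℂ) • b i ∧
      (∃ k : L2H H, (k =ᵐ[mu01] fun t => ((-iteratedDeriv 2 φ t + lam i * φ t : ℝ) : ℂ) • b i) ∧
        P.2.fst = k + Q P.1.fst) ∧
      P.2.snd.fst = -((φ 1 : ℂ) • b i) ∧ P.2.snd.snd = ((deriv φ 1 : ℝ) : ℂ) • b i - v := by
  have m1 : (1 : ℝ) ∈ Icc (0 : ℝ) 1 := by simp
  have hI := uniqueDiffOn_Icc (zero_lt_one (α := ℝ))
  have cL2 : ∀ {ψ : ℝ → ℝ}, Continuous ψ → MemLp (fun t => (ψ t : ℂ) • b i) 2 mu01 := by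
    intro ψ hψ
    have hc : Continuous fun t => (ψ t : ℂ) • b i := by fun_prop
    obtain ⟨C, hC⟩ := isCompact_Icc.exists_bound_of_continuousOn (s := Icc (0 : ℝ) 1) hc.continuousOn
    refine MemLp.of_bound hc.aestronglyMeasurable C ?_
    filter_upwards [ae_mem_Ioo] with t ht using hC t (Ioo_subset_Icc_self ht)
  have cφ2 : Continuous (iteratedDeriv 2 φ) := hφ.continuous_iteratedDeriv 2
    (mod_cast le_top : ((2 : ℕ∞) : WithTop ℕ∞) ≤ ∞)
  have ck : Continuous fun t => -iteratedDeriv 2 φ t + lam i * φ t := by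
    have := hφ.continuous
    fun_prop
  set y : L2H H := (cL2 hφ.continuous).toLp _
  set k : L2H H := (cL2 ck).toLp _
  have hy : y =ᵐ[mu01] fun t => (φ t : ℂ) • b i := (cL2 hφ.continuous).coeFn_toLp
  have hk : k =ᵐ[mu01] fun t => ((-iteratedDeriv 2 φ t + lam i * φ t : ℝ) : ℂ) • b i :=
    (cL2 ck).coeFn_toLp
  let u : ℕ → ℝ → H := fun j t => ((lam i ^ j * φ t : ℝ) : ℂ) • b i
  have hu0 : u 0 = fun t => (φ t : ℂ) • b i := by funext t; simp [u]
  have hsm : ∀ {f f' : ℝ → ℝ} {t : ℝ}, HasDerivAt f (f' t) t →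
      HasDerivAt (fun t => (f t : ℂ) • b i) ((f' t : ℂ) • b i) t := fun hf =>
    hf.ofReal_comp.smul_const (b i)
  have d1 : ∀ t, HasDerivAt (u 0) (((deriv φ t : ℝ) : ℂ) • b i) t := by
    intro t
    rw [hu0]
    exact hsm (hφ.differentiable (by simp) t).hasDerivAt
  have d2 : ∀ t, HasDerivAt (fun t => ((deriv φ t : ℝ) : ℂ) • b i)
      (((iteratedDeriv 2 φ t : ℝ) : ℂ) • b i) t := by
    intro t
    rw [iteratedDeriv_succ, iteratedDeriv_one]
    exact hsm ((contDiff_infty_iff_deriv.1 hφ).2.differentiable (by simp) t).hasDerivAt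
  have e1 : ∀ t ∈ Icc (0 : ℝ) 1, derivWithin (u 0) (Icc 0 1) t = ((deriv φ t : ℝ) : ℂ) • b i :=
    fun t ht => (d1 t).hasDerivWithinAt.derivWithin (hI t ht)
  have e2 : ∀ t ∈ Icc (0 : ℝ) 1,
      iteratedDerivWithin 2 (u 0) (Icc 0 1) t = ((iteratedDeriv 2 φ t : ℝ) : ℂ) • b i := by
    intro t ht
    rw [iteratedDerivWithin_succ, iteratedDerivWithin_one, derivWithin_congr e1 (e1 t ht)]
    exact (d2 t).hasDerivWithinAt.derivWithin (hI t ht)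
  refine ⟨(WithLp.toLp 2 (y, WithLp.toLp 2 (v, (φ 1 : ℂ) • b i)),
    WithLp.toLp 2 (k + Q y, WithLp.toLp 2 (-((φ 1 : ℂ) • b i), ((deriv φ 1 : ℝ) : ℂ) • b i - v))),
    ⟨u, ⟨fun j => ?_, fun j t _ => ?_, δ, hδ, fun t _ ht => ?_⟩, ?_, ?_, ?_, ?_, ?_⟩, hy, rfl, rfl,
    ⟨k, hk, rfl⟩, rfl, rfl⟩
  · have : ContDiff ℝ ∞ fun t => (lam i ^ j * φ t : ℝ) := contDiff_const.mul hφ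
    exact ((Complex.ofRealCLM.contDiff.comp this).smul contDiff_const).contDiffOn
  · rw [hD.mem_graph]
    intro l
    classical
    simp only [u, inner_smul_right, inner_basis b]
    split_ifs with hl
    · rw [hl]; push_cast; ring
    · simp
  · simp [u, h0 t ht]
  · rw [hu0]; exact hy
  · rw [hu0]; rfl
  · refine (Lp.coeFn_add k (Q y)).trans ?_
    filter_upwards [hk, hQq y, hy, ae_mem_Ioo] with t f1 f2 f3 ht
    rw [Pi.add_apply, f1, f2, f3, e2 t (Ioo_subset_Icc_self ht), hu0]
    congr 1
    simp only [u, pow_one]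
    rw [← neg_smul, ← add_smul]
    push_cast
    rfl
  · rw [hu0]; rfl
  · rw [e1 1 m1]; rfl

end IsDiag

/-! ### The adjoint of the minimal operator -/

/-- Green's formula with φ itself written as a scalar solution with a = 0. Only boundary terms at 1
survive, since φ vanishes near 0. -/
theorem integral_test {ρ δ : ℝ} (hρ : 0 < ρ) {φ : ℝ → ℝ} (hφ : ContDiff ℝ ∞ φ) (hδ : 0 < δ)
    (h0 : ∀ t < δ, φ t = 0) (a c : ℂ) {h : ℝ → ℂ} (hh : Integrable h mu01) :
    ∫ t, ((-iteratedDeriv 2 φ t + ρ ^ 2 * φ t : ℝ) : ℂ) * scal ρ a c h t ∂mu01 =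
      ∫ t, (φ t : ℂ) * h t ∂mu01 + φ 1 * scalDeriv ρ a c h 1 -
        ((deriv φ 1 : ℝ) : ℂ) * scal ρ a c h 1 := by
  have hρ0 : (ρ : ℂ) ≠ 0 := Complex.ofReal_ne_zero.2 hρ.ne'
  have c2 : Continuous (iteratedDeriv 2 φ) := hφ.continuous_iteratedDeriv 2
    (mod_cast le_top : ((2 : ℕ∞) : WithTop ℕ∞) ≤ ∞)
  have d1 : ∀ t, HasDerivAt φ (deriv φ t) t := fun t =>
    (hφ.differentiable (by simp) t).hasDerivAt
  have d2 : ∀ t, HasDerivAt (deriv φ) (iteratedDeriv 2 φ t) t := by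
    intro t
    rw [iteratedDeriv_succ, iteratedDeriv_one]
    exact ((contDiff_infty_iff_deriv.1 hφ).2.differentiable (by simp) t).hasDerivAt
  have z0 : deriv φ 0 = 0 := by
    have e : φ =ᶠ[𝓝 0] fun _ => 0 := by
      filter_upwards [Iio_mem_nhds hδ] with t ht using h0 t ht
    rw [e.deriv_eq, deriv_const]
  set ψ : ℝ → ℂ := fun t => ((-iteratedDeriv 2 φ t + ρ ^ 2 * φ t : ℝ) : ℂ) with hψ
  have cψ : Continuous ψ := by
    have := hφ.continuous
    fun_prop
  have iψ : Integrable ψ mu01 :=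
    (cψ.integrableOn_Icc (a := 0) (b := 1)).mono_set Ioo_subset_Icc_self
  set cφ : ℂ := (2 * ρ : ℂ)⁻¹ * (((deriv φ 1 : ℝ) : ℂ) + ρ * φ 1) with hcφ
  obtain ⟨s1, s2, s3⟩ := scal_of_smooth hρ (y := fun t => (φ t : ℂ))
    (y' := fun t => ((deriv φ t : ℝ) : ℂ)) (y'' := fun t => ((iteratedDeriv 2 φ t : ℝ) : ℂ))
    (h := ψ) (c := cφ) (fun t _ => (d1 t).ofReal_comp.hasDerivWithinAt)
    (fun t _ => (d2 t).ofReal_comp.hasDerivWithinAt)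
    (Complex.continuous_ofReal.comp c2).continuousOn (by rw [h0 0 hδ]; simp) (by rw [z0]; simp)
    (ae_of_all _ fun t => by simp [hψ]) (by rw [hcφ]; field_simp)
  have g := scal_green hρ 0 cφ a c iψ hh
  rw [s1 0 (by simp), s1 1 (by simp), s2, s3, h0 0 hδ] at g
  have e1 : ∫ t, conj (ψ t) * scal ρ a c h t ∂mu01 = ∫ t, ψ t * scal ρ a c h t ∂mu01 := by
    simp only [hψ, Complex.conj_ofReal]
  have e2 : ∫ t, conj (scal ρ 0 cφ ψ t) * h t ∂mu01 = ∫ t, (φ t : ℂ) * h t ∂mu01 := by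
    refine integral_congr_ae ?_
    filter_upwards [ae_mem_Ioo] with t ht
    rw [s1 t (Ioo_subset_Icc_self ht), Complex.conj_ofReal]
  rw [e1, e2] at g
  simp only [Complex.conj_ofReal, map_zero, Complex.ofReal_zero] at g
  linear_combination g

theorem inner_of_ae_eq_smul {k : L2H H} {ψ : ℝ → ℝ} {v : H}
    (hk : k =ᵐ[mu01] fun t => (ψ t : ℂ) • v) (z : L2H H) :
    ⟪k, z⟫_ℂ = ∫ t, (ψ t : ℂ) * ⟪v, z t⟫_ℂ ∂mu01 := by
  rw [L2.inner_def]
  refine integral_congr_ae ?_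
  filter_upwards [hk] with t ht
  rw [ht, inner_smul_left, Complex.conj_ofReal]

theorem ae_eq_zero_of_forall_test {E : Type*} [NormedAddCommGroup E] [NormedSpace ℝ E]
    [CompleteSpace E] {f : ℝ → E} (hf : Integrable f mu01)
    (h : ∀ ψ : ℝ → ℝ, ContDiff ℝ ∞ ψ → tsupport ψ ⊆ Ioo 0 1 → ∫ t, ψ t • f t ∂mu01 = 0) :
    f =ᵐ[mu01] 0 := by
  have h1 : IntegrableOn f (Ioo 0 1) volume := hf
  refine (ae_restrict_iff' measurableSet_Ioo).2
    (isOpen_Ioo.ae_eq_zero_of_integral_contDiff_smul_eq_zero h1.locallyIntegrableOn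
      fun ψ hψ _ hs => ?_)
  rw [← h ψ hψ hs]
  refine (setIntegral_eq_integral_of_forall_compl_eq_zero fun t ht => ?_).symm
  rw [image_eq_zero_of_notMem_tsupport (fun h' => ht (hs h')), zero_smul]

theorem norm_inv_mul_expConv_le {ρ : ℝ} (hρ : 1 ≤ ρ) {h : ℝ → ℂ} (hh : Integrable h mu01) (t : ℝ) :
    ‖(2 * ρ : ℂ)⁻¹ * expConv ρ h t‖ ≤ ∫ s, ‖h s‖ ∂mu01 := by
  have h0 : 0 ≤ ∫ s, ‖h s‖ ∂mu01 := integral_nonneg fun _ => norm_nonneg _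
  have h2 := norm_expConv_le (zero_le_one.trans hρ) hh t
  rw [norm_mul, norm_inv, norm_mul, Complex.norm_real, Real.norm_of_nonneg (zero_le_one.trans hρ),
    RCLike.norm_ofNat, inv_mul_le_iff₀ (by positivity)]
  nlinarith

theorem norm_inv_mul_expConvDeriv_le {ρ : ℝ} (hρ : 1 ≤ ρ) {h : ℝ → ℂ} (hh : Integrable h mu01)
    (t : ℝ) : ‖(2 * ρ : ℂ)⁻¹ * expConvDeriv ρ h t‖ ≤ ∫ s, ‖h s‖ ∂mu01 := by
  have h0 : 0 ≤ ∫ s, ‖h s‖ ∂mu01 := integral_nonneg fun _ => norm_nonneg _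
  have h2 := norm_expConvDeriv_le (zero_le_one.trans hρ) hh t
  rw [norm_mul, norm_inv, norm_mul, Complex.norm_real, Real.norm_of_nonneg (zero_le_one.trans hρ),
    RCLike.norm_ofNat, inv_mul_le_iff₀ (by positivity)]
  nlinarith

theorem norm_sub_sq_le (u v : ℂ) : ‖u - v‖ ^ 2 ≤ 2 * ‖u‖ ^ 2 + 2 * ‖v‖ ^ 2 := by
  have h := pow_le_pow_left₀ (norm_nonneg _) (norm_sub_le u v) 2
  nlinarith [sq_nonneg (‖u‖ - ‖v‖)]

namespace IsDiag

variable {ι : Type*} {A : H →ₗ.[ℂ] H} {b : HilbertBasis ι ℂ H} {lam : ι → ℝ} (hD : IsDiag A b lam)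
variable [Countable ι] {Q : L2H H → L2H H} {q : ℝ → H →L[ℂ] H}
  (hQq : ∀ z, Q z =ᵐ[mu01] fun t => q t (z t)) (hQ : ∀ z w, ⟪Q z, w⟫_ℂ = ⟪z, Q w⟫_ℂ)

include hD

/-- Functions whose coordinates solve the scalar equations are given by `sol`. -/
theorem exists_sol_of_coord {z h : L2H H} {z1 d1 : H} {a c : ι → ℂ}
    (h1 : ∀ i, scal (√(lam i)) (a i) (c i) (fun s => ⟪b i, h s⟫_ℂ) 1 = ⟪b i, z1⟫_ℂ)
    (h2 : ∀ i, scalDeriv (√(lam i)) (a i) (c i) (fun s => ⟪b i, h s⟫_ℂ) 1 = ⟪b i, d1⟫_ℂ)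
    (hz : ∀ i, (fun t => ⟪b i, z t⟫_ℂ) =ᵐ[mu01]
      scal (√(lam i)) (a i) (c i) (fun s => ⟪b i, h s⟫_ℂ)) :
    ∃ x g, z =ᵐ[mu01] sol A (toNeg (opPow A (1 / 4)) x) g h ∧
      z1 = sol A (toNeg (opPow A (1 / 4)) x) g h 1 ∧
      d1 = solDeriv A (toNeg (opPow A (1 / 4)) x) g h 1 := by
  have hh := Lp.memLp h
  set N : ι → ℝ := fun i => ∫ s, ‖⟪b i, h s⟫_ℂ‖ ∂mu01 with hN
  have sN : Summable fun i => N i ^ 2 := summable_sq_integral_coord b hh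
  have hE : ∀ i t, ‖(2 * √(lam i) : ℂ)⁻¹ * expConv (√(lam i)) (fun s => ⟪b i, h s⟫_ℂ) t‖ ^ 2 ≤
      N i ^ 2 := fun i t => pow_le_pow_left₀ (norm_nonneg _)
    (norm_inv_mul_expConv_le (hD.one_le_sqrt i) (integrable_coord hh (b i)) t) 2
  -- Summability of |a_i|²/√λ_i, which is f ∈ H_{-1/4}, comes from z - (convolution) in L_2 and from
  -- z(1) in H.
  have sa : Summable fun i => ‖a i‖ ^ 2 / √(lam i) := by
    have S := (((summable_integral_sq_coord b (Lp.memLp z)).mul_left 2).add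
      (sN.mul_left 2)).mul_left 400 |>.add
      ((((summable_sq_coord b z1).mul_left 2).add (sN.mul_left 2)).mul_left 200)
    refine S.of_nonneg_of_le (fun i => div_nonneg (sq_nonneg _) (hD.sqrt_pos i).le) fun i => ?_
    set p : ℝ → ℂ := fun t => ⟪b i, z t⟫_ℂ -
      (2 * √(lam i) : ℂ)⁻¹ * expConv (√(lam i)) (fun s => ⟪b i, h s⟫_ℂ) t with hp
    have hpm : AEStronglyMeasurable p mu01 := (integrable_coord (Lp.memLp z) (b i)).1.sub
      (((continuous_expConv (hD.sqrt_pos i).le (integrable_coord hh (b i))).const_mul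
        _).aestronglyMeasurable)
    have hpb : ∀ t, ‖p t‖ ^ 2 ≤ 2 * ‖⟪b i, z t⟫_ℂ‖ ^ 2 + 2 * N i ^ 2 := by
      intro t
      refine (norm_sub_sq_le _ _).trans ?_
      have := hE i t
      linarith
    have hJ : Integrable (fun t => 2 * ‖⟪b i, z t⟫_ℂ‖ ^ 2 + 2 * N i ^ 2) mu01 :=
      ((integrable_sq_coord (Lp.memLp z) (b i)).const_mul 2).add (integrable_const _)
    have hpi : Integrable (fun t => ‖p t‖ ^ 2) mu01 := by
      refine hJ.mono' (hpm.norm.pow 2) (ae_of_all _ fun t => ?_)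
      rw [Real.norm_of_nonneg (sq_nonneg _)]
      exact hpb t
    have hpe : p =ᵐ[mu01] fun t => Real.exp (-(t * √(lam i))) * a i +
        Real.exp (-((1 - t) * √(lam i))) * c i := by
      filter_upwards [hz i] with t ht
      rw [hp]
      simp only
      rw [ht, scal]
      ring
    refine (coef_bound (hD.one_le_sqrt i) (a i) (c i) hpe hpi).trans ?_
    refine add_le_add (mul_le_mul_of_nonneg_left ?_ (by norm_num))
      (mul_le_mul_of_nonneg_left ?_ (by norm_num))
    · refine (integral_mono hpi hJ hpb).trans (le_of_eq ?_)
      rw [integral_add ((integrable_sq_coord (Lp.memLp z) (b i)).const_mul 2) (integrable_const _),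
        integral_const_mul]
      simp
    · have e : Real.exp (-√(lam i)) * a i + c i = ⟪b i, z1⟫_ℂ -
          (2 * √(lam i) : ℂ)⁻¹ * expConv (√(lam i)) (fun s => ⟪b i, h s⟫_ℂ) 1 := by
        rw [← h1 i, scal_one]; ring
      rw [e]
      refine (norm_sub_sq_le _ _).trans ?_
      have := hE i 1
      linarith
  -- Summability of λ_i|c_i|², which is g ∈ H_{1/2}, comes from z'(1) in H together with the bound
  -- for a_i.
  have sc : Summable fun i => ‖√(lam i) * c i‖ ^ 2 := by
    have S := ((((summable_sq_coord b d1).mul_left 2).add (sN.mul_left 2)).mul_left 2).add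
      (sa.mul_left 8)
    refine S.of_nonneg_of_le (fun i => sq_nonneg _) fun i => ?_
    refine (coef_bound_right (hD.one_le_sqrt i) (a i) (c i)).trans ?_
    refine add_le_add (mul_le_mul_of_nonneg_left ?_ (by norm_num)) le_rfl
    have e : -(√(lam i) * (Real.exp (-√(lam i)) * a i)) + √(lam i) * c i = ⟪b i, d1⟫_ℂ -
        (2 * √(lam i) : ℂ)⁻¹ * expConvDeriv (√(lam i)) (fun s => ⟪b i, h s⟫_ℂ) 1 := by
      rw [← h2 i, scalDeriv_one, expConvDeriv_one]; ring
    rw [e]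
    refine (norm_sub_sq_le _ _).trans ?_
    have := pow_le_pow_left₀ (norm_nonneg _)
      (norm_inv_mul_expConvDeriv_le (hD.one_le_sqrt i) (integrable_coord hh (b i)) 1) 2
    linarith
  obtain ⟨x, hx⟩ := exists_coord b (a := fun i => ((lam i ^ (1 / 4 : ℝ) : ℝ) : ℂ)⁻¹ * a i) (by
    refine sa.congr fun i => ?_
    rw [norm_mul, norm_inv, Complex.norm_real, Real.norm_of_nonneg (hD.rpow_quarter_pos i).le,
      mul_pow, inv_pow, hD.rpow_quarter_sq]
    ring)
  obtain ⟨y, hy⟩ := exists_coord b sc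
  obtain ⟨g, hg⟩ := hD.exists_opPow_eq (s := 1 / 2) (by norm_num) y
  have hgc : ∀ i, ⟪b i, (g : H)⟫_ℂ = c i := by
    intro i
    have := hD.coord_opPow_half g i
    rw [hg, hy] at this
    exact (mul_left_cancel₀ (Complex.ofReal_ne_zero.2 (hD.sqrt_pos i).ne') this).symm
  have hxc : ∀ i, ((lam i ^ (1 / 4 : ℝ) : ℝ) : ℂ) * ⟪b i, x⟫_ℂ = a i := by
    intro i
    rw [hx, mul_inv_cancel_left₀ (Complex.ofReal_ne_zero.2 (hD.rpow_quarter_pos i).ne')]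
  refine ⟨x, g, ae_eq_of_coord b fun i => ?_, coord_ext b fun i => ?_, coord_ext b fun i => ?_⟩
  · filter_upwards [hz i, ae_mem_Ioo] with t ht htI
    rw [ht, hD.coord_sol x g h (Ioo_subset_Ioc_self htI), hxc, hgc]
  · rw [hD.coord_sol x g h one_mem_Ioc, hxc, hgc, h1]
  · rw [(hD.hasDerivWithinAt_sol x g h one_mem_Ioc).2, hxc, hgc, h2]

include hQq hQ

/-- Taking φ = 0 and v arbitrary identifies the second component of the image. Then a_i and c_i are
fixed by matching the expected Cauchy data at 1, and solving -φ'' + λ_i φ = ψ for arbitrary test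
functions ψ shows that the coordinate equals the scalar solution almost everywhere. -/
theorem exists_isMaxPair_of_orthogonal {P' : BigL2 H × BigL2 H}
    (hP' : ∀ P ∈ minGraph A q, ⟪P.2, P'.1⟫_ℂ = ⟪P.1, P'.2⟫_ℂ) :
    ∃ x g h, IsMaxPair A Q x g h P' := by
  set h : L2H H := P'.2.fst - Q P'.1.fst with hh
  have e1 : P'.2.fst = h + Q P'.1.fst := by rw [hh, sub_add_cancel]
  have test : ∀ (φ : ℝ → ℝ) (δ : ℝ), ContDiff ℝ ∞ φ → 0 < δ → (∀ t < δ, φ t = 0) →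
      ∀ (i : ι) (v : H), ∫ t, ((-iteratedDeriv 2 φ t + lam i * φ t : ℝ) : ℂ) *
          ⟪b i, P'.1.fst t⟫_ℂ ∂mu01 - φ 1 * ⟪b i, P'.1.snd.fst⟫_ℂ +
          ((deriv φ 1 : ℝ) : ℂ) * ⟪b i, P'.1.snd.snd⟫_ℂ - ⟪v, P'.1.snd.snd⟫_ℂ =
        ∫ t, (φ t : ℂ) * ⟪b i, h t⟫_ℂ ∂mu01 + ⟪v, P'.2.snd.fst⟫_ℂ +
          φ 1 * ⟪b i, P'.2.snd.snd⟫_ℂ := by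
    intro φ δ hφ hδ h0 i v
    obtain ⟨P, hP, p1, p2, p3, ⟨k, hk, p4⟩, p5, p6⟩ := hD.exists_mem_minGraph hQq hφ hδ h0 i v
    have := hP' P hP
    rw [inner_bigL2, inner_bigL2, p2, p3, p4, p5, p6, e1, inner_add_left, inner_add_right, hQ,
      inner_neg_left, inner_sub_left, inner_smul_left, inner_smul_left, inner_smul_left,
      Complex.conj_ofReal, Complex.conj_ofReal, inner_of_ae_eq_smul hk,
      inner_of_ae_eq_smul p1 h] at this
    linear_combination this
  have e2 : P'.2.snd.fst = -P'.1.snd.snd := by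
    refine coord_ext b fun i => ?_
    have := test (fun _ => 0) 1 contDiff_const one_pos (fun _ _ => rfl) i (b i)
    simp only [iteratedDeriv_const, deriv_const] at this
    rw [inner_neg_right]
    simpa using this.symm
  choose a c hac hac' using fun i => exists_cauchy_data (hD.sqrt_pos i) ⟪b i, P'.1.snd.snd⟫_ℂ
    ⟪b i, P'.2.snd.snd + P'.1.snd.fst⟫_ℂ (fun s => ⟪b i, h s⟫_ℂ)
  obtain ⟨x, g, f1, f2, f3⟩ := hD.exists_sol_of_coord (z := P'.1.fst) hac hac' fun i => by
    have hI := integrable_coord (Lp.memLp P'.1.fst) (b i)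
    have hhI := integrable_coord (Lp.memLp h) (b i)
    have cS := continuous_scal (hD.sqrt_pos i).le (a i) (c i) hhI
    have hS : Integrable (scal (√(lam i)) (a i) (c i) fun s => ⟪b i, h s⟫_ℂ) mu01 :=
      (cS.integrableOn_Icc (a := 0) (b := 1)).mono_set Ioo_subset_Icc_self
    have key := ae_eq_zero_of_forall_test (hI.sub hS) fun ψ hψ hs => by
      obtain ⟨δ, hδ, hψ0⟩ := exists_forall_lt_eq_zero hs
      -- The boundary terms at 1 are the same for z and for the scalar solution, so subtracting the
      -- two weak identities leaves the difference paired with ψ.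
      obtain ⟨φ, hφ, hφψ, hφ0⟩ := exists_contDiff_solution (hD.sqrt_pos i) hψ hδ hψ0
      have t1 := test φ δ hφ hδ hφ0 i 0
      have t2 := integral_test (hD.sqrt_pos i) hφ hδ hφ0 (a i) (c i) hhI
      rw [Real.sq_sqrt (hD.pos i).le] at hφψ t2
      simp only [hφψ] at t1 t2
      rw [hac, hac', inner_add_right] at t2
      rw [inner_zero_left, inner_zero_left] at t1
      simp only [Pi.sub_apply, Complex.real_smul, mul_sub]
      obtain ⟨C, hC⟩ := isCompact_Icc.exists_bound_of_continuousOn (s := Icc (0 : ℝ) 1)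
        (Complex.continuous_ofReal.comp hψ.continuous).continuousOn
      have hCb : ∀ᵐ t ∂mu01, ‖(ψ t : ℂ)‖ ≤ C := by
        filter_upwards [ae_mem_Ioo] with t ht using hC t (Ioo_subset_Icc_self ht)
      have mψ : AEStronglyMeasurable (fun t => (ψ t : ℂ)) mu01 :=
        (Complex.continuous_ofReal.comp hψ.continuous).aestronglyMeasurable
      rw [integral_sub (hI.bdd_mul mψ hCb) (hS.bdd_mul mψ hCb)]
      linear_combination t1 - t2
    filter_upwards [key] with t ht
    exact sub_eq_zero.1 ht
  exact ⟨x, g, h, ⟨f1, f2⟩, e1, by rw [e2, f2], by rw [← f3, add_sub_cancel_right]⟩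

end IsDiag

/-! ### The minimal and the maximal operator -/

/-- A subspace of a product of Hilbert spaces is dense in its second annihilator for the form
`⟪P.2, P'.1⟫ - ⟪P.1, P'.2⟫`. -/
theorem mem_topologicalClosure_of_annihilator {E : Type*} [NormedAddCommGroup E]
    [InnerProductSpace ℂ E] [CompleteSpace E] (G : Submodule ℂ (E × E)) {P : E × E}
    (hP : ∀ P' : E × E, (∀ R ∈ G, ⟪R.2, P'.1⟫_ℂ = ⟪R.1, P'.2⟫_ℂ) → ⟪P.2, P'.1⟫_ℂ = ⟪P.1, P'.2⟫_ℂ) :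
    P ∈ G.topologicalClosure := by
  set K : Submodule ℂ (WithLp 2 (E × E)) := G.map (WithLp.linearEquiv 2 ℂ (E × E)).symm.toLinearMap
  have h1 : WithLp.toLp 2 P ∈ Kᗮᗮ := by
    rw [Submodule.mem_orthogonal]
    intro r hr
    -- The rotation (u, v) ↦ (v, -u) turns orthogonality in E ⊕ E into annihilation for the form, so
    -- the double annihilator becomes the double orthogonal complement, that is, the closure.
    have h2 := hP (r.snd, -r.fst) fun R hR => by
      have := (Submodule.mem_orthogonal _ _).1 hr (WithLp.toLp 2 R) ⟨R, hR, rfl⟩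
      rw [WithLp.prod_inner_apply] at this
      rw [inner_neg_right, eq_neg_iff_add_eq_zero, add_comm]
      exact this
    rw [WithLp.prod_inner_apply]
    rw [inner_neg_right, eq_neg_iff_add_eq_zero] at h2
    have h3 := congrArg conj h2
    rw [map_add, inner_conj_symm, inner_conj_symm, map_zero, add_comm] at h3
    exact h3
  rw [Submodule.orthogonal_orthogonal_eq_closure] at h1
  have h4 : (WithLp.ofLp : WithLp 2 (E × E) → E × E) (WithLp.toLp 2 P) ∈ closure (G : Set (E × E)) :=
    map_mem_closure (WithLp.prod_continuous_ofLp 2 E E) h1 (by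
      rintro _ ⟨R, hR, rfl⟩
      exact hR)
  exact h4

theorem isClosed_annihilator {E : Type*} [NormedAddCommGroup E] [InnerProductSpace ℂ E]
    (S : Set (E × E)) : IsClosed {P : E × E | ∀ P' ∈ S, ⟪P.2, P'.1⟫_ℂ = ⟪P.1, P'.2⟫_ℂ} := by
  simp only [ofPred_forall]
  refine isClosed_biInter fun P' _ => isClosed_eq ?_ ?_ <;> fun_prop

theorem inner_comm_of_annihilator {E : Type*} [NormedAddCommGroup E] [InnerProductSpace ℂ E]
    {P P' : E × E} (h : ⟪P.2, P'.1⟫_ℂ = ⟪P.1, P'.2⟫_ℂ) : ⟪P'.2, P.1⟫_ℂ = ⟪P'.1, P.2⟫_ℂ := by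
  have := congrArg conj h
  rw [inner_conj_symm, inner_conj_symm] at this
  exact this.symm

theorem preMinOp_graph (A : H →ₗ.[ℂ] H) (q : ℝ → H →L[ℂ] H) :
    (preMinOp A q).graph = minGraph A q :=
  Submodule.toLinearPMap_graph_eq _ (minGraph_functional A q)

namespace IsDiag

variable {ι : Type*} {A : H →ₗ.[ℂ] H} {b : HilbertBasis ι ℂ H} {lam : ι → ℝ} (hD : IsDiag A b lam)
variable [Countable ι] {Q : L2H H → L2H H} {q : ℝ → H →L[ℂ] H}
  (hQq : ∀ z, Q z =ᵐ[mu01] fun t => q t (z t)) (hQ : ∀ z w, ⟪Q z, w⟫_ℂ = ⟪z, Q w⟫_ℂ)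

include hD hQq

/-- An orthogonal triple is killed one component at a time: by φ supported inside (0,1), then by the
free component y₁, and finally by a smooth step with φ(1) = 1. -/
theorem dense_preMinOp_domain : Dense ((preMinOp A q).domain : Set (BigL2 H)) := by
  rw [Submodule.dense_iff_topologicalClosure_eq_top, Submodule.topologicalClosure_eq_top_iff,
    Submodule.eq_bot_iff]
  intro Z hZ
  have hZ' : ∀ P ∈ minGraph A q, ⟪P.1, Z⟫_ℂ = 0 := by
    intro P hP
    refine (Submodule.mem_orthogonal _ _).1 hZ P.1 ?_
    rw [LinearPMap.mem_domain_iff]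
    exact ⟨P.2, by rw [preMinOp_graph]; exact hP⟩
  have test : ∀ (φ : ℝ → ℝ) (δ : ℝ), ContDiff ℝ ∞ φ → 0 < δ → (∀ t < δ, φ t = 0) →
      ∀ (i : ι) (v : H), ∫ t, (φ t : ℂ) * ⟪b i, Z.fst t⟫_ℂ ∂mu01 + (⟪v, Z.snd.fst⟫_ℂ +
        φ 1 * ⟪b i, Z.snd.snd⟫_ℂ) = 0 := by
    intro φ δ hφ hδ h0 i v
    obtain ⟨P, hP, p1, p2, p3, -⟩ := hD.exists_mem_minGraph hQq hφ hδ h0 i v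
    have := hZ' P hP
    rwa [inner_bigL2, inner_of_ae_eq_smul p1, p2, p3, inner_smul_left, Complex.conj_ofReal] at this
  have z1 : Z.fst = 0 := by
    refine Lp.ext (EventuallyEq.trans ?_ (Lp.coeFn_zero H 2 mu01).symm)
    refine ae_eq_of_coord b fun i => ?_
    have := ae_eq_zero_of_forall_test (integrable_coord (Lp.memLp Z.fst) (b i)) fun ψ hψ hs => by
      obtain ⟨δ, hδ, h0⟩ := exists_forall_lt_eq_zero hs
      have h := test ψ δ hψ hδ h0 i 0
      rw [image_eq_zero_of_notMem_tsupport (fun h' => (hs h').2.ne rfl)] at h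
      simpa [Complex.real_smul] using h
    filter_upwards [this] with t ht
    rw [ht]
    simp
  have z2 : Z.snd.fst = 0 := by
    refine coord_ext b fun i => ?_
    have h := test (fun _ => 0) 1 contDiff_const one_pos (fun _ _ => rfl) i (b i)
    simpa using h
  have z3 : Z.snd.snd = 0 := by
    refine coord_ext b fun i => ?_
    have hc : ContDiff ℝ ∞ fun t : ℝ => Real.smoothTransition (2 * t - 1) :=
      Real.smoothTransition.contDiff.comp (by fun_prop)
    have h := test (fun t => Real.smoothTransition (2 * t - 1)) (1 / 2) hc (by norm_num)
      (fun t ht => Real.smoothTransition.zero_of_nonpos (by linarith)) i 0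
    have e1 : Real.smoothTransition (2 * 1 - 1) = 1 :=
      Real.smoothTransition.one_of_one_le (by norm_num)
    have e2 : ∫ t, (Real.smoothTransition (2 * t - 1) : ℂ) * ⟪b i, Z.fst t⟫_ℂ ∂mu01 = 0 := by
      rw [z1]
      refine integral_eq_zero_of_ae ?_
      filter_upwards [Lp.coeFn_zero H 2 mu01] with t ht
      rw [ht]
      simp
    rw [e1, e2] at h
    simpa using h
  exact WithLp.ofLp_injective 2 (Prod.ext z1 (WithLp.ofLp_injective 2 (Prod.ext z2 z3)))

include hQ

theorem isMaxPair_annihilates {P P' : BigL2 H × BigL2 H} {x x' : H}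
    {g g' : (opPow A (1 / 2)).domain} {h h' : L2H H} (hP : IsMaxPair A Q x g h P)
    (h0 : ∀ i, solCoord b lam x g h i 0 = 0 ∧ solCoordDeriv b lam x g h i 0 = 0)
    (hP' : IsMaxPair A Q x' g' h' P') : ⟪P.2, P'.1⟫_ℂ = ⟪P.1, P'.2⟫_ℂ := by
  have s := hD.hasSum_green hQ hP hP'
  simp only [(h0 _).1, (h0 _).2, map_zero, zero_mul, sub_zero] at s
  exact sub_eq_zero.1 (s.unique hasSum_zero)

/-- L_0' is symmetric by Green's formula, hence contained in its adjoint, which is closed. -/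
theorem isClosable_preMinOp : (preMinOp A q).IsClosable := by
  have hd := hD.dense_preMinOp_domain hQq
  refine (LinearPMap.adjoint_isClosed hd).isClosable.leIsClosable (LinearPMap.le_of_le_graph ?_)
  rw [LinearPMap.adjoint_graph_eq_graph_adjoint hd, preMinOp_graph]
  intro P hP
  rw [Submodule.mem_adjoint_iff]
  intro y w hyw
  obtain ⟨x, g, h, h1, h2⟩ := hD.exists_isMaxPair_of_mem_minGraph hQq hyw
  obtain ⟨x', g', h', h1', -⟩ := hD.exists_isMaxPair_of_mem_minGraph hQq hP
  exact sub_eq_zero.2 (hD.isMaxPair_annihilates hQq hQ h1 h2 h1')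

theorem minOp_graph : (minOp A q).graph = (minGraph A q).topologicalClosure := by
  have := (hD.isClosable_preMinOp hQq hQ).graph_closure_eq_closure_graph
  rw [preMinOp_graph] at this
  exact this.symm

theorem mem_maxOp_graph {P : BigL2 H × BigL2 H} :
    P ∈ (maxOp A q).graph ↔ ∃ x g h, IsMaxPair A Q x g h P := by
  have hd : Dense ((minOp A q).domain : Set (BigL2 H)) :=
    (hD.dense_preMinOp_domain hQq).mono (LinearPMap.le_closure _).1
  unfold maxOp
  rw [LinearPMap.adjoint_graph_eq_graph_adjoint hd, Submodule.mem_adjoint_iff,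
    hD.minOp_graph hQq hQ]
  constructor
  · intro h
    exact hD.exists_isMaxPair_of_orthogonal hQq hQ fun R hR =>
      sub_eq_zero.1 (h R.1 R.2 (Submodule.le_topologicalClosure _ hR))
  -- Annihilation is checked on L_0' and passes to the closure because it is a closed condition.
  · rintro ⟨x, g, h, hP⟩ y w hyw
    have h1 : (y, w) ∈ {R : BigL2 H × BigL2 H | ∀ P' ∈ ({P} : Set _), ⟪R.2, P'.1⟫_ℂ = ⟪R.1, P'.2⟫_ℂ} :=
      (closure_minimal (fun R hR => by
        rintro P' rfl
        obtain ⟨x', g', h', h1, h2⟩ := hD.exists_isMaxPair_of_mem_minGraph hQq hR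
        exact hD.isMaxPair_annihilates hQq hQ h1 h2 hP) (isClosed_annihilator _)) hyw
    exact sub_eq_zero.2 (h1 P rfl)

omit hD hQq hQ in
theorem exists_isMaxPair (A : H →ₗ.[ℂ] H) (Q : L2H H → L2H H) {x : H}
    {g : (opPow A (1 / 2)).domain} {h : L2H H} {Z : BigL2 H}
    (hZ : Represents A (toNeg (opPow A (1 / 4)) x) g h Z) : ∃ W, IsMaxPair A Q x g h (Z, W) :=
  ⟨WithLp.toLp 2 (h + Q Z.fst, WithLp.toLp 2 (-sol A (toNeg (opPow A (1 / 4)) x) g h 1,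
    solDeriv A (toNeg (opPow A (1 / 4)) x) g h 1 - Z.snd.fst)), hZ, rfl, rfl, rfl⟩

omit hQq hQ in
theorem exists_represents (x : H) (g : (opPow A (1 / 2)).domain) (h : L2H H) :
    ∃ Z : BigL2 H, Represents A (toNeg (opPow A (1 / 4)) x) g h Z :=
  ⟨WithLp.toLp 2 ((hD.memLp_sol x g h).toLp _,
    WithLp.toLp 2 (0, sol A (toNeg (opPow A (1 / 4)) x) g h 1)),
    (hD.memLp_sol x g h).coeFn_toLp, rfl⟩

theorem mem_minOp_graph {P : BigL2 H × BigL2 H} :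
    P ∈ (minOp A q).graph ↔ ∃ x g h, IsMaxPair A Q x g h P ∧
      ∀ i, solCoord b lam x g h i 0 = 0 ∧ solCoordDeriv b lam x g h i 0 = 0 := by
  classical
  rw [hD.minOp_graph hQq hQ]
  constructor
  · intro hP
    have h1 : ∀ {x' g' h' P'}, IsMaxPair A Q x' g' h' P' → ⟪P.2, P'.1⟫_ℂ = ⟪P.1, P'.2⟫_ℂ := by
      intro x' g' h' P' hP'
      have h1 : P ∈ {R : BigL2 H × BigL2 H | ∀ P' ∈ (maxOp A q).graph,
          ⟪R.2, P'.1⟫_ℂ = ⟪R.1, P'.2⟫_ℂ} :=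
        (closure_minimal (fun R hR P' hP' => by
          obtain ⟨x', g', h', h3⟩ := (hD.mem_maxOp_graph hQq hQ).1 hP'
          obtain ⟨x, g, h, h1, h2⟩ := hD.exists_isMaxPair_of_mem_minGraph hQq hR
          exact hD.isMaxPair_annihilates hQq hQ h1 h2 h3) (isClosed_annihilator _)) hP
      exact h1 P' ((hD.mem_maxOp_graph hQq hQ).2 ⟨x', g', h', hP'⟩)
    -- Elements of the graph of L_0' belong to the maximal graph, so P annihilates them and is
    -- itself represented.
    obtain ⟨x, g, h, hx⟩ := hD.exists_isMaxPair_of_orthogonal hQq hQ fun R hR => by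
      obtain ⟨x', g', h', h2, -⟩ := hD.exists_isMaxPair_of_mem_minGraph hQq hR
      exact inner_comm_of_annihilator (h1 h2)
    refine ⟨x, g, h, hx, fun i => ?_⟩
    have e0 : ∀ j, expConv (√(lam j)) (fun s => ⟪b j, (0 : L2H H) s⟫_ℂ) 0 = 0 := by
      intro j
      refine integral_eq_zero_of_ae ?_
      filter_upwards [Lp.coeFn_zero H 2 mu01] with t ht
      rw [ht]
      simp
    have hsum : ∀ (x' : H) (g' : (opPow A (1 / 2)).domain),
        (∀ j ≠ i, ⟪b j, x'⟫_ℂ = 0) → (∀ j ≠ i, ⟪b j, (g' : H)⟫_ℂ = 0) →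
        conj (solCoordDeriv b lam x g h i 0) * solCoord b lam x' g' 0 i 0 -
          conj (solCoord b lam x g h i 0) * solCoordDeriv b lam x' g' 0 i 0 = 0 := by
      intro x' g' hx' hg'
      obtain ⟨Z, hZ⟩ := hD.exists_represents x' g' 0
      obtain ⟨W, hW⟩ := exists_isMaxPair A Q hZ
      have s := hD.hasSum_green hQ hx hW
      rw [sub_eq_zero.2 (h1 hW)] at s
      refine (hasSum_single i fun j hj => ?_).unique s
      have f1 : solCoord b lam x' g' 0 j 0 = 0 := by
        rw [solCoord, scal_zero, e0, hx' j hj, hg' j hj]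
        simp
      have f2 : solCoordDeriv b lam x' g' 0 j 0 = 0 := by
        rw [solCoordDeriv, scalDeriv_zero, e0, hx' j hj, hg' j hj]
        simp
      rw [f1, f2, mul_zero, mul_zero, sub_zero]
    have hoff : ∀ j ≠ i, ⟪b j, b i⟫_ℂ = 0 := fun j hj => by rw [inner_basis b, if_neg hj]
    have hon : ⟪b i, b i⟫_ℂ = 1 := by rw [inner_basis b, if_pos rfl]
    -- Green's formula against exp(-√A t) applied to a multiple of `b i`, then against exp(-√A(1 -
    -- t)) `b i`. They give d + √λ_i s = 0 and d - √λ_i s = 0, hence s = d = 0.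
    have r1 := hsum (b i) 0 hoff (fun j _ => inner_zero_right _)
    have r2 := hsum 0 ⟨b i, hD.basis_mem_fnCalc_domain _ i⟩ (fun j _ => inner_zero_right _) hoff
    set s := conj (solCoord b lam x g h i 0) with hs
    set d := conj (solCoordDeriv b lam x g h i 0) with hd
    have hk : ((lam i ^ (1 / 4 : ℝ) : ℝ) : ℂ) ≠ 0 :=
      Complex.ofReal_ne_zero.2 (hD.rpow_quarter_pos i).ne'
    have hρ : (√(lam i) : ℂ) ≠ 0 := Complex.ofReal_ne_zero.2 (hD.sqrt_pos i).ne'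
    have hE : (Real.exp (-√(lam i)) : ℂ) ≠ 0 := Complex.ofReal_ne_zero.2 (Real.exp_pos _).ne'
    rw [solCoord, solCoordDeriv, scal_zero, scalDeriv_zero, e0] at r1 r2
    simp only [hon, ZeroMemClass.coe_zero, inner_zero_right, mul_zero, add_zero, mul_one,
      zero_add, neg_zero] at r1 r2
    have r3 : d + √(lam i) * s = 0 := by
      refine (mul_eq_zero.1 (?_ : ((lam i ^ (1 / 4 : ℝ) : ℝ) : ℂ) * _ = 0)).resolve_left hk
      linear_combination r1
    have r4 : d - √(lam i) * s = 0 := by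
      refine (mul_eq_zero.1 (?_ : (Real.exp (-√(lam i)) : ℂ) * _ = 0)).resolve_left hE
      linear_combination r2
    have s0 : s = 0 := by
      refine (mul_eq_zero.1 (?_ : (√(lam i) : ℂ) * s = 0)).resolve_left hρ
      linear_combination (r3 - r4) / 2
    have d0 : d = 0 := by linear_combination (r3 + r4) / 2
    exact ⟨(map_eq_zero _).1 s0, (map_eq_zero _).1 d0⟩
  · rintro ⟨x, g, h, hx, h0⟩
    refine mem_topologicalClosure_of_annihilator _ fun P' hP' => ?_
    obtain ⟨x', g', h', hx'⟩ := hD.exists_isMaxPair_of_orthogonal hQq hQ hP'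
    exact hD.isMaxPair_annihilates hQq hQ hx h0 hx'

end IsDiag

/-! ### Boundary values at zero -/

namespace IsDiag

variable {ι : Type*} {A : H →ₗ.[ℂ] H} {b : HilbertBasis ι ℂ H} {lam : ι → ℝ} (hD : IsDiag A b lam)

include hD

theorem rpow_three_quarters (i : ι) :
    lam i ^ (3 / 4 : ℝ) = √(lam i) * lam i ^ (1 / 4 : ℝ) := by
  rw [Real.sqrt_eq_rpow, ← Real.rpow_add (hD.pos i)]
  norm_num

theorem one_le_rpow_quarter (i : ι) : 1 ≤ lam i ^ (1 / 4 : ℝ) :=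
  Real.one_le_rpow (hD.one_lt i).le (by norm_num)

theorem norm_exp_mul_coord_le {t : ℝ} (ht : 0 ≤ t) (i : ι) (z : ℂ) :
    ‖(Real.exp (-(t * √(lam i))) : ℂ) * z‖ ≤ ‖z‖ := by
  rw [← abs_of_nonneg ht]
  exact norm_exp_mul_le (hD.sqrt_pos i).le t z

variable [Countable ι]

theorem norm_solCoord_le (x g : H) (h : L2H H) {t : ℝ} (ht : t ∈ Icc (0 : ℝ) 1) (i : ι) :
    ‖((lam i ^ (1 / 4 : ℝ) : ℝ) : ℂ)⁻¹ * solCoord b lam x g h i t‖ ≤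
      1 * ‖⟪b i, x⟫_ℂ‖ + (‖⟪b i, g⟫_ℂ‖ + ∫ s, ‖⟪b i, h s⟫_ℂ‖ ∂mu01) := by
  have h1 := hD.rpow_quarter_pos i
  have h2 := hD.one_le_rpow_quarter i
  have hh := integrable_coord (Lp.memLp h) (b i)
  have h3 : ∀ z : ℂ, ‖((lam i ^ (1 / 4 : ℝ) : ℝ) : ℂ)⁻¹ * z‖ ≤ ‖z‖ := by
    intro z
    rw [norm_mul, norm_inv, Complex.norm_real, Real.norm_of_nonneg h1.le]
    exact mul_le_of_le_one_left (norm_nonneg _) (inv_le_one_of_one_le₀ h2)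
  rw [solCoord, scal, add_assoc, mul_add, mul_add]
  refine (norm_add_le _ _).trans (add_le_add ?_ ((norm_add_le _ _).trans (add_le_add ?_ ?_)))
  · rw [mul_left_comm, inv_mul_cancel_left₀ (Complex.ofReal_ne_zero.2 h1.ne'), one_mul]
    exact hD.norm_exp_mul_coord_le ht.1 i _
  · exact (h3 _).trans (hD.norm_exp_mul_coord_le (sub_nonneg.2 ht.2) i _)
  · exact (h3 _).trans (norm_inv_mul_expConv_le (hD.one_le_sqrt i) hh t)

theorem norm_solCoordDeriv_le (x : H) (g : (opPow A (1 / 2)).domain) (h : L2H H) {t : ℝ}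
    (ht : t ∈ Icc (0 : ℝ) 1) (i : ι) :
    ‖((lam i ^ (3 / 4 : ℝ) : ℝ) : ℂ)⁻¹ * solCoordDeriv b lam x g h i t‖ ≤
      1 * ‖⟪b i, x⟫_ℂ‖ + (‖⟪b i, opPow A (1 / 2) g⟫_ℂ‖ + ∫ s, ‖⟪b i, h s⟫_ℂ‖ ∂mu01) := by
  have h1 := hD.rpow_quarter_pos i
  have h0 := hD.sqrt_pos i
  have h2 : 1 ≤ lam i ^ (3 / 4 : ℝ) := Real.one_le_rpow (hD.one_lt i).le (by norm_num)
  have hh := integrable_coord (Lp.memLp h) (b i)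
  have h3 : ∀ z : ℂ, ‖((lam i ^ (3 / 4 : ℝ) : ℝ) : ℂ)⁻¹ * z‖ ≤ ‖z‖ := by
    intro z
    rw [norm_mul, norm_inv, Complex.norm_real, Real.norm_of_nonneg (zero_le_one.trans h2)]
    exact mul_le_of_le_one_left (norm_nonneg _) (inv_le_one_of_one_le₀ h2)
  rw [solCoordDeriv, scalDeriv, add_assoc, mul_add, mul_add]
  refine (norm_add_le _ _).trans (add_le_add ?_ ((norm_add_le _ _).trans (add_le_add ?_ ?_)))
  · have e : ((lam i ^ (3 / 4 : ℝ) : ℝ) : ℂ)⁻¹ * -(√(lam i) * (Real.exp (-(t * √(lam i))) *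
        (((lam i ^ (1 / 4 : ℝ) : ℝ) : ℂ) * ⟪b i, x⟫_ℂ))) =
        -((Real.exp (-(t * √(lam i))) : ℂ) * ⟪b i, x⟫_ℂ) := by
      have n0 : (√(lam i) : ℂ) ≠ 0 := Complex.ofReal_ne_zero.2 h0.ne'
      have n1 : ((lam i ^ (1 / 4 : ℝ) : ℝ) : ℂ) ≠ 0 := Complex.ofReal_ne_zero.2 h1.ne'
      rw [hD.rpow_three_quarters, Complex.ofReal_mul]
      field_simp
    rw [e, norm_neg, one_mul]
    exact hD.norm_exp_mul_coord_le ht.1 i _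
  · refine (h3 _).trans ?_
    rw [mul_left_comm, hD.coord_opPow_half]
    exact hD.norm_exp_mul_coord_le (sub_nonneg.2 ht.2) i _
  · exact (h3 _).trans (norm_inv_mul_expConvDeriv_le (hD.one_le_sqrt i) hh t)

/-- A^(-1/4) z(t) has coordinates continuous up to t = 0 and bounded by a fixed square summable
sequence, so dominated convergence applies. -/
theorem exists_tendsto_sol (x : H) (g : (opPow A (1 / 2)).domain) (h : L2H H) :
    ∃ X : H, (∀ i, ((lam i ^ (1 / 4 : ℝ) : ℝ) : ℂ) * ⟪b i, X⟫_ℂ = solCoord b lam x g h i 0) ∧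
      TendstoNeg (sol A (toNeg (opPow A (1 / 4)) x) g h) (𝓝[>] 0) (toNeg (opPow A (1 / 4)) X) := by
  have hB := hD.summable_sq_bound 1 x (g : H) h
  have hn : ∀ i, ((lam i ^ (1 / 4 : ℝ) : ℝ) : ℂ) ≠ 0 := fun i =>
    Complex.ofReal_ne_zero.2 (hD.rpow_quarter_pos i).ne'
  have hex : ∀ t : ℝ, ∃ U : H, t ∈ Icc (0 : ℝ) 1 → ∀ i, ⟪b i, U⟫_ℂ =
      ((lam i ^ (1 / 4 : ℝ) : ℝ) : ℂ)⁻¹ * solCoord b lam x g h i t := by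
    intro t
    by_cases ht : t ∈ Icc (0 : ℝ) 1
    · obtain ⟨U, hU⟩ := exists_coord_of_le b hB (hD.norm_solCoord_le x g h ht)
      exact ⟨U, fun _ => hU⟩
    · exact ⟨0, fun h => absurd h ht⟩
  choose U hU using hex
  have m0 : (0 : ℝ) ∈ Icc (0 : ℝ) 1 := by simp
  have hev : ∀ᶠ t in 𝓝[>] (0 : ℝ), t ∈ Ioc (0 : ℝ) 1 := Ioc_mem_nhdsGT one_pos
  refine ⟨U 0, fun i => by rw [hU 0 m0, mul_inv_cancel_left₀ (hn i)],
    hD.tendstoNeg (U := U) ?_ (tendsto_of_coord b hB ?_ ?_ fun i => ?_)⟩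
  · filter_upwards [hev] with t ht i
    rw [hU t (Ioc_subset_Icc_self ht), mul_inv_cancel_left₀ (hn i)]
    exact hD.coord_sol x g h ht i
  · filter_upwards [hev] with t ht i
    rw [hU t (Ioc_subset_Icc_self ht)]
    exact hD.norm_solCoord_le x g h (Ioc_subset_Icc_self ht) i
  · intro i
    rw [hU 0 m0]
    exact hD.norm_solCoord_le x g h m0 i
  · rw [hU 0 m0]
    have hc := continuous_scal (hD.sqrt_pos i).le ((lam i ^ (1 / 4 : ℝ) : ℝ) * ⟪b i, x⟫_ℂ)
      ⟪b i, (g : H)⟫_ℂ (integrable_coord (Lp.memLp h) (b i))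
    refine Tendsto.congr' ?_
      (((hc.tendsto 0).mono_left nhdsWithin_le_nhds).const_mul ((lam i ^ (1 / 4 : ℝ) : ℝ) : ℂ)⁻¹)
    filter_upwards [hev] with t ht
    rw [hU t (Ioc_subset_Icc_self ht)]
    rfl

theorem exists_tendsto_solDeriv (x : H) (g : (opPow A (1 / 2)).domain) (h : L2H H) :
    ∃ X : H,
      (∀ i, ((lam i ^ (3 / 4 : ℝ) : ℝ) : ℂ) * ⟪b i, X⟫_ℂ = solCoordDeriv b lam x g h i 0) ∧
      TendstoNeg (solDeriv A (toNeg (opPow A (1 / 4)) x) g h) (𝓝[>] 0)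
        (toNeg (opPow A (3 / 4)) X) := by
  have hB := hD.summable_sq_bound 1 x (opPow A (1 / 2) g) h
  have hn : ∀ i, ((lam i ^ (3 / 4 : ℝ) : ℝ) : ℂ) ≠ 0 := fun i =>
    Complex.ofReal_ne_zero.2 (Real.rpow_pos_of_pos (hD.pos i) _).ne'
  have hex : ∀ t : ℝ, ∃ U : H, t ∈ Icc (0 : ℝ) 1 → ∀ i, ⟪b i, U⟫_ℂ =
      ((lam i ^ (3 / 4 : ℝ) : ℝ) : ℂ)⁻¹ * solCoordDeriv b lam x g h i t := by
    intro t
    by_cases ht : t ∈ Icc (0 : ℝ) 1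
    · obtain ⟨U, hU⟩ := exists_coord_of_le b hB (hD.norm_solCoordDeriv_le x g h ht)
      exact ⟨U, fun _ => hU⟩
    · exact ⟨0, fun h => absurd h ht⟩
  choose U hU using hex
  have m0 : (0 : ℝ) ∈ Icc (0 : ℝ) 1 := by simp
  have hev : ∀ᶠ t in 𝓝[>] (0 : ℝ), t ∈ Ioc (0 : ℝ) 1 := Ioc_mem_nhdsGT one_pos
  refine ⟨U 0, fun i => by rw [hU 0 m0, mul_inv_cancel_left₀ (hn i)],
    hD.tendstoNeg (U := U) ?_ (tendsto_of_coord b hB ?_ ?_ fun i => ?_)⟩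
  · filter_upwards [hev] with t ht i
    rw [hU t (Ioc_subset_Icc_self ht), mul_inv_cancel_left₀ (hn i)]
    exact (hD.hasDerivWithinAt_sol x g h ht).2 i
  · filter_upwards [hev] with t ht i
    rw [hU t (Ioc_subset_Icc_self ht)]
    exact hD.norm_solCoordDeriv_le x g h (Ioc_subset_Icc_self ht) i
  · intro i
    rw [hU 0 m0]
    exact hD.norm_solCoordDeriv_le x g h m0 i
  · rw [hU 0 m0]
    refine Tendsto.congr' ?_ ((tendsto_scalDeriv_zero (hD.sqrt_pos i).le
      ((lam i ^ (1 / 4 : ℝ) : ℝ) * ⟪b i, x⟫_ℂ) ⟪b i, (g : H)⟫_ℂ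
      (integrable_coord (Lp.memLp h) (b i))).const_mul ((lam i ^ (3 / 4 : ℝ) : ℝ) : ℂ)⁻¹)
    filter_upwards [hev] with t ht
    rw [hU t (Ioc_subset_Icc_self ht)]
    rfl

theorem toNeg_eq_zero_of_coord {s : ℝ} {X : H} (h : ∀ i, ⟪b i, X⟫_ℂ = 0) :
    toNeg (opPow A s) X = 0 := by
  have : X = 0 := coord_ext b fun i => by rw [h i, inner_zero_right]
  subst this
  refine Subtype.ext (LinearMap.ext fun v => ?_)
  rw [toNeg_apply, inner_zero_right]
  rfl

/-- The conditions `z(0) = 0` and `z'(0) = 0` in coordinates. -/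
theorem tendstoNeg_zero_iff (x : H) (g : (opPow A (1 / 2)).domain) (h : L2H H) :
    (TendstoNeg (sol A (toNeg (opPow A (1 / 4)) x) g h) (𝓝[>] 0)
        (0 : NegSpace (opPow A (1 / 4))) ∧
      TendstoNeg (solDeriv A (toNeg (opPow A (1 / 4)) x) g h) (𝓝[>] 0)
        (0 : NegSpace (opPow A (3 / 4)))) ↔
    ∀ i, solCoord b lam x g h i 0 = 0 ∧ solCoordDeriv b lam x g h i 0 = 0 := by
  obtain ⟨X, hX, tX⟩ := hD.exists_tendsto_sol x g h
  obtain ⟨Y, hY, tY⟩ := hD.exists_tendsto_solDeriv x g h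
  constructor
  · rintro ⟨h1, h2⟩ i
    have u1 := tendsto_nhds_unique (hD.tendsto_coord_of_tendstoNeg h1 i)
      (hD.tendsto_coord_of_tendstoNeg tX i)
    have u2 := tendsto_nhds_unique (hD.tendsto_coord_of_tendstoNeg h2 i)
      (hD.tendsto_coord_of_tendstoNeg tY i)
    rw [hD.toNeg_basis, hX] at u1
    rw [hD.toNeg_basis, hY] at u2
    exact ⟨u1.symm, u2.symm⟩
  · intro h0
    rw [hD.toNeg_eq_zero_of_coord fun i => (mul_eq_zero.1 ((hX i).trans (h0 i).1)).resolve_left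
      (Complex.ofReal_ne_zero.2 (hD.rpow_quarter_pos i).ne')] at tX
    rw [hD.toNeg_eq_zero_of_coord fun i => (mul_eq_zero.1 ((hY i).trans (h0 i).2)).resolve_left
      (Complex.ofReal_ne_zero.2 (Real.rpow_pos_of_pos (hD.pos i) _).ne')] at tY
    exact ⟨tX, tY⟩

/-- Cauchy–Schwarz with ρ∫exp(-2ρs)ds ≤ 1. The gain of the factor √λ_i is what puts the h-part of
Ã^(1/4)(z'(0) + Ã^(1/2) z(0)) in H. -/
theorem sq_norm_expConv_zero_le (h : L2H H) (i : ι) :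
    √(lam i) * ‖expConv (√(lam i)) (fun s => ⟪b i, h s⟫_ℂ) 0‖ ^ 2 ≤
      ∫ s, ‖⟪b i, h s⟫_ℂ‖ ^ 2 ∂mu01 := by
  have hh := Lp.memLp h
  have h0 := hD.sqrt_pos i
  have hE : MemLp (fun s : ℝ => Real.exp (-(s * √(lam i)))) (ENNReal.ofReal 2) mu01 := by
    refine MemLp.of_bound (Continuous.aestronglyMeasurable (by fun_prop)) 1 ?_
    filter_upwards [ae_mem_Ioo] with s hs
    rw [Real.norm_of_nonneg (Real.exp_pos _).le, Real.exp_le_one_iff, neg_nonpos]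
    exact mul_nonneg hs.1.le h0.le
  have hc : MemLp (fun s => ⟪b i, h s⟫_ℂ) (ENNReal.ofReal 2) mu01 := by
    have := hh.const_inner (𝕜 := ℂ) (b i)
    simpa using this
  have h1 : ‖expConv (√(lam i)) (fun s => ⟪b i, h s⟫_ℂ) 0‖ ≤
      ∫ s, Real.exp (-(s * √(lam i))) * ‖⟪b i, h s⟫_ℂ‖ ∂mu01 := by
    rw [← integral_mul_exp]
    refine (norm_integral_le_integral_norm _).trans (le_of_eq ?_)
    refine integral_congr_ae (ae_of_all _ fun s => ?_)
    simp only
    rw [norm_mul, Complex.norm_real, Real.norm_of_nonneg (Real.exp_pos _).le, mul_comm]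
  have h2 := integral_mul_le_Lp_mul_Lq_of_nonneg Real.HolderConjugate.two_two
    (ae_of_all _ fun s => (Real.exp_pos (-(s * √(lam i)))).le)
    (ae_of_all _ fun s => norm_nonneg ⟪b i, h s⟫_ℂ) hE hc.norm
  simp only [Real.rpow_two, ← Real.sqrt_eq_rpow] at h2
  set I := ∫ s, Real.exp (-(s * √(lam i))) ^ 2 ∂mu01 with hI
  set J := ∫ s, ‖⟪b i, h s⟫_ℂ‖ ^ 2 ∂mu01
  have hI0 : 0 ≤ I := integral_nonneg fun s => sq_nonneg _
  have hJ0 : 0 ≤ J := integral_nonneg fun s => sq_nonneg _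
  have h3 := pow_le_pow_left₀ (norm_nonneg _) (h1.trans h2) 2
  rw [mul_pow, Real.sq_sqrt hI0, Real.sq_sqrt hJ0] at h3
  have h4 := (integral_mul_exp_le √(lam i)).2
  rw [integral_mul_const] at h4
  calc _ ≤ √(lam i) * (I * J) := mul_le_mul_of_nonneg_left h3 h0.le
    _ = (I * √(lam i)) * J := by ring
    _ ≤ J := mul_le_of_le_one_left hJ0 h4

/-- The vector `A^(1/4) (z'(0) + A^(1/2) z(0))`. -/
theorem exists_coord_boundary (x : H) (g : (opPow A (1 / 2)).domain) (h : L2H H) :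
    ∃ X : H, ∀ i, ⟪b i, X⟫_ℂ = ((lam i ^ (1 / 4 : ℝ) : ℝ) : ℂ) *
      (solCoordDeriv b lam x g h i 0 + √(lam i) * solCoord b lam x g h i 0) := by
  refine exists_coord b ?_
  have S := ((summable_sq_coord b (opPow A (1 / 2) g)).mul_left 32).add
    ((summable_integral_sq_coord b (Lp.memLp h)).mul_left 2)
  refine S.of_nonneg_of_le (fun i => sq_nonneg _) fun i => ?_
  have h0 := hD.sqrt_pos i
  have n0 : (√(lam i) : ℂ) ≠ 0 := Complex.ofReal_ne_zero.2 h0.ne'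
  -- The terms in x cancel. The g-term keeps the factor exp(-√λ_i), which beats any power, and the
  -- h-term keeps only the convolution at 0.
  have e : ((lam i ^ (1 / 4 : ℝ) : ℝ) : ℂ) *
      (solCoordDeriv b lam x g h i 0 + √(lam i) * solCoord b lam x g h i 0) =
      ((lam i ^ (1 / 4 : ℝ) * (2 * Real.exp (-√(lam i))) : ℝ) : ℂ) * ⟪b i, opPow A (1 / 2) g⟫_ℂ -
        -(((lam i ^ (1 / 4 : ℝ) : ℝ) : ℂ) * expConv (√(lam i)) (fun s => ⟪b i, h s⟫_ℂ) 0) := by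
    rw [solCoord, solCoordDeriv, scal_zero, scalDeriv_zero, hD.coord_opPow_half]
    push_cast
    field_simp
    ring
  rw [e]
  refine (norm_sub_sq_le _ _).trans (add_le_add ?_ (mul_le_mul_of_nonneg_left ?_ zero_le_two))
  · rw [norm_mul, Complex.norm_real, mul_pow, Real.norm_eq_abs, sq_abs, mul_pow,
      hD.rpow_quarter_sq, ← mul_assoc]
    refine mul_le_mul_of_nonneg_right ?_ (sq_nonneg _)
    have h1 := exp_neg_le_div_sq h0
    have h2 : √(lam i) * Real.exp (-√(lam i)) ≤ 2 := by
      calc _ ≤ √(lam i) * (2 / √(lam i) ^ 2) := mul_le_mul_of_nonneg_left h1 h0.le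
        _ = 2 / √(lam i) := by field_simp
        _ ≤ 2 := by rw [div_le_iff₀ h0]; nlinarith [hD.one_le_sqrt i]
    have h3 : Real.exp (-√(lam i)) ≤ 1 := Real.exp_le_one_iff.2 (by linarith)
    nlinarith [Real.exp_pos (-√(lam i))]
  · rw [norm_neg, norm_mul, Complex.norm_real, mul_pow, Real.norm_eq_abs, sq_abs,
      hD.rpow_quarter_sq]
    exact hD.sq_norm_expConv_zero_le h i

/-! ### The differential expression -/

theorem isTildeL {Q : L2H H → L2H H} {q : ℝ → H →L[ℂ] H}
    (hQq : ∀ z, Q z =ᵐ[mu01] fun t => q t (z t)) {x : H} {g : (opPow A (1 / 2)).domain}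
    {h : L2H H} {P : BigL2 H × BigL2 H} (hP : IsMaxPair A Q x g h P) :
    IsTildeL A q P.1.fst P.2.fst := by
  intro φ hφ _ hs v
  obtain ⟨δ, hδ, h0⟩ := exists_forall_lt_eq_zero hs
  have c2 : Continuous (iteratedDeriv 2 φ) := hφ.continuous_iteratedDeriv 2
    (mod_cast le_top : ((2 : ℕ∞) : WithTop ℕ∞) ≤ ∞)
  have h1 : (1 : ℝ) ∉ tsupport φ := fun h' => (hs h').2.ne rfl
  have φ1 : φ 1 = 0 := image_eq_zero_of_notMem_tsupport h1
  have φ1' : deriv φ 1 = 0 := by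
    have e : φ =ᶠ[𝓝 1] fun _ => 0 := notMem_tsupport_iff_eventuallyEq.1 h1
    rw [e.deriv_eq, deriv_const]
  have hsm : ∀ {ψ : ℝ → ℝ}, Continuous ψ → ∀ {f : ℝ → H}, Integrable f mu01 →
      Integrable (fun t => (ψ t : ℂ) • f t) mu01 := by
    intro ψ hψ f hf
    obtain ⟨C, hC⟩ := isCompact_Icc.exists_bound_of_continuousOn (s := Icc (0 : ℝ) 1)
      (Complex.continuous_ofReal.comp hψ).continuousOn
    refine hf.bdd_smul C (Complex.continuous_ofReal.comp hψ).aestronglyMeasurable ?_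
    filter_upwards [ae_mem_Ioo] with t ht using hC t (Ioo_subset_Icc_self ht)
  set z := P.1.fst with hz
  have iz : Integrable z mu01 := (Lp.memLp z).integrable one_le_two
  have iq : Integrable (Q z) mu01 := (Lp.memLp (Q z)).integrable one_le_two
  have ih : Integrable h mu01 := (Lp.memLp h).integrable one_le_two
  have i2 := hsm c2 iz
  have i1 := hsm hφ.continuous iz
  have i3 := hsm hφ.continuous ih
  have i4 := hsm hφ.continuous iq
  -- The distributional equation without q, integrated against φ and paired with v. It holds
  -- coordinate by coordinate, with no boundary terms because φ also vanishes near 1.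
  have key : ⟪A v, ∫ t, (φ t : ℂ) • z t ∂mu01⟫_ℂ =
      ⟪(v : H), ∫ t, (φ t : ℂ) • h t ∂mu01 + ∫ t, ((iteratedDeriv 2 φ t : ℝ) : ℂ) • z t ∂mu01⟫_ℂ := by
    refine inner_eq_of_coord b fun i => ?_
    have hv := (hD.mem_graph _ _).1 (A.mem_graph v) i
    rw [← inner_conj_symm _ (b i), hv, ← inner_conj_symm _ (b i), inner_add_right,
      ← integral_inner i1, ← integral_inner i2, ← integral_inner i3]
    simp only [inner_smul_right, map_mul, Complex.conj_ofReal]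
    have hI := integral_test (hD.sqrt_pos i) hφ hδ h0 ((lam i ^ (1 / 4 : ℝ) : ℝ) * ⟪b i, x⟫_ℂ)
      ⟪b i, (g : H)⟫_ℂ (integrable_coord (Lp.memLp h) (b i))
    rw [φ1, φ1', Real.sq_sqrt (hD.pos i).le] at hI
    have e : ∫ t, ((-iteratedDeriv 2 φ t + lam i * φ t : ℝ) : ℂ) *
        scal (√(lam i)) ((lam i ^ (1 / 4 : ℝ) : ℝ) * ⟪b i, x⟫_ℂ) ⟪b i, (g : H)⟫_ℂ
          (fun s => ⟪b i, h s⟫_ℂ) t ∂mu01 =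
        lam i * ∫ t, (φ t : ℂ) * ⟪b i, z t⟫_ℂ ∂mu01 -
          ∫ t, ((iteratedDeriv 2 φ t : ℝ) : ℂ) * ⟪b i, z t⟫_ℂ ∂mu01 := by
      have j1 := i1.const_inner (𝕜 := ℂ) (b i)
      have j2 := i2.const_inner (𝕜 := ℂ) (b i)
      simp only [inner_smul_right] at j1 j2
      rw [← integral_const_mul, ← integral_sub (j1.const_mul _) j2]
      refine integral_congr_ae ?_
      filter_upwards [hD.coord_of_represents hP.represents] with t ht
      rw [hz, ht i, solCoord]
      push_cast
      ring
    rw [e] at hI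
    simp only [Complex.ofReal_zero, zero_mul, add_zero, sub_zero] at hI
    linear_combination (conj ⟪b i, (v : H)⟫_ℂ) * hI
  have e1 : ∫ t, (-(((iteratedDeriv 2 φ t : ℝ) : ℂ) * ⟪(v : H), z t⟫_ℂ) +
      (φ t : ℂ) * (tildeA A (z t)).1 v + (φ t : ℂ) * ⟪(v : H), q t (z t)⟫_ℂ) ∂mu01 =
      -⟪(v : H), ∫ t, ((iteratedDeriv 2 φ t : ℝ) : ℂ) • z t ∂mu01⟫_ℂ +
        ⟪A v, ∫ t, (φ t : ℂ) • z t ∂mu01⟫_ℂ + ⟪(v : H), ∫ t, (φ t : ℂ) • Q z t ∂mu01⟫_ℂ := by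
    have j2 : Integrable (fun t => -⟪(v : H), ((iteratedDeriv 2 φ t : ℝ) : ℂ) • z t⟫_ℂ) mu01 :=
      (i2.const_inner (v : H)).neg
    have j1 : Integrable (fun t => ⟪A v, (φ t : ℂ) • z t⟫_ℂ) mu01 := i1.const_inner (A v)
    have j4 : Integrable (fun t => ⟪(v : H), (φ t : ℂ) • Q z t⟫_ℂ) mu01 := i4.const_inner (v : H)
    have j3 : Integrable (fun t => -⟪(v : H), ((iteratedDeriv 2 φ t : ℝ) : ℂ) • z t⟫_ℂ +
      ⟪A v, (φ t : ℂ) • z t⟫_ℂ) mu01 := j2.add j1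
    rw [← integral_inner i2, ← integral_inner i1, ← integral_inner i4, ← integral_neg,
      ← integral_add j2 j1, ← integral_add j3 j4]
    refine integral_congr_ae ?_
    filter_upwards [hQq z] with t ht
    rw [ht]
    simp only [inner_smul_right]
    rfl
  have e2 : ∫ t, (φ t : ℂ) * ⟪(v : H), P.2.fst t⟫_ℂ ∂mu01 =
      ⟪(v : H), ∫ t, (φ t : ℂ) • h t ∂mu01⟫_ℂ + ⟪(v : H), ∫ t, (φ t : ℂ) • Q z t ∂mu01⟫_ℂ := by
    rw [← integral_inner i3, ← integral_inner i4,
      ← integral_add (i3.const_inner (v : H)) (i4.const_inner (v : H))]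
    refine integral_congr_ae ?_
    rw [hP.image_fst]
    filter_upwards [Lp.coeFn_add h (Q z)] with t ht
    rw [ht]
    simp only [Pi.add_apply, inner_add_right, inner_smul_right, mul_add]
  rw [e1, e2, key, inner_add_right]
  ring

end IsDiag

/-! ### Composition of powers and the regularized boundary values -/

namespace IsDiag

variable {ι : Type*} {A : H →ₗ.[ℂ] H} {b : HilbertBasis ι ℂ H} {lam : ι → ℝ} (hD : IsDiag A b lam)

include hD

/-- Boundedness of A^(-s) keeps all intermediate domains under control. With p = 3/4 it gives
meaning to Ã^(1/2) z(0) as the functional v ↦ z(0)(A^(1/2) v) on D(A^(3/4)). -/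
theorem opPow_opPow {r s p : ℝ} (hrs : p = r + s) (hs : 0 ≤ s) (v : (opPow A p).domain) :
    ∃ (hv : (v : H) ∈ (opPow A r).domain) (hv' : opPow A r ⟨v, hv⟩ ∈ (opPow A s).domain),
      opPow A s ⟨opPow A r ⟨v, hv⟩, hv'⟩ = opPow A p v := by
  subst hrs
  have hv0 : ∀ i, ⟪b i, opPow A (r + s) v⟫_ℂ = ((lam i ^ (r + s) : ℝ) : ℂ) * ⟪b i, (v : H)⟫_ℂ :=
    fun i => hD.coord_fnCalc v i
  obtain ⟨y, hy⟩ := hD.exists_opPow_eq hs (opPow A (r + s) v)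
  have hy0 : ∀ i, ((lam i ^ s : ℝ) : ℂ) * ⟪b i, (y : H)⟫_ℂ =
      ((lam i ^ (r + s) : ℝ) : ℂ) * ⟪b i, (v : H)⟫_ℂ := fun i => by
    rw [← hv0 i, ← hy]
    exact (hD.coord_fnCalc y i).symm
  have hyr : ∀ i, ⟪b i, (y : H)⟫_ℂ = ((lam i ^ r : ℝ) : ℂ) * ⟪b i, (v : H)⟫_ℂ := fun i => by
    refine mul_left_cancel₀ (Complex.ofReal_ne_zero.2 (Real.rpow_pos_of_pos (hD.pos i) s).ne') ?_
    rw [hy0 i, Real.rpow_add (hD.pos i)]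
    push_cast
    ring
  have hv : (v : H) ∈ (opPow A r).domain := hD.mem_fnCalc_domain.2 ⟨y, hyr⟩
  have e : opPow A r ⟨v, hv⟩ = y :=
    coord_ext b fun i => (hD.coord_fnCalc ⟨v, hv⟩ i).trans (hyr i).symm
  refine ⟨hv, e ▸ y.2, ?_⟩
  rw [← hy]
  congr 1
  exact Subtype.ext e

variable [Countable ι]

theorem exists_boundary_values (x : H) (g : (opPow A (1 / 2)).domain) (h : L2H H) :
    ∃ (z0 : NegSpace (opPow A (1 / 4))) (d0 z0' : NegSpace (opPow A (3 / 4))),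
      TendstoNeg (sol A (toNeg (opPow A (1 / 4)) x) g h) (𝓝[>] 0) z0 ∧
      TendstoNeg (solDeriv A (toNeg (opPow A (1 / 4)) x) g h) (𝓝[>] 0) d0 ∧
      (∀ v : (opPow A (3 / 4)).domain,
        ∃ (hv : (v : H) ∈ (opPow A (1 / 2)).domain)
          (hv' : opPow A (1 / 2) ⟨v, hv⟩ ∈ (opPow A (1 / 4)).domain),
          z0'.1 v = d0.1 v + z0.1 ⟨opPow A (1 / 2) ⟨v, hv⟩, hv'⟩) ∧
      (∃ y : H, IsExtApply A (fun μ => μ ^ (-(1 / 4) : ℝ)) z0 y) ∧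
      ∃ y' : H, IsExtApply A (fun μ => μ ^ (1 / 4 : ℝ)) z0' y' := by
  obtain ⟨X, hX, tX⟩ := hD.exists_tendsto_sol x g h
  obtain ⟨Y, hY, tY⟩ := hD.exists_tendsto_solDeriv x g h
  obtain ⟨V, hV⟩ := hD.exists_coord_boundary x g h
  -- Here z(0) = Ã^(1/4) X and z'(0) = Ã^(3/4) Y, so z'(0) + Ã^(1/2) z(0) = Ã^(3/4)(Y + X).
  refine ⟨_, _, toNeg (opPow A (3 / 4)) (Y + X), tX, tY, fun v => ?_,
    ⟨X, hD.isExtApply_iff.2 fun i => ?_⟩, ⟨V, hD.isExtApply_iff.2 fun i => ?_⟩⟩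
  · obtain ⟨hv, hv', e⟩ := hD.opPow_opPow (r := 1 / 2) (s := 1 / 4) (by norm_num) (by norm_num) v
    refine ⟨hv, hv', ?_⟩
    rw [toNeg_apply, toNeg_apply, toNeg_apply, e, inner_add_right]
  · rw [← mul_assoc, ← Complex.ofReal_mul, ← Real.rpow_add (hD.pos i)]
    norm_num
  · rw [hV, inner_add_right, mul_add ((lam i ^ (3 / 4 : ℝ) : ℝ) : ℂ), hY, ← hX,
      hD.rpow_three_quarters, Complex.ofReal_mul, mul_assoc]

end IsDiag

end OpDiff

end

/-! ### Assembly of the lemma -/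

theorem lemma2p2 {H : Type*} [NormedAddCommGroup H] [InnerProductSpace ℂ H] [CompleteSpace H]
    [TopologicalSpace.SeparableSpace H]
    (A : H →ₗ.[ℂ] H) (hA : IsSelfAdjoint A)
    (hAI : ∀ x : A.domain, x ≠ 0 → ‖(x : H)‖ ^ 2 < (⟪A x, (x : H)⟫_ℂ).re)
    (hAc : OpDiff.HasCompactInverse A)
    (q : ℝ → H →L[ℂ] H)
    (hqm : ∀ x : H, AEStronglyMeasurable (fun t => q t x) OpDiff.mu01)
    (hqs : ∀ t ∈ Ioo (0 : ℝ) 1, IsSelfAdjoint (q t))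
    (hqb : ∃ C : ℝ, ∀ t ∈ Ioo (0 : ℝ) 1, ‖q t‖ ≤ C) :
    -- every choice of the parameters gives a function in `L_2(H, (0,1))`, differentiable on `(0,1]`
    (∀ f g h, MemLp (OpDiff.sol A f g h) 2 OpDiff.mu01 ∧
      DifferentiableOn ℝ (OpDiff.sol A f g h) (Ioc 0 1)) ∧
    -- the domain of the maximal operator
    (∀ Z : OpDiff.BigL2 H, Z ∈ (OpDiff.maxOp A q).domain ↔
      ∃ f g h, OpDiff.Represents A f g h Z) ∧
    -- its action
    (∀ (Z : (OpDiff.maxOp A q).domain) f g h, OpDiff.Represents A f g h (Z : OpDiff.BigL2 H) →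
      OpDiff.IsTildeL A q (Z : OpDiff.BigL2 H).fst (OpDiff.maxOp A q Z).fst ∧
      (OpDiff.maxOp A q Z).snd.fst = -OpDiff.sol A f g h 1 ∧
      (OpDiff.maxOp A q Z).snd.snd =
        OpDiff.solDeriv A f g h 1 - (Z : OpDiff.BigL2 H).snd.fst) ∧
    -- the domain of the minimal operator: `z(0) = 0` and `z'(0) = 0`
    (∀ Z : OpDiff.BigL2 H, Z ∈ (OpDiff.minOp A q).domain ↔
      Z ∈ (OpDiff.maxOp A q).domain ∧ ∃ f g h, OpDiff.Represents A f g h Z ∧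
        OpDiff.TendstoNeg (OpDiff.sol A f g h) (𝓝[>] 0)
          (0 : OpDiff.NegSpace (OpDiff.opPow A (1 / 4))) ∧
        OpDiff.TendstoNeg (OpDiff.solDeriv A f g h) (𝓝[>] 0)
          (0 : OpDiff.NegSpace (OpDiff.opPow A (3 / 4)))) ∧
    -- the boundary values `z0 = z(0)`, `z0' = z'(0) + Ã^(1/2) z(0)` and their regularizations
    (∀ f g h, ∃ (z0 : OpDiff.NegSpace (OpDiff.opPow A (1 / 4)))
        (d0 z0' : OpDiff.NegSpace (OpDiff.opPow A (3 / 4))),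
      OpDiff.TendstoNeg (OpDiff.sol A f g h) (𝓝[>] 0) z0 ∧
      OpDiff.TendstoNeg (OpDiff.solDeriv A f g h) (𝓝[>] 0) d0 ∧
      (∀ v : (OpDiff.opPow A (3 / 4)).domain,
        ∃ (hv : (v : H) ∈ (OpDiff.opPow A (1 / 2)).domain)
          (hv' : OpDiff.opPow A (1 / 2) ⟨v, hv⟩ ∈ (OpDiff.opPow A (1 / 4)).domain),
          z0'.1 v = d0.1 v + z0.1 ⟨OpDiff.opPow A (1 / 2) ⟨v, hv⟩, hv'⟩) ∧
      (∃ x : H, OpDiff.IsExtApply A (fun μ => μ ^ (-(1 / 4) : ℝ)) z0 x) ∧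
      ∃ x' : H, OpDiff.IsExtApply A (fun μ => μ ^ (1 / 4 : ℝ)) z0' x') := by
  obtain ⟨ι, b, lam, hD⟩ := OpDiff.exists_isDiag hA hAI hAc
  have : Countable ι := OpDiff.countable_of_hilbertBasis b
  obtain ⟨Q, hQq, hQ⟩ := OpDiff.exists_mulOp b hqm hqs hqb
  have hrep := hD.exists_toNeg (s := 1 / 4) (by norm_num)
  have hdom : ∀ Z : OpDiff.BigL2 H, Z ∈ (OpDiff.maxOp A q).domain ↔
      ∃ f g h, OpDiff.Represents A f g h Z := by
    intro Z
    rw [LinearPMap.mem_domain_iff]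
    constructor
    · rintro ⟨W, hW⟩
      obtain ⟨x, g, h, hP⟩ := (hD.mem_maxOp_graph hQq hQ).1 hW
      exact ⟨_, g, h, hP.represents⟩
    · rintro ⟨f, g, h, hZ⟩
      obtain ⟨x, rfl⟩ := hrep f
      obtain ⟨W, hW⟩ := OpDiff.IsDiag.exists_isMaxPair A Q hZ
      exact ⟨W, (hD.mem_maxOp_graph hQq hQ).2 ⟨x, g, h, hW⟩⟩
  refine ⟨fun f g h => ?_, hdom, fun Z f g h hZ => ?_, fun Z => ⟨fun hZ => ?_, ?_⟩, fun f g h => ?_⟩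
  · obtain ⟨x, rfl⟩ := hrep f
    exact ⟨hD.memLp_sol x g h, fun t ht =>
      (hD.hasDerivWithinAt_sol x g h ht).1.differentiableWithinAt⟩
  · obtain ⟨x, rfl⟩ := hrep f
    obtain ⟨W, hW⟩ := OpDiff.IsDiag.exists_isMaxPair A Q hZ
    have hm := (hD.mem_maxOp_graph hQq hQ).2 ⟨x, g, h, hW⟩
    -- The maximal operator is single-valued, so its value at Z is the W built from any chosen
    -- representation of Z.
    obtain ⟨Z', e1, e2⟩ := ((OpDiff.maxOp A q).mem_graph_iff).1 hm
    obtain rfl : Z' = Z := Subtype.ext e1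
    subst e2
    have h1 := hD.isTildeL hQq hW
    have h2 := hW.image_snd
    have h3 := hW.image_trd
    exact ⟨h1, h2, h3⟩
  · obtain ⟨W, hW⟩ := LinearPMap.mem_domain_iff.1 hZ
    obtain ⟨x, g, h, hP, h0⟩ := (hD.mem_minOp_graph hQq hQ).1 hW
    exact ⟨(hdom Z).2 ⟨_, g, h, hP.represents⟩, _, g, h, hP.represents,
      (hD.tendstoNeg_zero_iff x g h).2 h0⟩
  · rintro ⟨-, f, g, h, hZ, h0⟩
    obtain ⟨x, rfl⟩ := hrep f
    obtain ⟨W, hW⟩ := OpDiff.IsDiag.exists_isMaxPair A Q hZ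
    exact LinearPMap.mem_domain_iff.2 ⟨W, (hD.mem_minOp_graph hQq hQ).2
      ⟨x, g, h, hW, (hD.tendstoNeg_zero_iff x g h).1 h0⟩⟩
  · obtain ⟨x, rfl⟩ := hrep f
    exact hD.exists_boundary_values x g h
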